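/- Conventions. All Hilbert spaces are finite-dimensional and logarithms are to base 2. A subnormalized state on $\mathcal H$ is a positive semidefinite operator $\rho$ with $\operatorname{tr}\rho\le 1$; the set of these is $\mathcal P_{\le}(\mathcal H)$. For subnormalized states the purified distance is $P(\rho,\sigma)=\sqrt{1-F_*(\rho,\sigma)^2}$ with $F_*(\rho,\sigma)=\|\sqrt\rho\sqrt\sigma\|_1+\sqrt{(1-\operatorname{tr}\rho)(1-\operatorname{tr}\sigma)}$. For a subnormalized state $\rho_{XY}$ on $\mathcal H_X\otimes\mathcal H_Y$, $$H_{\min}(X|Y)_\rho=\sup_{\sigma\in\mathcal P_{\le}(\mathcal H_Y)}\bigl(-\inf\{\lambda\in\mathbb R:\rho_{XY}\le 2^\lambda\, I_X\otimes\sigma\}\bigr)\in[-\infty,\infty],$$ $$H^\varepsilon_{\min}(X|Y)_\rho=\sup\{H_{\min}(X|Y)_{\tau}:\tau\in\mathcal P_{\le}(\mathcal H_X\otimes\mathcal H_Y),\ P(\tau,\rho_{XY})\le\varepsilon\};$$ for a state of a larger system these refer to its reduced state $\rho_{XY}$. Let $G=(V,E)$ be a finite graph, $V=V_\partial\sqcup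 V_b$ a partition into boundary and bulk vertices, $A\subseteq V_\partial$ and $\bar A=V_\partial\setminus A$. Each edge $e$ has a bond dimension $D_e$, each half-edge $(e,x)$ (with $x$ an endpoint of $e$) carries $\mathcal H_{e,x}=\mathbb C^{D_e}$, a set of half-edges carries the tensor product of their spaces, $\mathcal H_e=\bigotimes_{x\in e}\mathcal H_{e,x}$, a set $B\subseteq V$ stands for the set of all half-edges $(e,x)$ with $x\in B$, and $\mathcal H_V$ is the tensor product over all half-edges. Let $\gamma_{A,1}$ and $\gamma_{A,2}$ be the sets of edges incident to $A$ and to $\bar A$ respectively, assume $\gamma_{A,1}\cap\gamma_{A,2}=\emptyset$, and let $E_b=E\setminus(\gamma_{A,1}\cup\gamma_{A,2})$. Let $C(A)=\{\Delta_A\subseteq V:\Delta_A\cap V_\partial=A\}$ be the set of cuts for $A$, and for $\Delta_A\in C(A)$ let $$Y^{\Delta_A}=\{(e,x): e=(xy),\ x\in V\setminus\Delta_A,\ y\in A\}.$$ Statement. Let $\varepsilon\ge 0$ and let $\phi=|\phi\rangle\langle\phi|\in\mathcal P_{\le}(\mathcal H_V)$ be a pure subnormalized state with $$|\phi\rangle=|\phi_{\gamma_{A,1}}\rangle\otimes|\phi_{\gamma_{A,2}}\rangle\otimes\bigotimes_{e\in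 E_b}|\phi_e\rangle,$$ where $|\phi_e\rangle\in\mathcal H_e$ is arbitrary for $e\in E_b$, and where for $i=1,2$ the vector $|\phi_{\gamma_{A,i}}\rangle$ has a Schmidt decomposition in the standard basis along the half-edges, that is, $$|\phi_{\gamma_{A,i}}\rangle=\sum_{I=(I_e)_{e\in\gamma_{A,i}}}\sqrt{\lambda^{(i)}_I}\ \bigotimes_{e\in\gamma_{A,i}}|I_eI_e\rangle\qquad\text{with all }\lambda^{(i)}_I\ge 0.$$ Then there exists a state $\phi^\varepsilon\in\mathcal P_{\le}(\mathcal H_V)$ such that $$P(\phi,\phi^\varepsilon)\le 2\sqrt{2^{|V_b|}\,\varepsilon}$$ and, for all cuts $\Delta_A\in C(A)$ simultaneously, $$H_{\min}(\Delta_A\setminus A\,|\,A)_{\phi^\varepsilon}\ \ge\ H^{\varepsilon}_{\min}(\Delta_A\setminus A\,|\,A\,Y^{\Delta_A})_{\phi}.$$ -/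

import Mathlib

open scoped Kronecker ComplexOrder

noncomputable section

/-! ## Finite-dimensional quantum states, purified distance, conditional min-entropy -/

/-- `ρ` is a subnormalized state: positive semidefinite with trace at most one. -/
def IsSubState {m : Type*} [Fintype m] (ρ : Matrix m m ℂ) : Prop :=
  ρ.PosSemidef ∧ ρ.trace.re ≤ 1

/-- The pure state `|v⟩⟨v|`. -/
def pureState {m : Type*} (v : m → ℂ) : Matrix m m ℂ :=
  Matrix.vecMulVec v (star v)

open scoped MatrixOrder in
/-- The positive semidefinite square root of a positive semidefinite matrix. -/
def psdSqrt {m : Type*} [Fintype m] [DecidableEq m] (M : Matrix m m ℂ) : Matrix m m ℂ :=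
  CFC.sqrt M

/-- The Schatten 1-norm `tr √(Mᴴ M)`. -/
def traceNorm {m : Type*} [Fintype m] [DecidableEq m] (M : Matrix m m ℂ) : ℝ :=
  (psdSqrt (M.conjTranspose * M)).trace.re

/-- The fidelity `‖√ρ √σ‖₁`. -/
def fidelity {m : Type*} [Fintype m] [DecidableEq m] (ρ σ : Matrix m m ℂ) : ℝ :=
  traceNorm (psdSqrt ρ * psdSqrt σ)

/-- The generalized fidelity of subnormalized states. -/
def generalizedFidelity {m : Type*} [Fintype m] [DecidableEq m] (ρ σ : Matrix m m ℂ) : ℝ :=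
  fidelity ρ σ + √((1 - ρ.trace.re) * (1 - σ.trace.re))

/-- The purified distance of subnormalized states. -/
def purifiedDistance {m : Type*} [Fintype m] [DecidableEq m] (ρ σ : Matrix m m ℂ) : ℝ :=
  √(1 - generalizedFidelity ρ σ ^ 2)

/-- `H_min(A|B)_{ρ|σ} = - inf {t : ρ ≤ 2^t (I ⊗ σ)}` (Loewner order), with values in `[-∞, ∞]`;
the first factor `m` labels a basis of `A`, the second factor `n` a basis of `B`. -/
def condMinEntropyRel {m n : Type*} [Fintype m] [DecidableEq m] [Fintype n]
    (ρ : Matrix (m × n) (m × n) ℂ) (σ : Matrix n n ℂ) : EReal :=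
  - sInf {x : EReal | ∃ t : ℝ, x = (t : EReal) ∧
      ((((2 : ℝ) ^ t : ℝ) : ℂ) • ((1 : Matrix m m ℂ) ⊗ₖ σ) - ρ).PosSemidef}

/-- The conditional min-entropy `H_min(A|B)_ρ`. -/
def condMinEntropy {m n : Type*} [Fintype m] [DecidableEq m] [Fintype n]
    (ρ : Matrix (m × n) (m × n) ℂ) : EReal :=
  sSup {x : EReal | ∃ σ : Matrix n n ℂ, IsSubState σ ∧ x = condMinEntropyRel ρ σ}

/-- The smooth conditional min-entropy `H_min^ε(A|B)_ρ`. -/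
def smoothCondMinEntropy {m n : Type*} [Fintype m] [DecidableEq m] [Fintype n] [DecidableEq n]
    (ε : ℝ) (ρ : Matrix (m × n) (m × n) ℂ) : EReal :=
  sSup {x : EReal | ∃ τ : Matrix (m × n) (m × n) ℂ,
    IsSubState τ ∧ purifiedDistance τ ρ ≤ ε ∧ x = condMinEntropy τ}

/-! ## Tensor networks: half-edges and their Hilbert spaces -/

/-- A half-edge `(e, x)`: an edge `e` with one of its endpoints `x`. -/
@[ext]
structure HalfEdge {V : Type*} (G : SimpleGraph V) where
  edge : G.edgeSet
  vertex : V
  mem : vertex ∈ (edge : Sym2 V)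

instance HalfEdge.instFinite {V : Type*} [Finite V] (G : SimpleGraph V) :
    Finite (HalfEdge G) :=
  Finite.of_injective (fun h : HalfEdge G => (h.edge, h.vertex)) (by
    intro a b hab
    simp only [Prod.mk.injEq] at hab
    exact HalfEdge.ext hab.1 hab.2)

/-- The standard basis of `H_S = ⨂_{(e,x) ∈ S} ℂ^{D e}`, for a set `S` of half-edges. -/
def Config {V : Type*} {G : SimpleGraph V} (D : G.edgeSet → ℕ) (S : Set (HalfEdge G)) : Type _ :=
  (h : S) → Fin (D h.1.edge)

/-- The standard basis of the Hilbert space `H_V` of all half-edges. -/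
def FullConfig {V : Type*} {G : SimpleGraph V} (D : G.edgeSet → ℕ) : Type _ :=
  (h : HalfEdge G) → Fin (D h.edge)

instance Config.instFinite {V : Type*} [Finite V] {G : SimpleGraph V} (D : G.edgeSet → ℕ)
    (S : Set (HalfEdge G)) : Finite (Config D S) :=
  inferInstanceAs (Finite ((h : S) → Fin (D h.1.edge)))

instance FullConfig.instFinite {V : Type*} [Finite V] {G : SimpleGraph V} (D : G.edgeSet → ℕ) :
    Finite (FullConfig D) :=
  inferInstanceAs (Finite ((h : HalfEdge G) → Fin (D h.edge)))

instance Config.instFintype {V : Type*} [Finite V] {G : SimpleGraph V} (D : G.edgeSet → ℕ)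
    (S : Set (HalfEdge G)) : Fintype (Config D S) :=
  Fintype.ofFinite _

instance FullConfig.instFintype {V : Type*} [Finite V] {G : SimpleGraph V} (D : G.edgeSet → ℕ) :
    Fintype (FullConfig D) :=
  Fintype.ofFinite _

instance Config.instDecidableEq {V : Type*} {G : SimpleGraph V} (D : G.edgeSet → ℕ)
    (S : Set (HalfEdge G)) : DecidableEq (Config D S) :=
  Classical.decEq _

instance FullConfig.instDecidableEq {V : Type*} {G : SimpleGraph V} (D : G.edgeSet → ℕ) :
    DecidableEq (FullConfig D) :=
  Classical.decEq _

/-- Restriction of a basis label to the half-edges in `S`. -/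
def FullConfig.restrict {V : Type*} {G : SimpleGraph V} {D : G.edgeSet → ℕ} (c : FullConfig D)
    (S : Set (HalfEdge G)) : Config D S :=
  fun h => c h.1

open scoped Classical in
/-- The basis label of `H_V` with the given parts on the disjoint sets `S`, `T` and on the
remaining half-edges. -/
def glue {V : Type*} {G : SimpleGraph V} {D : G.edgeSet → ℕ} {S T : Set (HalfEdge G)}
    (a : Config D S) (b : Config D T) (c : Config D (S ∪ T)ᶜ) : FullConfig D :=
  fun h =>
    if hS : h ∈ S then a ⟨h, hS⟩
    else if hT : h ∈ T then b ⟨h, hT⟩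
    else c ⟨h, fun hST => hST.elim hS hT⟩

/-- The reduced state `ρ_{ST} = tr_{(S ∪ T)ᶜ} ρ` of a state `ρ` of `H_V` on two disjoint sets of
half-edges, as an operator on `H_S ⊗ H_T`. -/
def reducedState {V : Type*} [Finite V] {G : SimpleGraph V} {D : G.edgeSet → ℕ}
    (S T : Set (HalfEdge G)) (ρ : Matrix (FullConfig D) (FullConfig D) ℂ) :
    Matrix (Config D S × Config D T) (Config D S × Config D T) ℂ :=
  fun p q => ∑ c : Config D (S ∪ T)ᶜ, ρ (glue p.1 p.2 c) (glue q.1 q.2 c)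

/-! ## Cuts, and the sets of edges and half-edges in the transition lemma -/

/-- `C(A)`: the vertex sets that meet the boundary exactly in `A`. -/
def cuts {V : Type*} (bdry A : Set V) : Set (Set V) :=
  {Δ | Δ ∩ bdry = A}

/-- The half-edges at the vertices in `B`; they carry `H_B = ⨂_{x ∈ B} H_x`. -/
def halfEdgesAt {V : Type*} (G : SimpleGraph V) (B : Set V) : Set (HalfEdge G) :=
  {h | h.vertex ∈ B}

/-- The half-edges of the edges in `γ`; they carry `H_γ = ⨂_{e ∈ γ} H_e`. -/
def halfEdgesOf {V : Type*} {G : SimpleGraph V} (γ : Set G.edgeSet) : Set (HalfEdge G) :=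
  {h | h.edge ∈ γ}

/-- The edges incident to `B`. -/
def incidentEdges {V : Type*} (G : SimpleGraph V) (B : Set V) : Set G.edgeSet :=
  {e | ∃ x ∈ B, x ∈ (e : Sym2 V)}

/-- `Y^Δ`: the half-edges `(e, x)` with `e = (xy)`, `x ∉ Δ` and `y ∈ A`. -/
def outerHalfEdges {V : Type*} (G : SimpleGraph V) (A Δ : Set V) : Set (HalfEdge G) :=
  {h | h.vertex ∉ Δ ∧ ∃ y ∈ A, (h.edge : Sym2 V) = s(h.vertex, y)}

/-- The label of the basis vector `⨂_{e ∈ γ} |I_e I_e⟩` of `H_γ`. -/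
def diagConfig {V : Type*} {G : SimpleGraph V} {D : G.edgeSet → ℕ} (γ : Set G.edgeSet)
    (I : (e : γ) → Fin (D e.1)) : Config D (halfEdgesOf γ) :=
  fun h => I ⟨h.1.edge, h.2⟩

open scoped Classical in
/-- The vector `v ∈ H_γ` has a Schmidt decomposition in the standard basis along the half-edges:
`v = ∑_I √(lam I) ⨂_{e ∈ γ} |I_e I_e⟩`, where `I = (I_e)_{e ∈ γ}` and `lam I ≥ 0`. -/
def HasStandardSchmidt {V : Type*} [Fintype V] {G : SimpleGraph V} {D : G.edgeSet → ℕ}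
    (γ : Set G.edgeSet) (v : Config D (halfEdgesOf γ) → ℂ) : Prop :=
  ∃ lam : ((e : γ) → Fin (D e.1)) → ℝ, (∀ I, 0 ≤ lam I) ∧
    v = ∑ I : (e : γ) → Fin (D e.1),
      ((√(lam I) : ℝ) : ℂ) • (Pi.single (diagConfig γ I) 1 : Config D (halfEdgesOf γ) → ℂ)

open scoped Classical in
/-- The vector `v₁ ⊗ v₂ ⊗ ⨂_{e ∉ γ₁ ∪ γ₂} w_e` of `H_V`, for disjoint sets of edges `γ₁`, `γ₂`
(the factors `w_e` with `e ∈ γ₁ ∪ γ₂` are not used). -/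
def backgroundVector {V : Type*} [Fintype V] {G : SimpleGraph V} {D : G.edgeSet → ℕ}
    (γ₁ γ₂ : Set G.edgeSet) (v₁ : Config D (halfEdgesOf γ₁) → ℂ)
    (v₂ : Config D (halfEdgesOf γ₂) → ℂ)
    (w : (e : G.edgeSet) → Config D (halfEdgesOf {e}) → ℂ) : FullConfig D → ℂ :=
  fun c => v₁ (c.restrict _) * v₂ (c.restrict _) *
    ∏ e : ((γ₁ ∪ γ₂)ᶜ : Set G.edgeSet), w e.1 (c.restrict _)

end

/-! In bases adapted to the edges, the network state is a superposition `∑ J, √(μ J) • B.fullVec J`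
of orthonormal product vectors in which both ends of an edge carry the same label. On γ₁ and γ₂ (the
edges at `A` and at `bdry \ A`) this is the assumed Schmidt form; on every other edge it is a
singular value decomposition (`exists_backgroundVector_eq_sum`).

Fix a cut Δ and let n, i, j, k, o, l be the labels of the edges inside A, from A to Δ \ A, from A to
Δᶜ, from Δ \ A to Δᶜ, inside Δᶜ and inside Δ \ A. Because γ₁ and γ₂ are disjoint and Δ contains no
boundary vertex outside A, the weight factorizes as μ = λ(n,i,j) q(k,o) χ(l). If A is kept together
with Y, the traced-out half-edges see only k and o, so the reduced state is coherent in j. If A is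
kept alone, they also see j, and the reduced state becomes a mixture over j.

The core is that quantum smoothing can be replaced by a classical filter f(i,j,k). Let τ ≤ t (I ⊗ σ)
be ε-close to the reduced state with Y. Let p be the weight of (i,j,k), let e_ijk be the
corresponding product vectors, orthonormal up to zero vectors, and put u_jk = ∑_i √p_ijk e_ijk and
q_ijk = |⟨e_ijk|τ|u_jk⟩|² / ⟨u_jk|τ|u_jk⟩. The triangle inequality for the seminorm of τ bounds the
fidelity by ∑ √(p q), so a classical Fuchs-van de Graaf inequality gives ∑ (p - q)₊ ≤ ε, and f =
min(1, q/p) discards at most ε. The operator bound on τ and Cauchy-Schwarz give q = r s, where s_ij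
is a diagonal entry of σ and ∑_i r_ijk ≤ t (`exists_filterBound_of_orthogonal`). Conversely, such a
domination of p f bounds the filtered reduced state without Y by the same t times I ⊗ σ', where σ'
is diagonal with entries s; this is Cauchy-Schwarz in i and Bessel's inequality in k and l, and it
uses that j is no longer coherent (`exists_posSemidef_sub_of_filterBound`). `exists_filter` combines
the two directions.

The product basis does not depend on Δ, and the converse holds for every g ≤ f that ignores n. Hence
the product of the filters of all cuts serves all cuts at once. A union bound over at most 2^|V_b|
cuts limits the discarded weight, and filtering away weight δ costs purified distance at most √(2δ).
-/

/-! ## Quadratic forms and orthogonal families -/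

open Matrix in
/-- The value `⟨v|τ|v⟩`. -/
def expVal {m : Type*} [Fintype m] (τ : Matrix m m ℂ) (v : m → ℂ) : ℝ :=
  (star v ⬝ᵥ (τ *ᵥ v)).re

open Matrix

theorem star_dotProduct_self_eq {m : Type*} [Fintype m] (v : m → ℂ) :
    star v ⬝ᵥ v = ((∑ p, ‖v p‖ ^ 2 : ℝ) : ℂ) := by
  simp only [dotProduct, Pi.star_apply, RCLike.star_def, Complex.conj_mul']
  push_cast
  rfl

theorem star_dotProduct_eq_star {m : Type*} [Fintype m] (u v : m → ℂ) :
    star u ⬝ᵥ v = star (star v ⬝ᵥ u) := by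
  simp [dotProduct, mul_comm]

theorem norm_dotProduct_sq_le {m : Type*} [Fintype m] (u v : m → ℂ) :
    ‖u ⬝ᵥ v‖ ^ 2 ≤ (∑ p, ‖u p‖ ^ 2) * ∑ p, ‖v p‖ ^ 2 := by
  have h : ‖u ⬝ᵥ v‖ ≤ ∑ p, ‖u p‖ * ‖v p‖ :=
    (norm_sum_le _ _).trans (le_of_eq (Finset.sum_congr rfl fun p _ => norm_mul _ _))
  calc ‖u ⬝ᵥ v‖ ^ 2 ≤ (∑ p, ‖u p‖ * ‖v p‖) ^ 2 := by gcongr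
    _ ≤ _ := Finset.sum_mul_sq_le_sq_mul_sq _ _ _

theorem norm_star_dotProduct_sq_le {m : Type*} [Fintype m] (u v : m → ℂ) :
    ‖star u ⬝ᵥ v‖ ^ 2 ≤ (∑ p, ‖u p‖ ^ 2) * ∑ p, ‖v p‖ ^ 2 := by
  simpa using norm_dotProduct_sq_le (star u) v

theorem Matrix.PosSemidef.exists_factor {m : Type*} [Fintype m] {τ : Matrix m m ℂ}
    (h : τ.PosSemidef) : ∃ B : Matrix m m ℂ, τ = Bᴴ * B := by
  classical
  open scoped MatrixOrder in
  have h0 : (0 : Matrix m m ℂ) ≤ τ := nonneg_iff_posSemidef.2 h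
  refine ⟨CFC.sqrt τ, ?_⟩
  have h1 : (CFC.sqrt τ).PosSemidef := nonneg_iff_posSemidef.1 (CFC.sqrt_nonneg τ)
  rw [h1.isHermitian.eq, CFC.sqrt_mul_sqrt_self τ h0]

theorem dotProduct_factor {m n : Type*} [Fintype m] [Fintype n] (B : Matrix n m ℂ) (u v : m → ℂ) :
    star u ⬝ᵥ ((Bᴴ * B) *ᵥ v) = star (B *ᵥ u) ⬝ᵥ (B *ᵥ v) := by
  rw [← mulVec_mulVec, dotProduct_mulVec, star_mulVec]

theorem expVal_factor {m n : Type*} [Fintype m] [Fintype n] (B : Matrix n m ℂ) (v : m → ℂ) :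
    expVal (Bᴴ * B) v = ∑ i, ‖(B *ᵥ v) i‖ ^ 2 := by
  rw [expVal, dotProduct_factor, star_dotProduct_self_eq, Complex.ofReal_re]

theorem expVal_nonneg {m : Type*} [Fintype m] {τ : Matrix m m ℂ} (h : τ.PosSemidef)
    (v : m → ℂ) : 0 ≤ expVal τ v := by
  obtain ⟨B, rfl⟩ := h.exists_factor
  rw [expVal_factor]
  positivity

theorem ofReal_expVal {m : Type*} [Fintype m] {τ : Matrix m m ℂ} (h : τ.PosSemidef)
    (v : m → ℂ) : (expVal τ v : ℂ) = star v ⬝ᵥ (τ *ᵥ v) := by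
  obtain ⟨B, rfl⟩ := h.exists_factor
  rw [expVal_factor, dotProduct_factor, star_dotProduct_self_eq]

/-- Cauchy-Schwarz for a positive semidefinite form. -/
theorem norm_dotProduct_mulVec_sq_le {m : Type*} [Fintype m] {τ : Matrix m m ℂ}
    (h : τ.PosSemidef) (u v : m → ℂ) :
    ‖star u ⬝ᵥ (τ *ᵥ v)‖ ^ 2 ≤ expVal τ u * expVal τ v := by
  obtain ⟨B, rfl⟩ := h.exists_factor
  rw [expVal_factor, expVal_factor, dotProduct_factor]
  exact norm_star_dotProduct_sq_le _ _

/-- The seminorm of a positive semidefinite form is subadditive. -/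
theorem sqrt_expVal_sum_le {m ι : Type*} [Fintype m] {τ : Matrix m m ℂ} (h : τ.PosSemidef)
    (s : Finset ι) (v : ι → m → ℂ) :
    √(expVal τ (∑ i ∈ s, v i)) ≤ ∑ i ∈ s, √(expVal τ (v i)) := by
  obtain ⟨B, rfl⟩ := h.exists_factor
  have key : ∀ x : m → ℂ, √(expVal (Bᴴ * B) x) = ‖WithLp.toLp 2 (B *ᵥ x)‖ := fun x => by
    rw [expVal_factor, EuclideanSpace.norm_eq]
  simp only [key]
  rw [show WithLp.toLp 2 (B *ᵥ ∑ i ∈ s, v i) = ∑ i ∈ s, WithLp.toLp 2 (B *ᵥ v i) by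
    rw [Matrix.mulVec_sum, WithLp.toLp_sum]]
  exact norm_sum_le _ _

theorem expVal_sum_matrix {m ι : Type*} [Fintype m] (s : Finset ι) (τ : ι → Matrix m m ℂ)
    (v : m → ℂ) : expVal (∑ i ∈ s, τ i) v = ∑ i ∈ s, expVal (τ i) v := by
  simp only [expVal, Matrix.sum_mulVec, dotProduct_sum, Complex.re_sum]

theorem expVal_sub {m : Type*} [Fintype m] (τ τ' : Matrix m m ℂ)
    (v : m → ℂ) : expVal (τ - τ') v = expVal τ v - expVal τ' v := by
  simp only [expVal, Matrix.sub_mulVec, dotProduct_sub, Complex.sub_re]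

theorem expVal_smul {m : Type*} [Fintype m] (t : ℝ) (τ : Matrix m m ℂ)
    (v : m → ℂ) : expVal ((t : ℂ) • τ) v = t * expVal τ v := by
  simp only [expVal, Matrix.smul_mulVec, dotProduct_smul, smul_eq_mul, Complex.re_ofReal_mul]

theorem pureState_mulVec {m : Type*} [Fintype m] (v z : m → ℂ) :
    pureState v *ᵥ z = (star v ⬝ᵥ z) • v := by
  rw [pureState, vecMulVec_mulVec]
  ext
  simp [mul_comm]

theorem expVal_pureState {m : Type*} [Fintype m] (v z : m → ℂ) :
    expVal (pureState v) z = ‖star v ⬝ᵥ z‖ ^ 2 := by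
  have h : star z ⬝ᵥ v = star (star v ⬝ᵥ z) := star_dotProduct_eq_star _ _
  rw [expVal, pureState_mulVec, dotProduct_smul, h, smul_eq_mul, RCLike.star_def,
    Complex.mul_conj, Complex.ofReal_re, Complex.normSq_eq_norm_sq]

theorem pureState_posSemidef {m : Type*} [Fintype m] (v : m → ℂ) : (pureState v).PosSemidef :=
  posSemidef_vecMulVec_self_star v

theorem trace_pureState {m : Type*} [Fintype m] (v : m → ℂ) :
    (pureState v).trace.re = ∑ p, ‖v p‖ ^ 2 := by
  rw [pureState, trace_vecMulVec, dotProduct_comm, star_dotProduct_self_eq, Complex.ofReal_re]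

theorem pureState_smul {m : Type*} (c : ℂ) (v : m → ℂ) :
    pureState (c • v) = (c * star c) • pureState v := by
  ext i j
  simp [pureState, vecMulVec_apply]
  ring

theorem posSemidef_sub_of_expVal_le {m : Type*} [Fintype m] {ρ τ : Matrix m m ℂ}
    (hρ : ρ.PosSemidef) (hτ : τ.PosSemidef) (h : ∀ z, expVal ρ z ≤ expVal τ z) :
    (τ - ρ).PosSemidef := by
  refine PosSemidef.of_dotProduct_mulVec_nonneg (hτ.isHermitian.sub hρ.isHermitian) fun z => ?_
  rw [Matrix.sub_mulVec, dotProduct_sub, ← ofReal_expVal hρ, ← ofReal_expVal hτ,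
    ← Complex.ofReal_sub]
  exact_mod_cast sub_nonneg.2 (h z)

theorem expVal_le_of_posSemidef_sub {m : Type*} [Fintype m] {ρ τ : Matrix m m ℂ}
    (h : (τ - ρ).PosSemidef) (z : m → ℂ) : expVal ρ z ≤ expVal τ z := by
  have := expVal_nonneg h z
  rw [expVal_sub] at this
  linarith

/-- Bessel's inequality for orthogonal vectors of norm at most one. -/
theorem sum_norm_dotProduct_sq_le {m ι : Type*} [Fintype m] [Fintype ι] [DecidableEq ι]
    (e : ι → m → ℂ) (c : ι → ℝ) (hc : ∀ i, c i ≤ 1)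
    (he : ∀ i j, star (e i) ⬝ᵥ e j = if i = j then (c i : ℂ) else 0) (z : m → ℂ) :
    ∑ i, ‖star (e i) ⬝ᵥ z‖ ^ 2 ≤ ∑ p, ‖z p‖ ^ 2 := by
  set a : ι → ℂ := fun i => star (e i) ⬝ᵥ z with ha
  -- Expanding ‖z - y‖² ≥ 0 suffices: ⟨y, z⟩ = ∑ |a i|², while ‖y‖² = ∑ |a i|² c i is no larger.
  set y : m → ℂ := ∑ i, a i • e i with hy
  have h1 : ∀ i, star (e i) ⬝ᵥ y = a i * c i := fun i => by
    simp [hy, dotProduct_sum, dotProduct_smul, he]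
  have h2 : ∀ x : m → ℂ, star y ⬝ᵥ x = ∑ i, star (a i) * (star (e i) ⬝ᵥ x) := fun x => by
    simp [hy, star_sum, sum_dotProduct, smul_dotProduct]
  have hzy : star z ⬝ᵥ y = star (star y ⬝ᵥ z) := star_dotProduct_eq_star _ _
  have e1 : star y ⬝ᵥ z = ((∑ i, ‖a i‖ ^ 2 : ℝ) : ℂ) := by
    rw [h2]; push_cast
    exact Finset.sum_congr rfl fun i _ => by rw [RCLike.star_def, Complex.conj_mul']
  have e2 : star y ⬝ᵥ y = ((∑ i, ‖a i‖ ^ 2 * c i : ℝ) : ℂ) := by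
    rw [h2]; push_cast
    refine Finset.sum_congr rfl fun i _ => ?_
    rw [h1, RCLike.star_def, ← mul_assoc, Complex.conj_mul']
  have h0 : 0 ≤ (star (z - y) ⬝ᵥ (z - y)).re := by
    rw [star_dotProduct_self_eq, Complex.ofReal_re]; positivity
  rw [star_sub, sub_dotProduct, dotProduct_sub, dotProduct_sub, hzy, e1, e2,
    star_dotProduct_self_eq, RCLike.star_def, Complex.conj_ofReal] at h0
  simp only [Complex.sub_re, Complex.ofReal_re] at h0
  have h3 : ∑ i, ‖a i‖ ^ 2 * c i ≤ ∑ i, ‖a i‖ ^ 2 :=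
    Finset.sum_le_sum fun i _ => mul_le_of_le_one_right (by positivity) (hc i)
  linarith

/-- Write τ = Bᴴ B and apply Bessel's inequality to each row of B. Squared norms below one are
allowed so that normalized families may contain zero vectors. -/
theorem sum_expVal_le_trace {m ι : Type*} [Fintype m] [Fintype ι] [DecidableEq ι]
    (e : ι → m → ℂ) (c : ι → ℝ) (hc : ∀ i, c i ≤ 1)
    (he : ∀ i j, star (e i) ⬝ᵥ e j = if i = j then (c i : ℂ) else 0)
    {τ : Matrix m m ℂ} (hτ : τ.PosSemidef) : ∑ i, expVal τ (e i) ≤ τ.trace.re := by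
  obtain ⟨B, rfl⟩ := hτ.exists_factor
  simp only [expVal_factor]
  rw [Finset.sum_comm]
  have h : (Bᴴ * B).trace.re = ∑ k, ∑ p, ‖star (B k) p‖ ^ 2 := by
    rw [trace_mul_comm, trace, Complex.re_sum]
    refine Finset.sum_congr rfl fun k _ => ?_
    have : (B * Bᴴ).diag k = star (star (B k)) ⬝ᵥ star (B k) := by
      simp [Matrix.mul_apply, dotProduct]
    rw [this, star_dotProduct_self_eq, Complex.ofReal_re]
  rw [h]
  refine Finset.sum_le_sum fun k _ => le_trans (le_of_eq ?_)
    (sum_norm_dotProduct_sq_le e c hc he (star (B k)))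
  refine Finset.sum_congr rfl fun i _ => ?_
  rw [star_dotProduct_star, norm_star, mulVec]

/-! ## Fidelity -/

theorem psdSqrt_posSemidef {m : Type*} [Fintype m] [DecidableEq m] (M : Matrix m m ℂ) :
    (psdSqrt M).PosSemidef := by
  open scoped MatrixOrder in
  exact nonneg_iff_posSemidef.1 (CFC.sqrt_nonneg M)

theorem psdSqrt_mul_self {m : Type*} [Fintype m] [DecidableEq m] {M : Matrix m m ℂ}
    (h : M.PosSemidef) : psdSqrt M * psdSqrt M = M := by
  open scoped MatrixOrder in
  exact CFC.sqrt_mul_sqrt_self M (nonneg_iff_posSemidef.2 h)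

theorem psdSqrt_eq {m : Type*} [Fintype m] [DecidableEq m] {M N : Matrix m m ℂ}
    (hN : N.PosSemidef) (h : N * N = M) : psdSqrt M = N := by
  open scoped MatrixOrder in
  exact CFC.sqrt_unique h (nonneg_iff_posSemidef.2 hN)

theorem pureState_mul_pureState {m : Type*} [Fintype m] (u v : m → ℂ) :
    pureState u * pureState v = (star u ⬝ᵥ v) • vecMulVec u (star v) := by
  rw [pureState, pureState, vecMulVec_mul_vecMulVec, vecMulVec_smul]

theorem ofReal_smul_posSemidef {m : Type*} {M : Matrix m m ℂ} (hM : M.PosSemidef) {t : ℝ}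
    (ht : 0 ≤ t) : ((t : ℂ) • M).PosSemidef :=
  hM.smul (by exact_mod_cast ht)

theorem trace_mul_pureState {m : Type*} [Fintype m] (N : Matrix m m ℂ) (v : m → ℂ) :
    (N * pureState v).trace.re = expVal N v := by
  rw [pureState, mul_vecMulVec, trace_vecMulVec, dotProduct_comm, expVal]

theorem orthogonal_normSq_nonneg {m ι : Type*} [Fintype m] [DecidableEq ι]
    {v : ι → m → ℂ} {c : ι → ℝ}
    (hv : ∀ i j, star (v i) ⬝ᵥ v j = if i = j then (c i : ℂ) else 0) (i : ι) : 0 ≤ c i := by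
  have h := hv i i
  rw [if_pos rfl, star_dotProduct_self_eq] at h
  rw [← Complex.ofReal_inj.1 h]
  positivity

theorem eq_zero_of_normSq_eq_zero {m ι : Type*} [Fintype m] [DecidableEq ι]
    {v : ι → m → ℂ} {c : ι → ℝ}
    (hv : ∀ i j, star (v i) ⬝ᵥ v j = if i = j then (c i : ℂ) else 0) {i : ι} (h : c i = 0) :
    v i = 0 := by
  have h1 := hv i i
  rw [if_pos rfl, h] at h1
  exact dotProduct_star_self_eq_zero.1 (by rw [dotProduct_comm]; simpa using h1)

/-! ### Orthogonal mixtures of pure states -/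

section OrthogonalSum

variable {m ι : Type*} [Fintype m] [DecidableEq m] [Fintype ι] [DecidableEq ι]
  {v : ι → m → ℂ} {c : ι → ℝ}

theorem sum_smul_pureState_mul (hv : ∀ i j, star (v i) ⬝ᵥ v j = if i = j then (c i : ℂ) else 0)
    (a b : ι → ℂ) : (∑ i, a i • pureState (v i)) * (∑ i, b i • pureState (v i)) =
      ∑ i, (a i * b i * c i) • pureState (v i) := by
  rw [Finset.sum_mul]
  refine Finset.sum_congr rfl fun i _ => ?_
  rw [Finset.mul_sum, Finset.sum_eq_single i]
  · rw [smul_mul_assoc, mul_smul_comm, pureState_mul_pureState, hv, if_pos rfl, pureState,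
      smul_smul, smul_smul, mul_assoc]
  · intro j _ hj
    rw [smul_mul_assoc, mul_smul_comm, pureState_mul_pureState, hv, if_neg hj.symm]
    simp
  · simp

/-- The rank-one terms annihilate each other and each squares to `c i` times itself. A term with `c
i = 0` vanishes, which makes the convention `0⁻¹ = 0` harmless. -/
theorem psdSqrt_sum_pureState
    (hv : ∀ i j, star (v i) ⬝ᵥ v j = if i = j then (c i : ℂ) else 0) :
    psdSqrt (∑ i, pureState (v i)) = ∑ i, (((√(c i))⁻¹ : ℝ) : ℂ) • pureState (v i) := by
  refine psdSqrt_eq (posSemidef_sum _ fun i _ =>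
    ofReal_smul_posSemidef (pureState_posSemidef _) (by positivity)) ?_
  rw [sum_smul_pureState_mul hv]
  refine Finset.sum_congr rfl fun i _ => ?_
  rcases (orthogonal_normSq_nonneg hv i).eq_or_lt with h | h
  · rw [eq_zero_of_normSq_eq_zero hv h.symm]
    simp [pureState]
  · have : (√(c i))⁻¹ * (√(c i))⁻¹ * c i = 1 := by
      rw [← mul_inv, Real.mul_self_sqrt h.le, inv_mul_cancel₀ h.ne']
    rw [← Complex.ofReal_mul, ← Complex.ofReal_mul, this]
    simp

/-- The fidelity with an orthogonal mixture of pure states. -/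
theorem fidelity_sum_pureState_le
    (hv : ∀ i j, star (v i) ⬝ᵥ v j = if i = j then (c i : ℂ) else 0)
    {τ : Matrix m m ℂ} (hτ : τ.PosSemidef) :
    fidelity τ (∑ i, pureState (v i)) ≤ ∑ i, √(expVal τ (v i)) := by
  have hc := orthogonal_normSq_nonneg hv
  set R : Matrix m m ℂ := ∑ i, (((√(c i))⁻¹ : ℝ) : ℂ) • pureState (v i) with hR
  -- The projection onto the span of the `v i`.
  set P : Matrix m m ℂ := ∑ i, (((c i)⁻¹ : ℝ) : ℂ) • pureState (v i) with hP
  have hRh : Rᴴ = R := (posSemidef_sum _ fun i _ =>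
    ofReal_smul_posSemidef (pureState_posSemidef (v i)) (by positivity)).isHermitian
  rw [fidelity, psdSqrt_sum_pureState hv, ← hR, traceNorm]
  have hM : (psdSqrt τ * R)ᴴ * (psdSqrt τ * R) = R * τ * R := by
    rw [conjTranspose_mul, hRh, (psdSqrt_posSemidef τ).isHermitian.eq, ← mul_assoc,
      mul_assoc R, psdSqrt_mul_self hτ]
  have hMp : (R * τ * R).PosSemidef := hM ▸ posSemidef_conjTranspose_mul_self _
  rw [hM]
  set N := psdSqrt (R * τ * R) with hN
  have hNp : N.PosSemidef := psdSqrt_posSemidef _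
  have hNN : Nᴴ * N = R * τ * R := by rw [hNp.isHermitian.eq, hN, psdSqrt_mul_self hMp]
  have hRP : R * P = R := by
    rw [hR, hP, sum_smul_pureState_mul hv]
    refine Finset.sum_congr rfl fun i _ => ?_
    rcases (hc i).eq_or_lt with h | h
    · rw [eq_zero_of_normSq_eq_zero hv h.symm]
      simp [pureState]
    · rw [mul_assoc, ← Complex.ofReal_mul, inv_mul_cancel₀ h.ne']
      simp
  -- N² = R τ R vanishes on the complement of the span, so N does too; the trace of N is then a sum
  -- of its diagonal entries along the `v i`.
  have hNP : N = N * P := by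
    have h0 : Nᴴ * N * (1 - P) = 0 := by
      rw [hNN, mul_assoc, mul_sub, mul_one, hRP, sub_self, mul_zero]
    have := (conjTranspose_mul_self_mul_eq_zero N (1 - P)).1 h0
    rw [mul_sub, mul_one, sub_eq_zero] at this
    exact this
  have htr : N.trace.re = ∑ i, (c i)⁻¹ * expVal N (v i) := by
    conv_lhs => rw [hNP, hP, Finset.mul_sum, trace_sum, Complex.re_sum]
    refine Finset.sum_congr rfl fun i _ => ?_
    rw [mul_smul_comm, trace_smul, smul_eq_mul, Complex.re_ofReal_mul, trace_mul_pureState]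
  have hRv : ∀ i, R *ᵥ v i = ((√(c i) : ℝ) : ℂ) • v i := fun i => by
    rw [hR, sum_mulVec, Finset.sum_eq_single i]
    · rw [smul_mulVec, pureState_mulVec, hv, if_pos rfl, smul_smul, ← Complex.ofReal_mul]
      congr 2
      rcases (hc i).eq_or_lt with h | h
      · simp [← h]
      · rw [inv_mul_eq_div, Real.div_sqrt]
    · intro j _ hj
      rw [smul_mulVec, pureState_mulVec, hv, if_neg hj]
      simp
    · simp
  rw [htr]
  refine Finset.sum_le_sum fun i _ => ?_
  rcases (hc i).eq_or_lt with h | h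
  · simp [← h]
  have h1 : expVal (R * τ * R) (v i) = c i * expVal τ (v i) := by
    have : star (v i) ⬝ᵥ ((R * τ * R) *ᵥ v i) = star (R *ᵥ v i) ⬝ᵥ (τ *ᵥ (R *ᵥ v i)) := by
      rw [star_mulVec, hRh, ← dotProduct_mulVec, mulVec_mulVec, mulVec_mulVec, mul_assoc]
    rw [expVal, this, hRv, mulVec_smul, dotProduct_smul, star_smul, smul_dotProduct, expVal,
      smul_smul, RCLike.star_def, Complex.conj_ofReal, ← Complex.ofReal_mul,
      Real.mul_self_sqrt (hc i), smul_eq_mul, Complex.re_ofReal_mul]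
  -- Cauchy-Schwarz for ⟨v|N v⟩, with ‖N v‖² = ⟨v|R τ R|v⟩.
  have h2 : expVal N (v i) ^ 2 ≤ c i * (c i * expVal τ (v i)) := by
    have h3 := norm_star_dotProduct_sq_le (v i) (N *ᵥ v i)
    have h4 : ∑ p, ‖v i p‖ ^ 2 = c i := by
      have := hv i i
      rw [if_pos rfl, star_dotProduct_self_eq] at this
      exact Complex.ofReal_inj.1 this
    rw [h4, ← expVal_factor N, hNN, h1, ← ofReal_expVal hNp, Complex.norm_real,
      Real.norm_eq_abs, sq_abs] at h3
    exact h3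
  have h5 : expVal N (v i) ≤ c i * √(expVal τ (v i)) := by
    rw [← Real.sqrt_sq (expVal_nonneg hNp (v i))]
    refine (Real.sqrt_le_sqrt h2).trans (le_of_eq ?_)
    rw [← mul_assoc, Real.sqrt_mul (mul_self_nonneg _), Real.sqrt_mul_self (hc i)]
  rw [inv_mul_le_iff₀ h]
  exact h5

end OrthogonalSum

theorem psdSqrt_pureState {m : Type*} [Fintype m] [DecidableEq m] (v : m → ℂ) :
    psdSqrt (pureState v) = (((√(∑ p, ‖v p‖ ^ 2))⁻¹ : ℝ) : ℂ) • pureState v := by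
  have := psdSqrt_sum_pureState (ι := Unit) (v := fun _ => v) (c := fun _ => ∑ p, ‖v p‖ ^ 2)
    (fun _ _ => by rw [if_pos rfl, star_dotProduct_self_eq])
  simpa using this

theorem psdSqrt_smul {m : Type*} [Fintype m] [DecidableEq m] {M : Matrix m m ℂ}
    (hM : M.PosSemidef) {t : ℝ} (ht : 0 ≤ t) :
    psdSqrt ((t : ℂ) • M) = ((√t : ℝ) : ℂ) • psdSqrt M := by
  refine psdSqrt_eq (ofReal_smul_posSemidef (psdSqrt_posSemidef M) (Real.sqrt_nonneg t)) ?_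
  rw [smul_mul_assoc, mul_smul_comm, smul_smul, psdSqrt_mul_self hM, ← Complex.ofReal_mul,
    Real.mul_self_sqrt ht]

theorem fidelity_pureState {m : Type*} [Fintype m] [DecidableEq m] (v w : m → ℂ) :
    fidelity (pureState v) (pureState w) = ‖star v ⬝ᵥ w‖ := by
  set a := ∑ p, ‖v p‖ ^ 2 with ha
  set b := ∑ p, ‖w p‖ ^ 2 with hb
  have ha0 : 0 ≤ a := by positivity
  have hb0 : 0 ≤ b := by positivity
  have hcs := norm_star_dotProduct_sq_le v w
  rw [← ha, ← hb] at hcs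
  have hM : (psdSqrt (pureState v) * psdSqrt (pureState w))ᴴ *
      (psdSqrt (pureState v) * psdSqrt (pureState w)) =
      ((b⁻¹ * ‖star v ⬝ᵥ w‖ ^ 2 : ℝ) : ℂ) • pureState w := by
    rw [conjTranspose_mul, (psdSqrt_posSemidef _).isHermitian.eq,
      (psdSqrt_posSemidef _).isHermitian.eq, ← mul_assoc, mul_assoc (psdSqrt (pureState w)),
      psdSqrt_mul_self (pureState_posSemidef v), psdSqrt_pureState, ← hb]
    have h1 : pureState w * pureState v * pureState w =
        ((‖star v ⬝ᵥ w‖ ^ 2 : ℝ) : ℂ) • pureState w := by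
      rw [pureState_mul_pureState, smul_mul_assoc, pureState, vecMulVec_mul_vecMulVec,
        vecMulVec_smul, smul_smul, star_dotProduct_eq_star w v,
        RCLike.star_def, Complex.conj_mul']
      push_cast
      rfl
    rw [smul_mul_assoc, mul_smul_comm, smul_mul_assoc, h1, smul_smul, smul_smul]
    congr 1
    rw [← Complex.ofReal_mul, ← mul_inv, Real.mul_self_sqrt hb0]
    push_cast
    rfl
  rw [fidelity, traceNorm, hM, psdSqrt_smul (pureState_posSemidef w) (by positivity),
    psdSqrt_pureState, ← hb, smul_smul, trace_smul, smul_eq_mul, ← Complex.ofReal_mul,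
    Complex.re_ofReal_mul, trace_pureState, ← hb, Real.sqrt_mul (by positivity),
    Real.sqrt_sq (norm_nonneg _), Real.sqrt_inv]
  rcases hb0.eq_or_lt with h | h
  · rw [← h, mul_zero] at hcs
    have : ‖star v ⬝ᵥ w‖ = 0 := by
      have := sq_nonneg ‖star v ⬝ᵥ w‖
      exact pow_eq_zero_iff two_ne_zero |>.1 (le_antisymm hcs this)
    simp [this]
  · have : √b * √b = b := Real.mul_self_sqrt hb0
    have hs : √b ≠ 0 := (Real.sqrt_pos.2 h).ne'
    field_simp
    rw [Real.sq_sqrt hb0, mul_comm]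

/-! ## A classical Fuchs-van de Graaf inequality -/

/-- For equal total mass the positive part is half the 1-distance. Factor |p - q| as |√p - √q| (√p +
√q) and apply Cauchy-Schwarz; the two square sums are 2 - 2F and 2 + 2F. -/
theorem sum_posPart_sq_le_of_sum_eq_one {ι : Type*} [Fintype ι] {p q : ι → ℝ}
    (hp : ∀ i, 0 ≤ p i) (hq : ∀ i, 0 ≤ q i) (hp1 : ∑ i, p i = 1) (hq1 : ∑ i, q i = 1) :
    (∑ i, max (p i - q i) 0) ^ 2 ≤ 1 - (∑ i, √(p i * q i)) ^ 2 := by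
  set F := ∑ i, √(p i * q i)
  have h1 : ∑ i, max (p i - q i) 0 = (∑ i, |p i - q i|) / 2 := by
    have : ∀ i, max (p i - q i) 0 = (|p i - q i| + (p i - q i)) / 2 := fun i => by
      rcases le_total (p i - q i) 0 with h | h
      · rw [max_eq_right h, abs_of_nonpos h]; ring
      · rw [max_eq_left h, abs_of_nonneg h]; ring
    simp only [this]
    rw [← Finset.sum_div, Finset.sum_add_distrib, Finset.sum_sub_distrib, hp1, hq1]
    ring
  have h2 : ∑ i, |p i - q i| = ∑ i, |√(p i) - √(q i)| * (√(p i) + √(q i)) := by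
    refine Finset.sum_congr rfl fun i _ => ?_
    rw [← abs_of_nonneg (by positivity : 0 ≤ √(p i) + √(q i)), ← abs_mul]
    congr 1
    nlinarith [Real.mul_self_sqrt (hp i), Real.mul_self_sqrt (hq i)]
  have h3 := Finset.sum_mul_sq_le_sq_mul_sq Finset.univ (fun i => |√(p i) - √(q i)|)
    (fun i => √(p i) + √(q i))
  have h4 : ∑ i, |√(p i) - √(q i)| ^ 2 = 2 - 2 * F := by
    have : ∀ i, |√(p i) - √(q i)| ^ 2 = p i + q i - 2 * √(p i * q i) := fun i => by
      rw [sq_abs, Real.sqrt_mul (hp i)]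
      nlinarith [Real.mul_self_sqrt (hp i), Real.mul_self_sqrt (hq i)]
    simp only [this]
    rw [Finset.sum_sub_distrib, Finset.sum_add_distrib, hp1, hq1, ← Finset.mul_sum]
    norm_num [F]
  have h5 : ∑ i, (√(p i) + √(q i)) ^ 2 = 2 + 2 * F := by
    have : ∀ i, (√(p i) + √(q i)) ^ 2 = p i + q i + 2 * √(p i * q i) := fun i => by
      rw [Real.sqrt_mul (hp i)]
      nlinarith [Real.mul_self_sqrt (hp i), Real.mul_self_sqrt (hq i)]
    simp only [this]
    rw [Finset.sum_add_distrib, Finset.sum_add_distrib, hp1, hq1, ← Finset.mul_sum]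
    norm_num [F]
  rw [h4, h5] at h3
  rw [h1, h2]
  nlinarith

/-- The missing masses become one extra outcome `none`, which accounts for the second term of the
generalized fidelity. -/
theorem sum_posPart_sq_le {ι : Type*} [Fintype ι] {p q : ι → ℝ}
    (hp : ∀ i, 0 ≤ p i) (hq : ∀ i, 0 ≤ q i) (hp1 : ∑ i, p i ≤ 1) (hq1 : ∑ i, q i ≤ 1) :
    (∑ i, max (p i - q i) 0) ^ 2 ≤
      1 - (∑ i, √(p i * q i) + √((1 - ∑ i, p i) * (1 - ∑ i, q i))) ^ 2 := by
  have h := sum_posPart_sq_le_of_sum_eq_one (ι := Option ι)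
    (p := fun o => o.elim (1 - ∑ i, p i) p) (q := fun o => o.elim (1 - ∑ i, q i) q)
    (fun o => by cases o <;> simp [hp, hp1]) (fun o => by cases o <;> simp [hq, hq1])
    (by simp [Fintype.sum_option]) (by simp [Fintype.sum_option])
  simp only [Fintype.sum_option, Option.elim] at h
  rw [add_comm (√_)] at h
  refine le_trans ?_ h
  have h0 : 0 ≤ ∑ i, max (p i - q i) 0 := Finset.sum_nonneg fun i _ => le_max_right _ _
  gcongr
  linarith [le_max_right (1 - ∑ i, p i - (1 - ∑ i, q i)) 0]

/-! ## Product vectors -/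

/-- The product vector `u ⊗ v`. -/
def tensorVec {m n : Type*} (u : m → ℂ) (v : n → ℂ) : m × n → ℂ := fun p => u p.1 * v p.2

theorem star_tensorVec_dotProduct {m n : Type*} [Fintype m] [Fintype n] (u u' : m → ℂ)
    (v v' : n → ℂ) :
    star (tensorVec u v) ⬝ᵥ tensorVec u' v' = (star u ⬝ᵥ u') * (star v ⬝ᵥ v') := by
  simp only [dotProduct, tensorVec, Pi.star_apply, star_mul', Fintype.sum_prod_type,
    Finset.sum_mul_sum]
  exact Finset.sum_congr rfl fun i _ => Finset.sum_congr rfl fun j _ => by ring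

theorem one_kronecker_mulVec_tensorVec {m n : Type*} [Fintype m] [Fintype n] [DecidableEq m]
    (σ : Matrix n n ℂ) (u : m → ℂ) (v : n → ℂ) :
    ((1 : Matrix m m ℂ) ⊗ₖ σ) *ᵥ tensorVec u v = tensorVec u (σ *ᵥ v) := by
  ext ⟨i, j⟩
  simp only [mulVec, dotProduct, kroneckerMap_apply, tensorVec, Fintype.sum_prod_type,
    one_apply]
  rw [Finset.sum_eq_single i (fun b _ hb => by simp [hb.symm]) (by simp), Finset.mul_sum]
  exact Finset.sum_congr rfl fun k _ => by rw [if_pos rfl]; ring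

theorem smul_tensorVec_smul {m n : Type*} (a b : ℂ) (u : m → ℂ) (v : n → ℂ) :
    tensorVec (a • u) (b • v) = (a * b) • tensorVec u v := by
  ext p
  simp [tensorVec]
  ring

theorem expVal_one_kronecker {m n : Type*} [Fintype m] [Fintype n] [DecidableEq m]
    (σ : Matrix n n ℂ) (z : m × n → ℂ) :
    expVal ((1 : Matrix m m ℂ) ⊗ₖ σ) z = ∑ i, expVal σ fun j => z (i, j) := by
  simp only [expVal, ← Complex.re_sum]
  congr 1
  simp only [dotProduct, mulVec, kroneckerMap_apply, Fintype.sum_prod_type, one_apply,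
    Pi.star_apply]
  refine Finset.sum_congr rfl fun i _ => Finset.sum_congr rfl fun j _ => ?_
  rw [Finset.sum_eq_single i (fun b _ hb => by simp [hb.symm]) (by simp)]
  simp

theorem star_tensorVec_dotProduct_eq {m n : Type*} [Fintype m] [Fintype n] (u : m → ℂ)
    (v : n → ℂ) (z : m × n → ℂ) :
    star (tensorVec u v) ⬝ᵥ z = star u ⬝ᵥ fun i => star v ⬝ᵥ fun j => z (i, j) := by
  simp only [dotProduct, tensorVec, Pi.star_apply, star_mul', Fintype.sum_prod_type,
    Finset.mul_sum, mul_assoc]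

/-- The family `v` normalized, where `c i` is the squared norm of `v i`; zero vectors stay zero. -/
noncomputable def normalizeVec {ι m : Type*} (v : ι → m → ℂ) (c : ι → ℝ) (i : ι) : m → ℂ :=
  (((√(c i))⁻¹ : ℝ) : ℂ) • v i

/-- The value `(c i)⁻¹ * c i` is 1 or, for a zero vector, 0; keeping it unevaluated avoids
restricting the index set. -/
theorem star_normalizeVec_dotProduct {ι m : Type*} [Fintype m] [DecidableEq ι] {v : ι → m → ℂ}
    {c : ι → ℝ} (hv : ∀ i j, star (v i) ⬝ᵥ v j = if i = j then (c i : ℂ) else 0) (i j : ι) :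
    star (normalizeVec v c i) ⬝ᵥ normalizeVec v c j =
      if i = j then (((c i)⁻¹ * c i : ℝ) : ℂ) else 0 := by
  rw [normalizeVec, normalizeVec, star_smul, smul_dotProduct, dotProduct_smul, hv]
  split_ifs with h
  · subst h
    rw [RCLike.star_def, Complex.conj_ofReal, smul_eq_mul, smul_eq_mul, ← Complex.ofReal_mul,
      ← Complex.ofReal_mul, ← mul_assoc, ← mul_inv,
      Real.mul_self_sqrt (orthogonal_normSq_nonneg hv i)]
  · simp

theorem sqrt_smul_normalizeVec {ι m : Type*} [Fintype m] [DecidableEq ι] {v : ι → m → ℂ}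
    {c : ι → ℝ} (hv : ∀ i j, star (v i) ⬝ᵥ v j = if i = j then (c i : ℂ) else 0) (i : ι) :
    ((√(c i) : ℝ) : ℂ) • normalizeVec v c i = v i := by
  rw [normalizeVec, smul_smul, ← Complex.ofReal_mul]
  rcases (orthogonal_normSq_nonneg hv i).eq_or_lt with h | h
  · rw [eq_zero_of_normSq_eq_zero hv h.symm, smul_zero]
  · rw [mul_inv_cancel₀ (Real.sqrt_pos.2 h).ne', Complex.ofReal_one, one_smul]

theorem normalizeVec_sum_expVal_le {ι m : Type*} [Fintype m] [Fintype ι] [DecidableEq ι]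
    {v : ι → m → ℂ}
    {c : ι → ℝ} (hv : ∀ i j, star (v i) ⬝ᵥ v j = if i = j then (c i : ℂ) else 0)
    {σ : Matrix m m ℂ} (hσ : σ.PosSemidef) :
    ∑ i, expVal σ (normalizeVec v c i) ≤ σ.trace.re :=
  sum_expVal_le_trace _ (fun i => (c i)⁻¹ * c i) (fun _ => _root_.inv_mul_le_one)
    (star_normalizeVec_dotProduct hv) hσ

/-! ## Classical filters -/

/-- The filter `f` keeps all but `ε` of the weight `p`, and the filtered weight `p f` is dominated
by `r s` with `s` a subnormalized distribution and `∑ i, r i j k ≤ t`. -/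
structure FilterBound {IX IY K : Type*} [Fintype IX] [Fintype IY] [Fintype K]
    (p : IX → IY → K → ℝ) (ε t : ℝ) (f : IX → IY → K → ℝ) (s : IX → IY → ℝ)
    (r : IX → IY → K → ℝ) : Prop where
  f_nonneg : ∀ i j k, 0 ≤ f i j k
  f_le_one : ∀ i j k, f i j k ≤ 1
  s_nonneg : ∀ i j, 0 ≤ s i j
  s_sum : ∑ i, ∑ j, s i j ≤ 1
  r_nonneg : ∀ i j k, 0 ≤ r i j k
  weight_le : ∀ i j k, p i j k * f i j k ≤ r i j k * s i j
  r_sum : ∀ j k, ∑ i, r i j k ≤ t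
  loss : ∑ i, ∑ j, ∑ k, p i j k * (1 - f i j k) ≤ ε

/-- The test vector z = y / s is the optimal one and turns the family of quadratic inequalities into
a single sum. The second claim says that dividing by `s i = 0` loses nothing: testing with a unit
vector shows that `y i = 0` there, unless `E = 0` and both sides are zero. -/
theorem sum_le_of_div_le {ι : Type*} [Fintype ι] {y s : ι → ℝ} {t E : ℝ} (hE : 0 ≤ E) (ht : 0 ≤ t)
    (hs : ∀ i, 0 ≤ s i) (h : ∀ z : ι → ℝ, (∑ i, z i * y i) ^ 2 ≤ t * (∑ i, z i ^ 2 * s i) * E) :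
    ∑ i, y i ^ 2 / (s i * E) ≤ t ∧ ∀ i, y i ^ 2 / E = y i ^ 2 / (s i * E) * s i := by
  classical
  rcases hE.eq_or_lt with hE0 | hE0
  · subst hE0
    simpa using ht
  constructor
  · have h1 := h fun i => y i / s i
    have e1 : ∑ i, y i / s i * y i = ∑ i, y i ^ 2 / s i :=
      Finset.sum_congr rfl fun i _ => by ring
    have e2 : ∑ i, (y i / s i) ^ 2 * s i = ∑ i, y i ^ 2 / s i :=
      Finset.sum_congr rfl fun i _ => by
        rcases eq_or_ne (s i) 0 with h0 | h0
        · simp [h0]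
        · field_simp
    rw [e1, e2] at h1
    have e3 : ∑ i, y i ^ 2 / (s i * E) = (∑ i, y i ^ 2 / s i) / E := by
      rw [Finset.sum_div]
      exact Finset.sum_congr rfl fun i _ => by rw [div_div]
    rw [e3, div_le_iff₀ hE0]
    set Y := ∑ i, y i ^ 2 / s i
    have hY : 0 ≤ Y := Finset.sum_nonneg fun i _ => div_nonneg (sq_nonneg _) (hs i)
    rcases hY.eq_or_lt with hY0 | hY0
    · rw [← hY0]; positivity
    · nlinarith
  · intro i
    rcases eq_or_ne (s i) 0 with h0 | h0
    · have h1 := h (Pi.single i 1)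
      have e1 : ∑ j, (Pi.single i (1 : ℝ) : ι → ℝ) j * y j = y i := by
        simp [Pi.single_apply]
      have e2 : ∑ j, (Pi.single i (1 : ℝ) : ι → ℝ) j ^ 2 * s j = 0 := by
        simp [Pi.single_apply, h0]
      rw [e1, e2] at h1
      have : y i ^ 2 = 0 := le_antisymm (by simpa using h1) (sq_nonneg _)
      simp [this]
    · field_simp

/-- The quantum-to-classical step. For fixed (j, k) the rank-one operator τ|u⟩⟨u|τ / ⟨u|τ|u⟩ lies
below τ and has the same value at u. Its diagonal is the distribution q that is compared with p, and
it inherits the upper bound on τ. -/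
theorem exists_filterBound_of_orthogonal {IX IY K m : Type*} [Fintype IX] [Fintype IY] [Fintype K]
    [DecidableEq IX] [DecidableEq IY] [DecidableEq K] [Fintype m]
    {τ : Matrix m m ℂ} (hτ : IsSubState τ) {e : IX × IY × K → m → ℂ} {c : IX × IY × K → ℝ}
    (hc : ∀ a, c a ≤ 1) (he : ∀ a b, star (e a) ⬝ᵥ e b = if a = b then (c a : ℂ) else 0)
    {p : IX → IY → K → ℝ} (hp : ∀ i j k, 0 ≤ p i j k) (hp1 : ∑ i, ∑ j, ∑ k, p i j k ≤ 1)
    {s : IX → IY → ℝ} (hs : ∀ i j, 0 ≤ s i j) (hs1 : ∑ i, ∑ j, s i j ≤ 1) {t : ℝ} (ht : 0 ≤ t)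
    (hT : ∀ j k (z : IX → ℂ), expVal τ (∑ i, z i • e (i, j, k)) ≤ t * ∑ i, ‖z i‖ ^ 2 * s i j)
    {ε F : ℝ} (hε : 0 ≤ ε) (hF0 : 0 ≤ F) (hFε : 1 - F ^ 2 ≤ ε ^ 2)
    (hF : F ≤ ∑ j, ∑ k, √(expVal τ (∑ i, ((√(p i j k) : ℝ) : ℂ) • e (i, j, k))) +
      √((1 - τ.trace.re) * (1 - ∑ i, ∑ j, ∑ k, p i j k))) :
    ∃ f r, FilterBound p ε t f s r := by
  set u : IY → K → m → ℂ := fun j k => ∑ i, ((√(p i j k) : ℝ) : ℂ) • e (i, j, k) with hu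
  set E : IY → K → ℝ := fun j k => expVal τ (u j k) with hE
  have hE0 : ∀ j k, 0 ≤ E j k := fun j k => expVal_nonneg hτ.1 _
  set y : IX → IY → K → ℂ := fun i j k => star (e (i, j, k)) ⬝ᵥ (τ *ᵥ u j k) with hy
  set q : IX → IY → K → ℝ := fun i j k => ‖y i j k‖ ^ 2 / E j k with hq
  have hq0 : ∀ i j k, 0 ≤ q i j k := fun i j k => div_nonneg (sq_nonneg _) (hE0 j k)
  have hstar : ∀ j k (z : IX → ℂ) (x : m → ℂ), star (∑ i, z i • e (i, j, k)) ⬝ᵥ x =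
      ∑ i, star (z i) * (star (e (i, j, k)) ⬝ᵥ x) := fun j k z x => by
    simp [star_sum, sum_dotProduct, smul_dotProduct]
  have hqe : ∀ i j k, q i j k ≤ expVal τ (e (i, j, k)) := fun i j k => by
    refine div_le_of_le_mul₀ (hE0 j k) (expVal_nonneg hτ.1 _) ?_
    exact norm_dotProduct_mulVec_sq_le hτ.1 _ _
  -- By Cauchy-Schwarz q is below the diagonal of τ, hence it is subnormalized.
  have hq1 : ∑ i, ∑ j, ∑ k, q i j k ≤ τ.trace.re := by
    refine le_trans ?_ (sum_expVal_le_trace e c hc he hτ.1)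
    rw [Fintype.sum_prod_type]
    refine Finset.sum_le_sum fun i _ => ?_
    rw [Fintype.sum_prod_type]
    exact Finset.sum_le_sum fun j _ => Finset.sum_le_sum fun k _ => hqe i j k
  have hbound : ∀ j k, ∑ i, ‖y i j k‖ ^ 2 / (s i j * E j k) ≤ t ∧
      ∀ i, ‖y i j k‖ ^ 2 / E j k = ‖y i j k‖ ^ 2 / (s i j * E j k) * s i j := fun j k => by
    refine sum_le_of_div_le (hE0 j k) ht (fun i => hs i j) fun z => ?_
    -- The phases of y are put into the coefficients, so that the inner product becomes the real sum
    -- ∑ z |y|.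
    set x : IX → ℂ := fun i => if y i j k = 0 then 0 else
      ((z i : ℝ) : ℂ) * y i j k / ((‖y i j k‖ : ℝ) : ℂ) with hx
    have h1 : star (∑ i, x i • e (i, j, k)) ⬝ᵥ (τ *ᵥ u j k) =
        ((∑ i, z i * ‖y i j k‖ : ℝ) : ℂ) := by
      rw [hstar]
      push_cast
      refine Finset.sum_congr rfl fun i _ => ?_
      change star (x i) * y i j k = _
      by_cases h0 : y i j k = 0
      · simp [hx, h0]
      · have hn : ((‖y i j k‖ : ℝ) : ℂ) ≠ 0 := by simpa using h0
        simp only [hx, h0, if_false, star_div₀, star_mul', RCLike.star_def, Complex.conj_ofReal]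
        rw [div_mul_eq_mul_div, mul_assoc, Complex.conj_mul']
        field_simp
    have h2 := norm_dotProduct_mulVec_sq_le hτ.1 (∑ i, x i • e (i, j, k)) (u j k)
    rw [h1, Complex.norm_real, Real.norm_eq_abs, sq_abs] at h2
    refine h2.trans (mul_le_mul_of_nonneg_right ((hT j k x).trans ?_) (hE0 j k))
    refine mul_le_mul_of_nonneg_left (Finset.sum_le_sum fun i _ => ?_) ht
    refine mul_le_mul_of_nonneg_right ?_ (hs i j)
    by_cases h0 : y i j k = 0
    · simp [hx, h0]; positivity
    · have hn : ‖y i j k‖ ≠ 0 := by simpa using h0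
      simp only [hx, h0, if_false, norm_div, norm_mul, Complex.norm_real, norm_norm]
      rw [mul_div_assoc, div_self hn, mul_one, Real.norm_eq_abs, sq_abs]
  -- Expanding only the left u in E = ⟨u|τ|u⟩ gives E ≤ ∑ √p |y|; dividing by √E turns |y| into √q.
  have hcl : ∀ j k, √(E j k) ≤ ∑ i, √(p i j k * q i j k) := fun j k => by
    have h1 : E j k ≤ ∑ i, √(p i j k) * ‖y i j k‖ := by
      have : E j k = (star (u j k) ⬝ᵥ (τ *ᵥ u j k)).re := rfl
      rw [this]
      refine (Complex.re_le_norm _).trans ?_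
      conv_lhs => rw [hu]
      rw [hstar]
      refine (norm_sum_le _ _).trans (Finset.sum_le_sum fun i _ => le_of_eq ?_)
      rw [norm_mul, norm_star, Complex.norm_real, Real.norm_eq_abs,
        abs_of_nonneg (Real.sqrt_nonneg _)]
    have h2 : ∑ i, √(p i j k * q i j k) = (∑ i, √(p i j k) * ‖y i j k‖) / √(E j k) := by
      rw [Finset.sum_div]
      refine Finset.sum_congr rfl fun i _ => ?_
      rw [Real.sqrt_mul (hp i j k), hq, Real.sqrt_div (sq_nonneg _), Real.sqrt_sq (norm_nonneg _),
        mul_div_assoc]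
    rw [h2]
    rcases (hE0 j k).eq_or_lt with h | h
    · rw [← h]; simp
    · rw [le_div_iff₀ (Real.sqrt_pos.2 h), Real.mul_self_sqrt h.le]
      exact h1
  have hloss : ∑ i, ∑ j, ∑ k, max (p i j k - q i j k) 0 ≤ ε := by
    have h := sum_posPart_sq_le (ι := IX × IY × K) (p := fun a => p a.1 a.2.1 a.2.2)
      (q := fun a => q a.1 a.2.1 a.2.2) (fun a => hp _ _ _) (fun a => hq0 _ _ _)
      (by simpa [Fintype.sum_prod_type] using hp1)
      (by simpa [Fintype.sum_prod_type] using hq1.trans hτ.2)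
    simp only [Fintype.sum_prod_type] at h
    have hFle : F ≤ ∑ i, ∑ j, ∑ k, √(p i j k * q i j k) +
        √((1 - ∑ i, ∑ j, ∑ k, p i j k) * (1 - ∑ i, ∑ j, ∑ k, q i j k)) := by
      refine hF.trans (add_le_add ?_ (Real.sqrt_le_sqrt ?_))
      · rw [Finset.sum_comm]
        refine (Finset.sum_le_sum fun j _ => Finset.sum_le_sum fun k _ => hcl k j).trans
          (le_of_eq ?_)
        rw [Finset.sum_comm]
        simp only [Finset.sum_comm (γ := IX)]
      · rw [mul_comm]
        have : 0 ≤ 1 - ∑ i, ∑ j, ∑ k, p i j k := by linarith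
        gcongr
    have h3 := pow_le_pow_left₀ hF0 hFle 2
    exact abs_le_of_sq_le_sq' (by linarith) hε |>.2
  -- With this f the kept weight is p f = min(p, q) and the lost weight is exactly (p - q)₊.
  refine ⟨fun i j k => min 1 (q i j k / p i j k), fun i j k => ‖y i j k‖ ^ 2 / (s i j * E j k),
    fun i j k => le_min zero_le_one (div_nonneg (hq0 i j k) (hp i j k)),
    fun i j k => min_le_left _ _, hs, hs1,
    fun i j k => div_nonneg (sq_nonneg _) (mul_nonneg (hs i j) (hE0 j k)), fun i j k => ?_,
    fun j k => (hbound j k).1, le_trans (le_of_eq ?_) hloss⟩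
  · rw [← (hbound j k).2 i]
    rcases (hp i j k).eq_or_lt with h | h
    · rw [← h, zero_mul]; exact hq0 i j k
    · refine (mul_le_mul_of_nonneg_left (min_le_right _ _) h.le).trans (le_of_eq ?_)
      rw [mul_div_cancel₀ _ h.ne']
  · refine Finset.sum_congr rfl fun i _ => Finset.sum_congr rfl fun j _ =>
      Finset.sum_congr rfl fun k _ => ?_
    rcases (hp i j k).eq_or_lt with h | h
    · rw [← h, zero_mul, max_eq_right (by linarith [hq0 i j k])]
    · rcases le_total 1 (q i j k / p i j k) with h1 | h1
      · rw [min_eq_left h1]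
        rw [le_div_iff₀ h, one_mul] at h1
        rw [max_eq_right (by linarith)]; ring
      · rw [min_eq_right h1]
        rw [div_le_one h] at h1
        rw [max_eq_left (by linarith)]
        field_simp

/-! ## From a smoothed state to a filter, and back -/

theorem traceNorm_nonneg {m : Type*} [Fintype m] [DecidableEq m] (M : Matrix m m ℂ) :
    0 ≤ traceNorm M :=
  (Complex.nonneg_iff.1 (psdSqrt_posSemidef _).trace_nonneg).1

theorem one_sub_generalizedFidelity_sq_le {m : Type*} [Fintype m] [DecidableEq m]
    {ρ σ : Matrix m m ℂ} {ε : ℝ} (hε : 0 ≤ ε) (h : purifiedDistance ρ σ ≤ ε) :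
    1 - generalizedFidelity ρ σ ^ 2 ≤ ε ^ 2 :=
  (Real.sqrt_le_left hε).1 h

theorem star_sum_tensorVec_dotProduct {𝒳 𝒯 IX IY K : Type*} [Fintype 𝒳] [Fintype 𝒯] [Fintype IX]
    [Fintype IY] [DecidableEq IX] [DecidableEq IY] [DecidableEq K]
    {ξ : IX × K → 𝒳 → ℂ} {X : ℝ} {α : IX × IY → 𝒯 → ℂ} {Λ : IX × IY → ℝ}
    (hξ : ∀ a b, star (ξ a) ⬝ᵥ ξ b = if a = b then (X : ℂ) else 0)
    (hα : ∀ a b, star (α a) ⬝ᵥ α b = if a = b then (Λ a : ℂ) else 0) (k l : K) :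
    star (∑ i, ∑ j, tensorVec (ξ (i, k)) (α (i, j))) ⬝ᵥ
        (∑ i, ∑ j, tensorVec (ξ (i, l)) (α (i, j))) =
      if k = l then ((∑ i, ∑ j, Λ (i, j) * X : ℝ) : ℂ) else 0 := by
  simp only [star_sum, sum_dotProduct, dotProduct_sum, star_tensorVec_dotProduct, hξ, hα,
    Prod.mk.injEq]
  by_cases h : k = l
  · subst h
    simp [ite_and, mul_comm]
  · simp [h]

/-- Here φ is incoherent in k but coherent in i and j. The normalized product vectors ξ' ⊗ α' serve
as the family e, and p is the weight of φ on them. -/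
theorem exists_filterBound {𝒳 𝒯 IX IY K : Type*} [Fintype 𝒳] [Fintype 𝒯] [Fintype IX]
    [Fintype IY] [Fintype K] [DecidableEq IX] [DecidableEq IY] [DecidableEq K]
    [DecidableEq 𝒳] [DecidableEq 𝒯]
    {ξ : IX × K → 𝒳 → ℂ} {X : ℝ} {α : IX × IY → 𝒯 → ℂ} {Λ : IX × IY → ℝ} {Q : K → ℝ}
    (hξ : ∀ a b, star (ξ a) ⬝ᵥ ξ b = if a = b then (X : ℂ) else 0) (hX : 0 ≤ X)
    (hα : ∀ a b, star (α a) ⬝ᵥ α b = if a = b then (Λ a : ℂ) else 0) (hQ : ∀ k, 0 ≤ Q k)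
    (hp1 : ∑ i, ∑ j, ∑ k, Λ (i, j) * Q k * X ≤ 1)
    {φ τ : Matrix (𝒳 × 𝒯) (𝒳 × 𝒯) ℂ} {σ : Matrix 𝒯 𝒯 ℂ}
    (hφ : φ = ∑ k, (Q k : ℂ) • pureState (∑ i, ∑ j, tensorVec (ξ (i, k)) (α (i, j))))
    (hτ : IsSubState τ) (hσ : IsSubState σ) {t ε : ℝ} (ht : 0 ≤ t) (hε : 0 ≤ ε)
    (hle : ((t : ℂ) • ((1 : Matrix 𝒳 𝒳 ℂ) ⊗ₖ σ) - τ).PosSemidef)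
    (hP : purifiedDistance τ φ ≤ ε) :
    ∃ f s r, FilterBound (fun i j k => Λ (i, j) * Q k * X) ε t f s r := by
  have hΛ := orthogonal_normSq_nonneg hα
  set ξ' := normalizeVec ξ (fun _ => X) with hξ'
  set α' := normalizeVec α Λ with hα'
  have oξ : ∀ a b, star (ξ' a) ⬝ᵥ ξ' b = if a = b then ((X⁻¹ * X : ℝ) : ℂ) else 0 :=
    star_normalizeVec_dotProduct hξ
  have oα := star_normalizeVec_dotProduct hα
  rw [← hα'] at oα
  have hu : ∀ i j k, ((√(Λ (i, j) * Q k * X) : ℝ) : ℂ) • tensorVec (ξ' (i, k)) (α' (i, j)) =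
      ((√(Q k) : ℝ) : ℂ) • tensorVec (ξ (i, k)) (α (i, j)) := fun i j k => by
    rw [← sqrt_smul_normalizeVec hξ (i, k), ← sqrt_smul_normalizeVec hα (i, j),
      smul_tensorVec_smul, smul_smul, Real.sqrt_mul (mul_nonneg (hΛ _) (hQ k)),
      Real.sqrt_mul (hΛ _)]
    push_cast
    congr 1
    ring
  set v : K → 𝒳 × 𝒯 → ℂ := fun k => ((√(Q k) : ℝ) : ℂ) •
    ∑ i, ∑ j, tensorVec (ξ (i, k)) (α (i, j)) with hv
  have hφv : φ = ∑ k, pureState (v k) := by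
    rw [hφ]
    refine Finset.sum_congr rfl fun k _ => ?_
    rw [hv]
    dsimp only
    rw [pureState_smul, RCLike.star_def, Complex.conj_ofReal, ← Complex.ofReal_mul,
      Real.mul_self_sqrt (hQ k)]
  have ov : ∀ k l, star (v k) ⬝ᵥ v l =
      if k = l then ((∑ i, ∑ j, Λ (i, j) * Q k * X : ℝ) : ℂ) else 0 := fun k l => by
    rw [hv]
    dsimp only
    rw [star_smul, smul_dotProduct, dotProduct_smul, star_sum_tensorVec_dotProduct hξ hα]
    by_cases h : k = l
    · subst h
      rw [if_pos rfl, if_pos rfl, RCLike.star_def, Complex.conj_ofReal, smul_eq_mul, smul_eq_mul,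
        ← mul_assoc, ← Complex.ofReal_mul, Real.mul_self_sqrt (hQ k), ← Complex.ofReal_mul]
      congr 1
      simp only [Finset.mul_sum]
      exact Finset.sum_congr rfl fun i _ => Finset.sum_congr rfl fun j _ => by ring
    · rw [if_neg h, if_neg h, smul_zero, smul_zero]
  have htr : φ.trace.re = ∑ i, ∑ j, ∑ k, Λ (i, j) * Q k * X := by
    rw [hφv, trace_sum, Complex.re_sum]
    have : ∀ k, (pureState (v k)).trace.re = ∑ i, ∑ j, Λ (i, j) * Q k * X := fun k => by
      rw [trace_pureState]
      have := ov k k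
      rw [if_pos rfl, star_dotProduct_self_eq] at this
      exact Complex.ofReal_inj.1 this
    simp only [this]
    rw [Finset.sum_comm]
    exact Finset.sum_congr rfl fun i _ => Finset.sum_comm
  have hs := normalizeVec_sum_expVal_le hα hσ.1
  rw [← hα', Fintype.sum_prod_type] at hs
  obtain ⟨f, r, h⟩ := exists_filterBound_of_orthogonal hτ
    (e := fun a : IX × IY × K => tensorVec (ξ' (a.1, a.2.2)) (α' (a.1, a.2.1)))
    (c := fun a => (X⁻¹ * X) * ((Λ (a.1, a.2.1))⁻¹ * Λ (a.1, a.2.1)))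
    (fun a => mul_le_one₀ _root_.inv_mul_le_one
      (mul_nonneg (inv_nonneg.2 (hΛ _)) (hΛ _)) _root_.inv_mul_le_one)
    (fun a b => by
      obtain ⟨i, j, k⟩ := a
      obtain ⟨i', j', k'⟩ := b
      rw [star_tensorVec_dotProduct, oξ, oα]
      by_cases h1 : i = i' <;> by_cases h2 : j = j' <;> by_cases h3 : k = k' <;>
        simp [h1, h2, h3])
    (p := fun i j k => Λ (i, j) * Q k * X)
    (fun i j k => mul_nonneg (mul_nonneg (hΛ _) (hQ k)) hX) hp1
    -- The diagonal of σ in the normalized family; its sum is at most the trace of σ.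
    (s := fun i j => expVal σ (α' (i, j))) (fun i j => expVal_nonneg hσ.1 _) (hs.trans hσ.2) ht
    (fun j k z => by
      refine (expVal_le_of_posSemidef_sub hle _).trans ?_
      rw [expVal_smul]
      refine mul_le_mul_of_nonneg_left ?_ ht
      have e1 : expVal ((1 : Matrix 𝒳 𝒳 ℂ) ⊗ₖ σ)
          (∑ i, z i • tensorVec (ξ' (i, k)) (α' (i, j))) =
          ∑ i, ‖z i‖ ^ 2 * ((X⁻¹ * X) * expVal σ (α' (i, j))) := by
        simp only [expVal, Matrix.mulVec_sum, Matrix.mulVec_smul, one_kronecker_mulVec_tensorVec,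
          star_sum, sum_dotProduct, dotProduct_sum, star_smul, smul_dotProduct, dotProduct_smul,
          star_tensorVec_dotProduct, oξ, Complex.re_sum, Prod.mk.injEq, and_true]
        refine Finset.sum_congr rfl fun i _ => ?_
        rw [Finset.sum_eq_single i (fun b _ hb => by simp [hb]) (by simp), if_pos rfl,
          smul_eq_mul, smul_eq_mul, ← mul_assoc, RCLike.star_def]
        rw [← Complex.re_ofReal_mul, ← Complex.re_ofReal_mul]
        congr 1
        push_cast
        rw [← Complex.conj_mul']
        ring
      rw [e1]
      refine Finset.sum_le_sum fun i _ => mul_le_mul_of_nonneg_left ?_ (sq_nonneg _)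
      exact mul_le_of_le_one_left (expVal_nonneg hσ.1 _) _root_.inv_mul_le_one)
    (F := generalizedFidelity τ φ) hε (add_nonneg (traceNorm_nonneg _) (Real.sqrt_nonneg _))
    (one_sub_generalizedFidelity_sq_le hε hP)
    (by
      rw [generalizedFidelity, htr]
      refine add_le_add_left ?_ _
      conv_lhs => rw [hφv]
      refine (fidelity_sum_pureState_le ov hτ.1).trans ?_
      rw [Finset.sum_comm]
      refine Finset.sum_le_sum fun k _ => ?_
      -- The coherence in j is given up here: the τ-seminorm of `v k` is at most the sum over j of
      -- the seminorms of its parts.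
      have : v k = ∑ j, ∑ i, ((√(Λ (i, j) * Q k * X) : ℝ) : ℂ) •
          tensorVec (ξ' (i, k)) (α' (i, j)) := by
        simp only [hu, hv, Finset.smul_sum]
        exact Finset.sum_comm
      rw [this]
      exact sqrt_expVal_sum_le hτ.1 _ _)
  exact ⟨f, _, r, h⟩

/-- The classical-to-quantum step. The witness σ is diagonal in the normalized α with entries s. The
filtered state is a mixture over j, k and o, so only the coherence in i and l has to be controlled;
the factorization r s is made for Cauchy-Schwarz in these labels. Allowing any g ≤ f, possibly
depending on o and l, leaves room for the filters of other cuts. -/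
theorem exists_posSemidef_sub_of_filterBound {𝒳 𝒜 IX IY K O L : Type*} [Fintype 𝒳] [Fintype 𝒜]
    [Fintype IX] [Fintype IY] [Fintype K] [Fintype O] [Fintype L] [DecidableEq 𝒳] [DecidableEq IX]
    [DecidableEq IY] [DecidableEq K] [DecidableEq L]
    {ξ : IX × L × K → 𝒳 → ℂ} {α : IX × IY → 𝒜 → ℂ} {Λ : IX × IY → ℝ} {q : K → O → ℝ} {χ : L → ℝ}
    (hξ : ∀ a b, star (ξ a) ⬝ᵥ ξ b = if a = b then 1 else 0)
    (hα : ∀ a b, star (α a) ⬝ᵥ α b = if a = b then (Λ a : ℂ) else 0)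
    (hq : ∀ k o, 0 ≤ q k o) (hχ : ∀ l, 0 ≤ χ l) {g : IX → IY → K → O → L → ℝ}
    {f : IX → IY → K → ℝ} (hg : ∀ i j k o l, 0 ≤ g i j k o l)
    (hgf : ∀ i j k o l, g i j k o l ≤ f i j k) {ε t : ℝ} (ht : 0 ≤ t) {s : IX → IY → ℝ}
    {r : IX → IY → K → ℝ}
    (h : FilterBound (fun i j k => Λ (i, j) * (∑ o, q k o) * ∑ l, χ l) ε t f s r) :
    ∃ σ : Matrix 𝒜 𝒜 ℂ, IsSubState σ ∧ ((t : ℂ) • ((1 : Matrix 𝒳 𝒳 ℂ) ⊗ₖ σ) -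
      ∑ j, ∑ k, ∑ o, pureState (∑ i, ∑ l, ((√(q k o * χ l * g i j k o l) : ℝ) : ℂ) •
        tensorVec (ξ (i, l, k)) (α (i, j)))).PosSemidef := by
  have hΛ := orthogonal_normSq_nonneg hα
  set α' := normalizeVec α Λ with hα'
  have oα := star_normalizeVec_dotProduct hα
  rw [← hα'] at oα
  have hσ : (∑ i, ∑ j, ((s i j : ℝ) : ℂ) • pureState (α' (i, j))).PosSemidef :=
    posSemidef_sum _ fun i _ => posSemidef_sum _ fun j _ =>
      ofReal_smul_posSemidef (pureState_posSemidef _) (h.s_nonneg i j)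
  refine ⟨∑ i, ∑ j, ((s i j : ℝ) : ℂ) • pureState (α' (i, j)), ⟨hσ, ?_⟩, ?_⟩
  · refine le_trans ?_ h.s_sum
    rw [trace_sum, Complex.re_sum]
    refine Finset.sum_le_sum fun i _ => ?_
    rw [trace_sum, Complex.re_sum]
    refine Finset.sum_le_sum fun j _ => ?_
    rw [trace_smul, smul_eq_mul, Complex.re_ofReal_mul, trace_pureState]
    refine mul_le_of_le_one_right (h.s_nonneg i j) ?_
    have := oα (i, j) (i, j)
    rw [if_pos rfl, star_dotProduct_self_eq] at this
    rw [Complex.ofReal_inj.1 this]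
    exact _root_.inv_mul_le_one
  have h1σ : ((1 : Matrix 𝒳 𝒳 ℂ) ⊗ₖ
      (∑ i, ∑ j, ((s i j : ℝ) : ℂ) • pureState (α' (i, j)))).PosSemidef :=
    PosSemidef.one.kronecker hσ
  refine posSemidef_sub_of_expVal_le (posSemidef_sum _ fun j _ => posSemidef_sum _ fun k _ =>
    posSemidef_sum _ fun o _ => pureState_posSemidef _) (ofReal_smul_posSemidef h1σ ht) fun z => ?_
  set y : IX → IY → L → K → ℂ := fun i j l k =>
    star (ξ (i, l, k)) ⬝ᵥ fun x => star (α' (i, j)) ⬝ᵥ fun a => z (x, a) with hy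
  -- The share of `r i j k` that belongs to the labels o and l, in proportion to their weights. The
  -- shares add up to r, or to 0 if the total weight is 0.
  set w : IX → L → K → O → IY → ℝ := fun i l k o j =>
    q k o * χ l / ((∑ o, q k o) * ∑ l, χ l) * r i j k with hw
  have hQ : ∀ k, 0 ≤ ∑ o, q k o := fun k => Finset.sum_nonneg fun o _ => hq k o
  have hX : 0 ≤ ∑ l, χ l := Finset.sum_nonneg fun l _ => hχ l
  have hw0 : ∀ i l k o j, 0 ≤ w i l k o j := fun i l k o j =>
    mul_nonneg (div_nonneg (mul_nonneg (hq k o) (hχ l)) (mul_nonneg (hQ k) hX)) (h.r_nonneg i j k)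
  have hws : ∀ i l k o j, q k o * χ l * g i j k o l * Λ (i, j) ≤ w i l k o j * s i j := by
    intro i l k o j
    have hqχ : 0 ≤ q k o * χ l := mul_nonneg (hq k o) (hχ l)
    rcases hqχ.eq_or_lt with h0 | h0
    · simp only [hw, ← h0]; simp
    have hq0 : 0 < q k o := lt_of_le_of_ne (hq k o) fun h1 => by rw [← h1] at h0; simp at h0
    have hχ0 : 0 < χ l := lt_of_le_of_ne (hχ l) fun h1 => by rw [← h1] at h0; simp at h0
    have hQ0 : 0 < ∑ o, q k o :=
      hq0.trans_le (Finset.single_le_sum (fun o _ => hq k o) (Finset.mem_univ o))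
    have hX0 : 0 < ∑ l, χ l :=
      hχ0.trans_le (Finset.single_le_sum (fun l _ => hχ l) (Finset.mem_univ l))
    have h1 : Λ (i, j) * (∑ o, q k o) * (∑ l, χ l) * g i j k o l ≤ r i j k * s i j :=
      (mul_le_mul_of_nonneg_left (hgf i j k o l)
        (mul_nonneg (mul_nonneg (hΛ _) (hQ k)) hX)).trans (h.weight_le i j k)
    have h2 := mul_le_mul_of_nonneg_left h1
      (div_nonneg hqχ (mul_nonneg (hQ k) hX) : 0 ≤ q k o * χ l / ((∑ o, q k o) * ∑ l, χ l))
    calc q k o * χ l * g i j k o l * Λ (i, j) = q k o * χ l / ((∑ o, q k o) * ∑ l, χ l) *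
          (Λ (i, j) * (∑ o, q k o) * (∑ l, χ l) * g i j k o l) := by field_simp
      _ ≤ _ := h2
      _ = _ := by rw [hw]; ring
  have hterm : ∀ j k o, expVal (pureState (∑ i, ∑ l, ((√(q k o * χ l * g i j k o l) : ℝ) : ℂ) •
        tensorVec (ξ (i, l, k)) (α (i, j)))) z ≤
      (∑ i, ∑ l, w i l k o j) * ∑ i, ∑ l, s i j * ‖y i j l k‖ ^ 2 := by
    intro j k o
    rw [expVal_pureState]
    have e1 : star (∑ i, ∑ l, ((√(q k o * χ l * g i j k o l) : ℝ) : ℂ) •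
        tensorVec (ξ (i, l, k)) (α (i, j))) ⬝ᵥ z =
        ∑ i, ∑ l, ((√(q k o * χ l * g i j k o l) * √(Λ (i, j)) : ℝ) : ℂ) * y i j l k := by
      simp only [star_sum, sum_dotProduct, star_smul, smul_dotProduct]
      refine Finset.sum_congr rfl fun i _ => Finset.sum_congr rfl fun l _ => ?_
      rw [star_tensorVec_dotProduct_eq, ← sqrt_smul_normalizeVec hα (i, j), ← hα']
      simp only [star_smul, smul_dotProduct, RCLike.star_def, Complex.conj_ofReal]
      rw [show (fun x => ((√(Λ (i, j)) : ℝ) : ℂ) • (star (α' (i, j)) ⬝ᵥ fun a => z (x, a))) =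
        ((√(Λ (i, j)) : ℝ) : ℂ) • fun x => star (α' (i, j)) ⬝ᵥ fun a => z (x, a) from rfl,
        dotProduct_smul, smul_eq_mul, smul_eq_mul]
      push_cast
      ring
    have e2 : ‖star (∑ i, ∑ l, ((√(q k o * χ l * g i j k o l) : ℝ) : ℂ) •
        tensorVec (ξ (i, l, k)) (α (i, j))) ⬝ᵥ z‖ ≤
        ∑ a : IX × L, √(w a.1 a.2 k o j) * (√(s a.1 j) * ‖y a.1 j a.2 k‖) := by
      rw [e1, Fintype.sum_prod_type]
      refine (norm_sum_le _ _).trans (Finset.sum_le_sum fun i _ =>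
        (norm_sum_le _ _).trans (Finset.sum_le_sum fun l _ => ?_))
      rw [norm_mul, Complex.norm_real, Real.norm_eq_abs, abs_of_nonneg (by positivity), ← mul_assoc]
      refine mul_le_mul_of_nonneg_right ?_ (norm_nonneg _)
      rw [← Real.sqrt_mul (mul_nonneg (mul_nonneg (hq k o) (hχ l)) (hg i j k o l)),
        ← Real.sqrt_mul (hw0 i l k o j)]
      exact Real.sqrt_le_sqrt (hws i l k o j)
    refine (pow_le_pow_left₀ (norm_nonneg _) e2 2).trans
      ((Finset.sum_mul_sq_le_sq_mul_sq _ _ _).trans (le_of_eq ?_))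
    rw [Fintype.sum_prod_type, Fintype.sum_prod_type]
    congr 1
    · exact Finset.sum_congr rfl fun i _ => Finset.sum_congr rfl fun l _ =>
        Real.sq_sqrt (hw0 i l k o j)
    · exact Finset.sum_congr rfl fun i _ => Finset.sum_congr rfl fun l _ => by
        rw [mul_pow, Real.sq_sqrt (h.s_nonneg i j)]
  have hwt : ∀ j k, ∑ o, ∑ i, ∑ l, w i l k o j ≤ t := by
    intro j k
    have : ∑ o, ∑ i, ∑ l, w i l k o j =
        ((∑ o, q k o) * ∑ l, χ l) / ((∑ o, q k o) * ∑ l, χ l) * ∑ i, r i j k := by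
      simp only [hw, ← Finset.sum_mul, ← Finset.mul_sum, ← Finset.sum_div]
    rw [this]
    exact (mul_le_of_le_one_left (Finset.sum_nonneg fun i _ => h.r_nonneg i j k)
      (div_self_le_one _)).trans (h.r_sum j k)
  have hs0 : ∀ j k, 0 ≤ ∑ i, ∑ l, s i j * ‖y i j l k‖ ^ 2 := fun j k =>
    Finset.sum_nonneg fun i _ => Finset.sum_nonneg fun l _ =>
      mul_nonneg (h.s_nonneg i j) (sq_nonneg _)
  calc expVal (∑ j, ∑ k, ∑ o, pureState (∑ i, ∑ l, ((√(q k o * χ l * g i j k o l) : ℝ) : ℂ) •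
        tensorVec (ξ (i, l, k)) (α (i, j)))) z
      ≤ ∑ j, ∑ k, ∑ o, (∑ i, ∑ l, w i l k o j) * ∑ i, ∑ l, s i j * ‖y i j l k‖ ^ 2 := by
        simp only [expVal_sum_matrix]
        exact Finset.sum_le_sum fun j _ => Finset.sum_le_sum fun k _ =>
          Finset.sum_le_sum fun o _ => hterm j k o
    _ ≤ ∑ j, ∑ k, t * ∑ i, ∑ l, s i j * ‖y i j l k‖ ^ 2 := by
        refine Finset.sum_le_sum fun j _ => Finset.sum_le_sum fun k _ => ?_
        rw [← Finset.sum_mul]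
        exact mul_le_mul_of_nonneg_right (hwt j k) (hs0 j k)
    _ = t * ∑ i, ∑ j, s i j * ∑ l, ∑ k, ‖y i j l k‖ ^ 2 := by
        simp only [← Finset.mul_sum]
        congr 1
        simp only [Finset.mul_sum]
        exact (Finset.sum_congr rfl fun j _ => Finset.sum_comm).trans (Finset.sum_comm.trans
          (Finset.sum_congr rfl fun i _ => Finset.sum_congr rfl fun j _ => Finset.sum_comm))
    _ ≤ t * ∑ i, ∑ j, s i j * ∑ x, ‖star (α' (i, j)) ⬝ᵥ fun a => z (x, a)‖ ^ 2 := by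
        refine mul_le_mul_of_nonneg_left (Finset.sum_le_sum fun i _ => Finset.sum_le_sum fun j _ =>
          mul_le_mul_of_nonneg_left ?_ (h.s_nonneg i j)) ht
        -- For fixed i the vectors ξ(i, l, k) are orthonormal in (l, k), so the sum over these
        -- labels is bounded by Bessel's inequality.
        rw [← Fintype.sum_prod_type']
        exact sum_norm_dotProduct_sq_le (fun a : L × K => ξ (i, a.1, a.2)) (fun _ => 1)
          (fun _ => le_rfl) (fun a b => by
            obtain ⟨l, k⟩ := a
            obtain ⟨l', k'⟩ := b
            rw [hξ]; simp) (fun x => star (α' (i, j)) ⬝ᵥ fun a => z (x, a))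
    _ = _ := by
        rw [expVal_smul, expVal_one_kronecker]
        congr 1
        simp only [expVal_sum_matrix, expVal_smul, expVal_pureState, Finset.mul_sum]
        exact ((Finset.sum_comm).trans (Finset.sum_congr rfl fun i _ => Finset.sum_comm)).symm

/-! ### Compactness of filters -/

/-- All conditions are non-strict polynomial inequalities, hence closed, and the two sum conditions
confine s and r to a box. With s and r among the data no quotients occur, so closedness is
immediate. -/
theorem FilterBound.isCompact {IX IY K : Type*} [Fintype IX] [Fintype IY] [Fintype K]
    (p : IX → IY → K → ℝ) (ε t : ℝ) :
    IsCompact {x : (IX → IY → K → ℝ) × (IX → IY → ℝ) × (IX → IY → K → ℝ) |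
      FilterBound p ε t x.1 x.2.1 x.2.2} := by
  refine (isCompact_Icc (a := 0) (b := (fun _ _ _ => 1, fun _ _ => 1,
    fun _ _ _ => t))).of_isClosed_subset
    ?_ ?_
  · have : {x : (IX → IY → K → ℝ) × (IX → IY → ℝ) × (IX → IY → K → ℝ) |
      FilterBound p ε t x.1 x.2.1 x.2.2} =
      {x | (∀ i j k, 0 ≤ x.1 i j k) ∧ (∀ i j k, x.1 i j k ≤ 1) ∧ (∀ i j, 0 ≤ x.2.1 i j) ∧
        (∑ i, ∑ j, x.2.1 i j ≤ 1) ∧ (∀ i j k, 0 ≤ x.2.2 i j k) ∧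
        (∀ i j k, p i j k * x.1 i j k ≤ x.2.2 i j k * x.2.1 i j) ∧
        (∀ j k, ∑ i, x.2.2 i j k ≤ t) ∧
        ∑ i, ∑ j, ∑ k, p i j k * (1 - x.1 i j k) ≤ ε} :=
      Set.ext fun x => ⟨fun h => ⟨h.1, h.2, h.3, h.4, h.5, h.6, h.7, h.8⟩,
        fun ⟨h1, h2, h3, h4, h5, h6, h7, h8⟩ => ⟨h1, h2, h3, h4, h5, h6, h7, h8⟩⟩
    rw [this]
    simp only [Set.ofPred_and, Set.ofPred_forall]
    refine IsClosed.inter ?_ (IsClosed.inter ?_ (IsClosed.inter ?_ (IsClosed.inter ?_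
      (IsClosed.inter ?_ (IsClosed.inter ?_ (IsClosed.inter ?_ ?_))))))
    all_goals
      repeat refine isClosed_iInter fun _ => ?_
      exact isClosed_le (by fun_prop) (by fun_prop)
  · rintro ⟨f, s, r⟩ h
    refine ⟨⟨fun i j k => h.f_nonneg i j k, fun i j => h.s_nonneg i j,
      fun i j k => h.r_nonneg i j k⟩, fun i j k => h.f_le_one i j k, fun i j => ?_,
      fun i j k => ?_⟩
    · exact ((Finset.single_le_sum (fun j _ => h.s_nonneg i j) (Finset.mem_univ j)).trans
        (Finset.single_le_sum (f := fun i => ∑ j, s i j)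
          (fun i _ => Finset.sum_nonneg fun j _ => h.s_nonneg i j)
          (Finset.mem_univ i))).trans h.s_sum
    · exact (Finset.single_le_sum (f := fun i => r i j k) (fun i _ => h.r_nonneg i j k)
        (Finset.mem_univ i)).trans (h.r_sum j k)

theorem FilterBound.mono {IX IY K : Type*} [Fintype IX] [Fintype IY] [Fintype K]
    {p : IX → IY → K → ℝ} {ε t t' : ℝ} {f s r} (h : FilterBound p ε t f s r) (ht : t ≤ t') :
    FilterBound p ε t' f s r :=
  { h with r_sum := fun j k => (h.r_sum j k).trans ht }

/-- By compactness, one filter works for all thresholds below a supremum. -/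
theorem exists_filterBound_forall {IX IY K : Type*} [Fintype IX] [Fintype IY] [Fintype K]
    {p : IX → IY → K → ℝ} {ε : ℝ} (hε : 0 ≤ ε) (H : EReal)
    (h : ∀ x : ℝ, (x : EReal) < H → ∃ f s r, FilterBound p ε (2 ^ (-x)) f s r) :
    ∃ f s r, (∀ i j k, 0 ≤ f i j k) ∧ (∀ i j k, f i j k ≤ 1) ∧
      (∑ i, ∑ j, ∑ k, p i j k * (1 - f i j k) ≤ ε) ∧
      ∀ x : ℝ, (x : EReal) < H → FilterBound p ε (2 ^ (-x)) f s r := by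
  by_cases hH : Nonempty {x : ℝ // (x : EReal) < H}
  · obtain ⟨⟨f, s, r⟩, hx⟩ := IsCompact.nonempty_iInter_of_directed_nonempty_isCompact_isClosed
      (fun x : {x : ℝ // (x : EReal) < H} =>
        {y : (IX → IY → K → ℝ) × (IX → IY → ℝ) × (IX → IY → K → ℝ) |
          FilterBound p ε (2 ^ (-x.1)) y.1 y.2.1 y.2.2})
      -- A larger x is a stricter threshold, so the sets are nested and in particular directed.
      (fun x y => by
        have key : ∀ a b : {x : ℝ // (x : EReal) < H}, a.1 ≤ b.1 →
            {y : (IX → IY → K → ℝ) × (IX → IY → ℝ) × (IX → IY → K → ℝ) |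
              FilterBound p ε (2 ^ (-b.1)) y.1 y.2.1 y.2.2} ⊆
            {y | FilterBound p ε (2 ^ (-a.1)) y.1 y.2.1 y.2.2} := fun a b hab _ hz =>
          FilterBound.mono hz
            (Real.rpow_le_rpow_of_exponent_le one_le_two (neg_le_neg hab))
        rcases le_total x.1 y.1 with hxy | hxy
        · exact ⟨y, key x y hxy, subset_rfl⟩
        · exact ⟨x, subset_rfl, key y x hxy⟩)
      (fun x => by
        obtain ⟨f, s, r, hf⟩ := h x.1 x.2
        exact ⟨(f, s, r), hf⟩)
      (fun x => FilterBound.isCompact p ε _) (fun x => (FilterBound.isCompact p ε _).isClosed)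
    have hx' : ∀ x : ℝ, (x : EReal) < H → FilterBound p ε (2 ^ (-x)) f s r := fun x hxH =>
      Set.mem_iInter.1 hx ⟨x, hxH⟩
    obtain ⟨x⟩ := hH
    have h0 := hx' x.1 x.2
    exact ⟨f, s, r, h0.f_nonneg, h0.f_le_one, h0.loss, hx'⟩
  · exact ⟨fun _ _ _ => 1, 0, 0, fun _ _ _ => zero_le_one, fun _ _ _ => le_rfl, by simpa using hε,
      fun x hx => (hH ⟨⟨x, hx⟩⟩).elim⟩

/-! ## Conditional min-entropies -/

/-- The strict inequality replaces attainment of the two suprema and the infimum. The exponent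
obtained lies below -x, and raising it to -x only adds a positive multiple of I ⊗ σ. -/
theorem exists_of_lt_smoothCondMinEntropy {m n : Type*} [Fintype m] [DecidableEq m] [Fintype n]
    [DecidableEq n] {ε x : ℝ} {ρ : Matrix (m × n) (m × n) ℂ}
    (h : (x : EReal) < smoothCondMinEntropy ε ρ) :
    ∃ τ σ, IsSubState τ ∧ purifiedDistance τ ρ ≤ ε ∧ IsSubState σ ∧
      ((((2 : ℝ) ^ (-x) : ℝ) : ℂ) • ((1 : Matrix m m ℂ) ⊗ₖ σ) - τ).PosSemidef := by
  obtain ⟨_, ⟨τ, hτ, hP, rfl⟩, h1⟩ := lt_sSup_iff.1 h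
  obtain ⟨_, ⟨σ, hσ, rfl⟩, h2⟩ := lt_sSup_iff.1 h1
  rw [condMinEntropyRel, EReal.lt_neg_comm, sInf_lt_iff] at h2
  obtain ⟨_, ⟨t, rfl, ht⟩, h3⟩ := h2
  refine ⟨τ, σ, hτ, hP, hσ, ?_⟩
  rw [← EReal.coe_neg, EReal.coe_lt_coe_iff] at h3
  have h4 : (2 : ℝ) ^ t ≤ 2 ^ (-x) := Real.rpow_le_rpow_of_exponent_le one_le_two h3.le
  have h5 := ofReal_smul_posSemidef
    (PosSemidef.one.kronecker hσ.1 : ((1 : Matrix m m ℂ) ⊗ₖ σ).PosSemidef)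
    (sub_nonneg.2 h4)
  have := h5.add ht
  rw [Complex.ofReal_sub, sub_smul] at this
  simpa using this

theorem le_condMinEntropy_of_forall_lt {m n : Type*} [Fintype m] [DecidableEq m] [Fintype n]
    {ρ : Matrix (m × n) (m × n) ℂ} {H : EReal}
    (h : ∀ x : ℝ, (x : EReal) < H → ∃ σ, IsSubState σ ∧
      ((((2 : ℝ) ^ (-x) : ℝ) : ℂ) • ((1 : Matrix m m ℂ) ⊗ₖ σ) - ρ).PosSemidef) :
    H ≤ condMinEntropy ρ := by
  refine EReal.ge_of_forall_gt_iff_ge.1 fun x hx => ?_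
  obtain ⟨σ, hσ, hx⟩ := h x hx
  refine le_trans ?_ (le_sSup ⟨σ, hσ, rfl⟩)
  rw [condMinEntropyRel, EReal.le_neg, ← EReal.coe_neg]
  exact sInf_le ⟨-x, rfl, hx⟩

theorem condMinEntropy_zero {m n : Type*} [Fintype m] [DecidableEq m] [Fintype n] :
    condMinEntropy (0 : Matrix (m × n) (m × n) ℂ) = ⊤ :=
  top_le_iff.1 <| le_condMinEntropy_of_forall_lt fun _ _ =>
    ⟨0, ⟨PosSemidef.zero, by simp⟩, by simpa using PosSemidef.zero⟩

theorem tensorVec_sum_sum {m n ι κ : Type*} (s : Finset ι) (t : Finset κ) (u : ι → m → ℂ)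
    (v : κ → n → ℂ) :
    tensorVec (∑ i ∈ s, u i) (∑ j ∈ t, v j) = ∑ i ∈ s, ∑ j ∈ t, tensorVec (u i) (v j) := by
  ext p
  simp only [tensorVec, Finset.sum_apply, Finset.sum_mul_sum]

theorem star_sum_sqrt_smul_dotProduct {κ ι m : Type*} [Fintype m] [Fintype κ] [DecidableEq ι]
    [DecidableEq κ] {v : κ × ι → m → ℂ}
    (hv : ∀ a b, star (v a) ⬝ᵥ v b = if a = b then 1 else 0) {w : κ → ι → ℝ}
    (hw : ∀ k i, 0 ≤ w k i) (i j : ι) :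
    star (∑ k, ((√(w k i) : ℝ) : ℂ) • v (k, i)) ⬝ᵥ (∑ k, ((√(w k j) : ℝ) : ℂ) • v (k, j)) =
      if i = j then ((∑ k, w k i : ℝ) : ℂ) else 0 := by
  simp only [star_sum, sum_dotProduct, dotProduct_sum, star_smul, smul_dotProduct,
    dotProduct_smul, hv, Prod.mk.injEq, RCLike.star_def, Complex.conj_ofReal, smul_eq_mul]
  by_cases h : i = j
  · subst h
    simp only [and_true, mul_ite, mul_one, mul_zero, Finset.sum_ite_eq',
      Finset.mem_univ, if_true]
    push_cast
    refine Finset.sum_congr rfl fun k _ => ?_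
    rw [← Complex.ofReal_mul, Real.mul_self_sqrt (hw k i)]
  · simp [h]

/-- The transition of smooth conditional min-entropies for a single cut, for states that are given
by orthonormal product families. -/
theorem exists_filter {𝒳 𝒜 𝒯 N IX IY K O L : Type*} [Fintype 𝒳] [Fintype 𝒜] [Fintype 𝒯]
    [Fintype N] [Fintype IX] [Fintype IY] [Fintype K] [Fintype O] [Fintype L]
    [DecidableEq 𝒳] [DecidableEq 𝒯] [DecidableEq N] [DecidableEq IX] [DecidableEq IY]
    [DecidableEq K] [DecidableEq L]
    {ξ : L × IX × K → 𝒳 → ℂ} {a : N × IX × IY → 𝒜 → ℂ} {b : N × IX × IY → 𝒯 → ℂ}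
    (hξ : ∀ x y, star (ξ x) ⬝ᵥ ξ y = if x = y then 1 else 0)
    (ha : ∀ x y, star (a x) ⬝ᵥ a y = if x = y then 1 else 0)
    (hb : ∀ x y, star (b x) ⬝ᵥ b y = if x = y then 1 else 0)
    {lam : N → IX × IY → ℝ} {q : K → O → ℝ} {χ : L → ℝ} (hlam : ∀ n i, 0 ≤ lam n i)
    (hq : ∀ k o, 0 ≤ q k o) (hχ : ∀ l, 0 ≤ χ l)
    (h1 : ∑ n, ∑ i, ∑ j, ∑ k, ∑ o, ∑ l, lam n (i, j) * q k o * χ l ≤ 1) {ε : ℝ} (hε : 0 ≤ ε) :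
    ∃ f : IX → IY → K → ℝ, (∀ i j k, 0 ≤ f i j k) ∧ (∀ i j k, f i j k ≤ 1) ∧
      (∑ n, ∑ i, ∑ j, ∑ k, ∑ o, ∑ l, lam n (i, j) * q k o * χ l * (1 - f i j k) ≤ ε) ∧
      ∀ g : IX → IY → K → O → L → ℝ, (∀ i j k o l, 0 ≤ g i j k o l) →
        (∀ i j k o l, g i j k o l ≤ f i j k) →
        smoothCondMinEntropy ε (∑ d : K × O, pureState (∑ c : N × IX × IY × L,
            ((√(lam c.1 (c.2.1, c.2.2.1) * q d.1 d.2 * χ c.2.2.2) : ℝ) : ℂ) •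
              tensorVec (ξ (c.2.2.2, c.2.1, d.1)) (b (c.1, c.2.1, c.2.2.1)))) ≤
          condMinEntropy (∑ d : IY × K × O, pureState (∑ c : N × IX × L,
            ((√(lam c.1 (c.2.1, d.1) * q d.2.1 d.2.2 * χ c.2.2 *
                g c.2.1 d.1 d.2.1 d.2.2 c.2.2) : ℝ) : ℂ) •
              tensorVec (ξ (c.2.2, c.2.1, d.2.1)) (a (c.1, c.2.1, d.1)))) := by
  set Λ : IX × IY → ℝ := fun i => ∑ n, lam n i with hΛ
  set X := ∑ l, χ l with hX
  set Q : K → ℝ := fun k => ∑ o, q k o with hQ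
  -- In ρ the labels l and n are coherent and not correlated with the rest beyond (i, j, k), so they
  -- are summed into the vectors; o only contributes to the mixture weight Q.
  set ξ' : IX × K → 𝒳 → ℂ := fun i => ∑ l, ((√(χ l) : ℝ) : ℂ) • ξ (l, i) with hξ'
  set a' : IX × IY → 𝒜 → ℂ := fun i => ∑ n, ((√(lam n i) : ℝ) : ℂ) • a (n, i) with ha'
  set b' : IX × IY → 𝒯 → ℂ := fun i => ∑ n, ((√(lam n i) : ℝ) : ℂ) • b (n, i) with hb'
  have oξ : ∀ x y, star (ξ' x) ⬝ᵥ ξ' y = if x = y then (X : ℂ) else 0 :=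
    star_sum_sqrt_smul_dotProduct hξ (w := fun l _ => χ l) fun l _ => hχ l
  have oa : ∀ x y, star (a' x) ⬝ᵥ a' y = if x = y then (Λ x : ℂ) else 0 :=
    star_sum_sqrt_smul_dotProduct ha hlam
  have ob : ∀ x y, star (b' x) ⬝ᵥ b' y = if x = y then (Λ x : ℂ) else 0 :=
    star_sum_sqrt_smul_dotProduct hb hlam
  have hp : ∀ F : IX → IY → K → ℝ, ∑ n, ∑ i, ∑ j, ∑ k, ∑ o, ∑ l,
      lam n (i, j) * q k o * χ l * F i j k = ∑ i, ∑ j, ∑ k, Λ (i, j) * Q k * X * F i j k := by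
    intro F
    rw [Finset.sum_comm]
    refine Finset.sum_congr rfl fun i _ => ?_
    rw [Finset.sum_comm]
    refine Finset.sum_congr rfl fun j _ => ?_
    rw [Finset.sum_comm]
    refine Finset.sum_congr rfl fun k _ => ?_
    simp only [hΛ, hQ, hX, ← Finset.sum_mul, ← Finset.mul_sum]
  have hp1 := hp fun _ _ _ => 1
  simp only [mul_one] at hp1
  rw [hp1] at h1
  set ρ := ∑ d : K × O, pureState (∑ c : N × IX × IY × L,
            ((√(lam c.1 (c.2.1, c.2.2.1) * q d.1 d.2 * χ c.2.2.2) : ℝ) : ℂ) •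
              tensorVec (ξ (c.2.2.2, c.2.1, d.1)) (b (c.1, c.2.1, c.2.2.1))) with hρdef
  have hρ : ρ = ∑ k, (Q k : ℂ) • pureState (∑ i, ∑ j, tensorVec (ξ' (i, k)) (b' (i, j))) := by
    rw [hρdef, Fintype.sum_prod_type]
    refine Finset.sum_congr rfl fun k _ => ?_
    rw [hQ, Complex.ofReal_sum, Finset.sum_smul]
    refine Finset.sum_congr rfl fun o _ => ?_
    have : (∑ c : N × IX × IY × L,
        ((√(lam c.1 (c.2.1, c.2.2.1) * q k o * χ c.2.2.2) : ℝ) : ℂ) •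
          tensorVec (ξ (c.2.2.2, c.2.1, k)) (b (c.1, c.2.1, c.2.2.1))) =
        ((√(q k o) : ℝ) : ℂ) • ∑ i, ∑ j, tensorVec (ξ' (i, k)) (b' (i, j)) := by
      simp only [Fintype.sum_prod_type, hξ', hb', tensorVec_sum_sum, smul_tensorVec_smul,
        Finset.smul_sum, smul_smul]
      rw [Finset.sum_comm]
      refine Finset.sum_congr rfl fun i _ => ?_
      rw [Finset.sum_comm]
      refine Finset.sum_congr rfl fun j _ => ?_
      rw [Finset.sum_comm]
      refine Finset.sum_congr rfl fun l _ => Finset.sum_congr rfl fun n _ => ?_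
      congr 1
      rw [Real.sqrt_mul (mul_nonneg (hlam _ _) (hq _ _)), Real.sqrt_mul (hlam _ _)]
      push_cast
      ring
    rw [this, pureState_smul, RCLike.star_def, Complex.conj_ofReal, ← Complex.ofReal_mul,
      Real.mul_self_sqrt (hq k o)]
  -- The smoothed state may vary with the threshold x; compactness yields one filter for all x below
  -- the smooth entropy.
  obtain ⟨f, s, r, hf0, hf1, hloss, hfx⟩ := exists_filterBound_forall
    (p := fun i j k => Λ (i, j) * Q k * X) hε (smoothCondMinEntropy ε ρ) fun x hx => by
      obtain ⟨τ, σ, hτ, hP, hσ, hle⟩ := exists_of_lt_smoothCondMinEntropy hx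
      exact exists_filterBound oξ (Finset.sum_nonneg fun l _ => hχ l) ob
        (fun k => Finset.sum_nonneg fun o _ => hq k o) h1 hρ hτ hσ (by positivity) hε hle hP
  refine ⟨f, hf0, hf1, (hp fun i j k => 1 - f i j k).trans_le hloss, fun g hg0 hgf => ?_⟩
  refine le_condMinEntropy_of_forall_lt fun x hx => ?_
  obtain ⟨σ, hσ, h⟩ := exists_posSemidef_sub_of_filterBound
    (ξ := fun c : IX × L × K => ξ (c.2.1, c.1, c.2.2)) (α := a') (Λ := Λ) (q := q) (χ := χ)
    (fun x y => by
      rw [hξ]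
      obtain ⟨x1, x2, x3⟩ := x
      obtain ⟨y1, y2, y3⟩ := y
      simp only [Prod.mk.injEq]
      congr 1
      exact propext ⟨fun ⟨h1, h2, h3⟩ => ⟨h2, h1, h3⟩, fun ⟨h1, h2, h3⟩ => ⟨h2, h1, h3⟩⟩)
    oa hq hχ hg0 hgf (by positivity : (0 : ℝ) ≤ 2 ^ (-x)) (hfx x hx)
  refine ⟨σ, hσ, ?_⟩
  convert h using 2
  simp only [Fintype.sum_prod_type]
  refine Finset.sum_congr rfl fun j _ => Finset.sum_congr rfl fun k _ =>
    Finset.sum_congr rfl fun o _ => ?_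
  congr 1
  have ht : ∀ (u : 𝒳 → ℂ) i, tensorVec u (a' (i, j)) =
      ∑ n, ((√(lam n (i, j)) : ℝ) : ℂ) • tensorVec u (a (n, i, j)) := fun u i => by
    ext p
    simp only [tensorVec, ha', Finset.sum_apply, Pi.smul_apply, smul_eq_mul, Finset.mul_sum]
    exact Finset.sum_congr rfl fun n _ => by ring
  simp only [ht, Finset.smul_sum, smul_smul]
  rw [Finset.sum_comm]
  refine Finset.sum_congr rfl fun i _ => ?_
  rw [Finset.sum_comm]
  refine Finset.sum_congr rfl fun l _ => Finset.sum_congr rfl fun n _ => ?_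
  congr 1
  rw [← Complex.ofReal_mul, ← Real.sqrt_mul
    (mul_nonneg (mul_nonneg (hq k o) (hχ l)) (hg0 i j k o l))]
  congr 2
  ring

/-! ## Product bases of half-edges -/

noncomputable instance HalfEdge.instFintype {V : Type*} [Finite V] (G : SimpleGraph V) :
    Fintype (HalfEdge G) :=
  Fintype.ofFinite _

noncomputable instance HalfEdge.instFintypeSet {V : Type*} [Finite V] {G : SimpleGraph V}
    (S : Set (HalfEdge G)) : Fintype S :=
  Fintype.ofFinite _

/-- Labels of the edges in `P`. -/
def EdgeLabelOn {V : Type*} {G : SimpleGraph V} (D : G.edgeSet → ℕ) (P : Set G.edgeSet) : Type _ :=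
  (e : P) → Fin (D e.1)

/-- Labels of all edges. -/
def EdgeLabel {V : Type*} {G : SimpleGraph V} (D : G.edgeSet → ℕ) : Type _ :=
  (e : G.edgeSet) → Fin (D e)

noncomputable instance EdgeLabelOn.instFintype {V : Type*} [Finite V] {G : SimpleGraph V}
    (D : G.edgeSet → ℕ) (P : Set G.edgeSet) : Fintype (EdgeLabelOn D P) :=
  haveI : Finite (EdgeLabelOn D P) := inferInstanceAs (Finite ((e : P) → Fin (D e.1)))
  Fintype.ofFinite _

noncomputable instance EdgeLabelOn.instDecidableEq {V : Type*} {G : SimpleGraph V}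
    (D : G.edgeSet → ℕ) (P : Set G.edgeSet) : DecidableEq (EdgeLabelOn D P) :=
  Classical.decEq _

noncomputable instance EdgeLabel.instFintype {V : Type*} [Finite V] {G : SimpleGraph V}
    (D : G.edgeSet → ℕ) : Fintype (EdgeLabel D) :=
  haveI : Finite (EdgeLabel D) := inferInstanceAs (Finite ((e : G.edgeSet) → Fin (D e)))
  Fintype.ofFinite _

noncomputable instance EdgeLabel.instDecidableEq {V : Type*} {G : SimpleGraph V}
    (D : G.edgeSet → ℕ) : DecidableEq (EdgeLabel D) :=
  Classical.decEq _

/-- Vectors `B h l` of `H_h` for all half-edges `h`, labelled as the standard basis. -/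
abbrev LocalFamily {V : Type*} {G : SimpleGraph V} (D : G.edgeSet → ℕ) : Type _ :=
  (h : HalfEdge G) → Fin (D h.edge) → Fin (D h.edge) → ℂ

/-- The vectors at each half-edge are orthonormal. -/
def LocalFamily.IsOrthonormal {V : Type*} {G : SimpleGraph V} {D : G.edgeSet → ℕ}
    (B : LocalFamily D) : Prop :=
  ∀ h l l', star (B h l) ⬝ᵥ B h l' = if l = l' then 1 else 0

/-- The product vector on the half-edges in `S` in which both ends of an edge `e` carry the
label `J e`. -/
noncomputable def LocalFamily.vec {V : Type*} [Finite V] {G : SimpleGraph V} {D : G.edgeSet → ℕ}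
    (B : LocalFamily D) (S : Set (HalfEdge G)) (J : EdgeLabel D) : Config D S → ℂ :=
  fun c => ∏ h : S, B h.1 (J h.1.edge) (c h)

/-- The product vector on all half-edges in which both ends of an edge `e` carry the
label `J e`. -/
noncomputable def LocalFamily.fullVec {V : Type*} [Finite V] {G : SimpleGraph V}
    {D : G.edgeSet → ℕ} (B : LocalFamily D) (J : EdgeLabel D) : FullConfig D → ℂ :=
  fun c => ∏ h, B h (J h.edge) (c h)

section

variable {V : Type*} [Finite V] {G : SimpleGraph V} {D : G.edgeSet → ℕ}

theorem LocalFamily.vec_congr (B : LocalFamily D) {S : Set (HalfEdge G)} {J J' : EdgeLabel D}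
    (h : ∀ h ∈ S, J h.edge = J' h.edge) : B.vec S J = B.vec S J' := by
  ext c
  exact Finset.prod_congr rfl fun x _ => by rw [h x.1 x.2]

theorem sum_config_prod {S : Set (HalfEdge G)} (F : (h : S) → Fin (D h.1.edge) → ℂ) :
    ∑ c : Config D S, ∏ h, F h (c h) = ∏ h, ∑ x, F h x := by
  classical
  have key : ∏ h, ∑ x, F h x = ∑ c : ((h : S) → Fin (D h.1.edge)), ∏ h, F h (c h) := by
    rw [Finset.prod_univ_sum, Fintype.piFinset_univ]
  refine Eq.trans ?_ key.symm
  exact Fintype.sum_equiv (ι := Config D S) (κ := (h : S) → Fin (D h.1.edge)) (Equiv.refl _)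
    _ _ fun _ => rfl

theorem sum_fullConfig_prod (F : (h : HalfEdge G) → Fin (D h.edge) → ℂ) :
    ∑ c : FullConfig D, ∏ h, F h (c h) = ∏ h, ∑ x, F h x := by
  classical
  have key : ∏ h, ∑ x, F h x = ∑ c : ((h : HalfEdge G) → Fin (D h.edge)), ∏ h, F h (c h) := by
    rw [Finset.prod_univ_sum, Fintype.piFinset_univ]
  refine Eq.trans ?_ key.symm
  exact Fintype.sum_equiv (ι := FullConfig D) (κ := (h : HalfEdge G) → Fin (D h.edge))
    (Equiv.refl _)
    _ _ fun _ => rfl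

open scoped Classical in
theorem LocalFamily.IsOrthonormal.star_vec_dotProduct {B : LocalFamily D} (hB : B.IsOrthonormal)
    (S : Set (HalfEdge G)) (J J' : EdgeLabel D) :
    star (B.vec S J) ⬝ᵥ B.vec S J' = if ∀ h ∈ S, J h.edge = J' h.edge then 1 else 0 := by
  have h1 : star (B.vec S J) ⬝ᵥ B.vec S J' =
      ∏ h : S, if J h.1.edge = J' h.1.edge then 1 else 0 := by
    simp only [dotProduct, LocalFamily.vec, Pi.star_apply, star_prod, ← Finset.prod_mul_distrib]
    rw [sum_config_prod fun h x => star (B h.1 (J h.1.edge) x) * B h.1 (J' h.1.edge) x]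
    exact Finset.prod_congr rfl fun h _ => hB h.1 _ _
  rw [h1, Finset.prod_ite_zero]
  simp

open scoped Classical in
theorem LocalFamily.IsOrthonormal.star_fullVec_dotProduct {B : LocalFamily D}
    (hB : B.IsOrthonormal) (J J' : EdgeLabel D) :
    star (B.fullVec J) ⬝ᵥ B.fullVec J' = if J = J' then 1 else 0 := by
  have h1 : star (B.fullVec J) ⬝ᵥ B.fullVec J' =
      ∏ h : HalfEdge G, if J h.edge = J' h.edge then 1 else 0 := by
    simp only [dotProduct, LocalFamily.fullVec, Pi.star_apply, star_prod,
      ← Finset.prod_mul_distrib]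
    rw [sum_fullConfig_prod fun h x => star (B h (J h.edge) x) * B h (J' h.edge) x]
    exact Finset.prod_congr rfl fun h _ => hB h _ _
  rw [h1, Finset.prod_ite_zero]
  simp only [Finset.mem_univ, forall_const, Finset.prod_const_one]
  congr 1
  -- Every edge has a half-edge, so labels that agree at all half-edges are equal.
  refine propext ⟨fun h => funext fun e => ?_, fun h x => by rw [h]⟩
  obtain ⟨⟨x, y⟩, he⟩ := e
  exact h ⟨⟨s(x, y), he⟩, x, Sym2.mem_mk_left x y⟩

open scoped Classical in
theorem prod_set_eq_prod_dite {ι : Type*} [Fintype ι] (S : Set ι) [Fintype S] (g : S → ℂ) :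
    ∏ h : S, g h = ∏ h, if hS : h ∈ S then g ⟨h, hS⟩ else 1 := by
  rw [Finset.prod_dite]
  simp only [Finset.prod_const_one, mul_one]
  refine Finset.prod_bij' (fun x _ => ⟨x.1, by simp⟩)
    (fun x _ => ⟨x.1, (Finset.mem_filter.1 x.2).2⟩) ?_ ?_ ?_ ?_ ?_ <;> simp

theorem LocalFamily.fullVec_glue (B : LocalFamily D) {S T : Set (HalfEdge G)} (hST : Disjoint S T)
    (J : EdgeLabel D) (p : Config D S) (q : Config D T) (c : Config D (S ∪ T)ᶜ) :
    B.fullVec J (glue p q c) = B.vec S J p * B.vec T J q * B.vec (S ∪ T)ᶜ J c := by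
  classical
  simp only [LocalFamily.fullVec, LocalFamily.vec, prod_set_eq_prod_dite]
  rw [← Finset.prod_mul_distrib, ← Finset.prod_mul_distrib]
  refine Finset.prod_congr rfl fun h _ => ?_
  by_cases hS : h ∈ S
  · have hT : h ∉ T := Set.disjoint_left.1 hST hS
    simp [glue, hS, hT]
  · by_cases hT : h ∈ T
    · simp [glue, hS, hT]
    · simp [glue, hS, hT]

/-- The partial trace turns the cross terms d ≠ d' into inner products of orthonormal vectors on the
complement, so they vanish. -/
theorem reducedState_pureState {S T : Set (HalfEdge G)} {ι : Type*} [Fintype ι] [DecidableEq ι]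
    {Φ : FullConfig D → ℂ} (w : ι → Config D S × Config D T → ℂ) (z : ι → Config D (S ∪ T)ᶜ → ℂ)
    (hΦ : ∀ p c, Φ (glue p.1 p.2 c) = ∑ d, w d p * z d c)
    (hz : ∀ d d', star (z d) ⬝ᵥ z d' = if d = d' then 1 else 0) :
    reducedState S T (pureState Φ) = ∑ d, pureState (w d) := by
  ext p q
  simp only [reducedState, pureState, vecMulVec_apply, Pi.star_apply, hΦ, Matrix.sum_apply,
    star_sum, star_mul', Finset.sum_mul_sum]
  rw [Finset.sum_comm]
  refine Finset.sum_congr rfl fun d _ => ?_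
  rw [Finset.sum_comm, Finset.sum_eq_single d]
  · have := hz d d
    rw [if_pos rfl, dotProduct] at this
    rw [← mul_one (w d p * _), ← this, Finset.mul_sum]
    exact Finset.sum_congr rfl fun c _ => by rw [Pi.star_apply]; ring
  · intro d' _ hd
    have := hz d' d
    rw [if_neg hd, dotProduct] at this
    rw [← mul_zero (w d p * star (w d' q)), ← this, Finset.mul_sum]
    exact Finset.sum_congr rfl fun c _ => by rw [Pi.star_apply]; ring
  · simp

/-- The reduced state of a superposition of product vectors; the labels are split into a part
`d` that is visible on the complement and a part `r` that is not. -/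
theorem reducedState_pureState_sum_fullVec {B : LocalFamily D} (hB : B.IsOrthonormal)
    {S T : Set (HalfEdge G)} (hST : Disjoint S T) {R ι : Type*} [Fintype R] [Fintype ι]
    [DecidableEq ι] (E : R × ι ≃ EdgeLabel D) (z : ι → EdgeLabel D)
    (hz : ∀ r d, ∀ h ∈ (S ∪ T)ᶜ, E (r, d) h.edge = z d h.edge)
    (hz' : ∀ d d', (∀ h ∈ (S ∪ T)ᶜ, z d h.edge = z d' h.edge) → d = d') (coef : EdgeLabel D → ℂ) :
    reducedState S T (pureState (∑ J, coef J • B.fullVec J)) =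
      ∑ d, pureState (∑ r, coef (E (r, d)) •
        tensorVec (B.vec S (E (r, d))) (B.vec T (E (r, d)))) := by
  classical
  refine reducedState_pureState _ (fun d => B.vec (S ∪ T)ᶜ (z d)) (fun p c => ?_) fun d d' => ?_
  · rw [Finset.sum_apply, ← E.sum_comp, Fintype.sum_prod_type, Finset.sum_comm]
    refine Finset.sum_congr rfl fun d _ => ?_
    rw [Finset.sum_apply, Finset.sum_mul]
    refine Finset.sum_congr rfl fun r _ => ?_
    rw [Pi.smul_apply, Pi.smul_apply, B.fullVec_glue hST, B.vec_congr (hz r d), tensorVec,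
      smul_eq_mul, smul_eq_mul]
    ring
  · rw [hB.star_vec_dotProduct]
    congr 1
    exact propext ⟨hz' d d', fun h => by simp [h]⟩

end

/-! ## Edge classes of a cut -/

/-- The classes of edges for a cut `Δ ⊇ A`: inside `A`, from `A` to `Δ \ A`, from `A` to `Δᶜ`,
from `Δ \ A` to `Δᶜ`, inside `Δᶜ`, and inside `Δ \ A`. -/
inductive EdgeClass
  | inner
  | near
  | far
  | cross
  | outer
  | bulk

section

variable {V : Type*} {G : SimpleGraph V} {D : G.edgeSet → ℕ}

/-- Labels of the edges of one class. -/
abbrev ClassLabel (D : G.edgeSet → ℕ) (cls : G.edgeSet → EdgeClass) (m : EdgeClass) : Type _ :=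
  EdgeLabelOn D {e | cls e = m}

/-- The labels of all classes as one function. -/
def packLabels {cls : G.edgeSet → EdgeClass} (n : ClassLabel D cls .inner)
    (i : ClassLabel D cls .near) (j : ClassLabel D cls .far) (k : ClassLabel D cls .cross)
    (o : ClassLabel D cls .outer) (l : ClassLabel D cls .bulk) (m : EdgeClass) :
    ClassLabel D cls m :=
  match m with
  | .inner => n
  | .near => i
  | .far => j
  | .cross => k
  | .outer => o
  | .bulk => l

/-- The label of all edges with the given parts. -/
def assemble {cls : G.edgeSet → EdgeClass} (n : ClassLabel D cls .inner)
    (i : ClassLabel D cls .near) (j : ClassLabel D cls .far) (k : ClassLabel D cls .cross)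
    (o : ClassLabel D cls .outer) (l : ClassLabel D cls .bulk) : EdgeLabel D :=
  fun e => packLabels n i j k o l (cls e) ⟨e, rfl⟩

/-- The part of a label on one class of edges. -/
def classPart (cls : G.edgeSet → EdgeClass) (J : EdgeLabel D) (m : EdgeClass) :
    ClassLabel D cls m :=
  fun e => J e.1

theorem assemble_apply {cls : G.edgeSet → EdgeClass} (n : ClassLabel D cls .inner)
    (i : ClassLabel D cls .near) (j : ClassLabel D cls .far) (k : ClassLabel D cls .cross)
    (o : ClassLabel D cls .outer) (l : ClassLabel D cls .bulk) {e : G.edgeSet} {m : EdgeClass}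
    (h : cls e = m) : assemble n i j k o l e = packLabels n i j k o l m ⟨e, h⟩ := by
  subst h
  rfl

theorem classPart_assemble {cls : G.edgeSet → EdgeClass} (n : ClassLabel D cls .inner)
    (i : ClassLabel D cls .near) (j : ClassLabel D cls .far) (k : ClassLabel D cls .cross)
    (o : ClassLabel D cls .outer) (l : ClassLabel D cls .bulk) (m : EdgeClass) :
    classPart cls (assemble n i j k o l) m = packLabels n i j k o l m :=
  funext fun e => assemble_apply n i j k o l e.2

theorem assemble_classPart (cls : G.edgeSet → EdgeClass) (J : EdgeLabel D) :
    assemble (classPart cls J .inner) (classPart cls J .near) (classPart cls J .far)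
      (classPart cls J .cross) (classPart cls J .outer) (classPart cls J .bulk) = J := by
  funext e
  -- Generalizing the class to a variable m lets the case split avoid rewriting in dependent types.
  have : ∀ m (h : cls e = m), packLabels (classPart cls J .inner) (classPart cls J .near)
      (classPart cls J .far) (classPart cls J .cross) (classPart cls J .outer)
      (classPart cls J .bulk) m ⟨e, h⟩ = J e := fun m h => by
    cases m <;> rfl
  exact this _ rfl

/-- Labels of all edges are the same as labels of the six classes. -/
def assembleEquiv (D : G.edgeSet → ℕ) (cls : G.edgeSet → EdgeClass) :
    ClassLabel D cls .inner × ClassLabel D cls .near × ClassLabel D cls .far ×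
      ClassLabel D cls .cross × ClassLabel D cls .outer × ClassLabel D cls .bulk ≃
    EdgeLabel D where
  toFun x := assemble x.1 x.2.1 x.2.2.1 x.2.2.2.1 x.2.2.2.2.1 x.2.2.2.2.2
  invFun J := (classPart cls J .inner, classPart cls J .near, classPart cls J .far,
    classPart cls J .cross, classPart cls J .outer, classPart cls J .bulk)
  left_inv x := by simp only [classPart_assemble, packLabels]
  right_inv J := assemble_classPart cls J

/-- A class that is visible on S can be read off from the labels there; this injectivity makes
product vectors indexed by the visible classes orthonormal. -/
theorem classPart_eq_of_agree {cls : G.edgeSet → EdgeClass} {S : Set (HalfEdge G)}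
    {m : EdgeClass} (hm : ∀ e, cls e = m → ∃ h ∈ S, h.edge = e) {J J' : EdgeLabel D}
    (h : ∀ h ∈ S, J h.edge = J' h.edge) : classPart cls J m = classPart cls J' m := by
  funext ⟨e, he⟩
  obtain ⟨x, hx, rfl⟩ := hm e he
  exact h x hx

theorem sum_assemble [Finite V] (cls : G.edgeSet → EdgeClass) (F : EdgeLabel D → ℝ) :
    ∑ J, F J = ∑ n : ClassLabel D cls .inner, ∑ i : ClassLabel D cls .near,
      ∑ j : ClassLabel D cls .far, ∑ k : ClassLabel D cls .cross, ∑ o : ClassLabel D cls .outer,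
      ∑ l : ClassLabel D cls .bulk, F (assemble n i j k o l) := by
  rw [← (assembleEquiv D cls).sum_comp]
  simp only [Fintype.sum_prod_type]
  rfl

/-- The filter for one cut, in terms of the classes of the edges. -/
theorem exists_edgeFilter [Finite V] {B : LocalFamily D} (hB : B.IsOrthonormal)
    (cls : G.edgeSet → EdgeClass) {S R T : Set (HalfEdge G)} (hSR : Disjoint S R)
    (hST : Disjoint S T)
    (hS : ∀ e, (∃ h ∈ S, h.edge = e) ↔ cls e = .near ∨ cls e = .cross ∨ cls e = .bulk)
    (hR : ∀ e, (∃ h ∈ R, h.edge = e) ↔ cls e = .inner ∨ cls e = .near ∨ cls e = .far)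
    (hT : ∀ e, (∃ h ∈ T, h.edge = e) ↔ cls e = .inner ∨ cls e = .near ∨ cls e = .far)
    (hSRc : ∀ e, (∃ h ∈ (S ∪ R)ᶜ, h.edge = e) ↔
      cls e = .far ∨ cls e = .cross ∨ cls e = .outer)
    (hSTc : ∀ e, (∃ h ∈ (S ∪ T)ᶜ, h.edge = e) ↔ cls e = .cross ∨ cls e = .outer)
    (J₀ : EdgeLabel D) {lam q χ : EdgeLabel D → ℝ} (hlam : ∀ J, 0 ≤ lam J) (hq : ∀ J, 0 ≤ q J)
    (hχ : ∀ J, 0 ≤ χ J)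
    (dlam : ∀ n i j k o l k' o' l', lam (assemble (cls := cls) n i j k o l) =
      lam (assemble (cls := cls) n i j k' o' l'))
    (dq : ∀ n i j k o l n' i' j' l', q (assemble (cls := cls) n i j k o l) =
      q (assemble (cls := cls) n' i' j' k o l'))
    (dχ : ∀ n i j k o l n' i' j' k' o', χ (assemble (cls := cls) n i j k o l) =
      χ (assemble (cls := cls) n' i' j' k' o' l))
    (h1 : ∑ J, lam J * q J * χ J ≤ 1) {ε : ℝ} (hε : 0 ≤ ε) :
    ∃ f : EdgeLabel D → ℝ, (∀ J, 0 ≤ f J) ∧ (∀ J, f J ≤ 1) ∧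
      (∀ J J', (∀ e, cls e ≠ .inner → J e = J' e) → f J = f J') ∧
      (∑ J, lam J * q J * χ J * (1 - f J) ≤ ε) ∧
      ∀ g : EdgeLabel D → ℝ, (∀ J, 0 ≤ g J) → (∀ J, g J ≤ f J) →
        (∀ J J', (∀ e, cls e ≠ .inner → J e = J' e) → g J = g J') →
        smoothCondMinEntropy ε (reducedState S T
            (pureState (∑ J, ((√(lam J * q J * χ J) : ℝ) : ℂ) • B.fullVec J))) ≤
          condMinEntropy (reducedState S R
            (pureState (∑ J, ((√(lam J * q J * χ J * g J) : ℝ) : ℂ) • B.fullVec J))) := by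
  classical
  -- Default values from J₀ fill the classes on which a given vector or weight does not depend.
  set n₀ := classPart cls J₀ .inner
  set i₀ := classPart cls J₀ .near
  set j₀ := classPart cls J₀ .far
  set k₀ := classPart cls J₀ .cross
  set o₀ := classPart cls J₀ .outer
  set l₀ := classPart cls J₀ .bulk
  set ξ : ClassLabel D cls .bulk × ClassLabel D cls .near × ClassLabel D cls .cross →
      Config D S → ℂ := fun x => B.vec S (assemble n₀ x.2.1 j₀ x.2.2 o₀ x.1) with hξ
  set a : ClassLabel D cls .inner × ClassLabel D cls .near × ClassLabel D cls .far →
      Config D R → ℂ := fun x => B.vec R (assemble x.1 x.2.1 x.2.2 k₀ o₀ l₀) with ha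
  set b : ClassLabel D cls .inner × ClassLabel D cls .near × ClassLabel D cls .far →
      Config D T → ℂ := fun x => B.vec T (assemble x.1 x.2.1 x.2.2 k₀ o₀ l₀) with hb
  have oξ : ∀ x y, star (ξ x) ⬝ᵥ ξ y = if x = y then 1 else 0 := fun x y => by
    rw [hξ, hB.star_vec_dotProduct]
    congr 1
    refine propext ⟨fun h => ?_, fun h => by simp [h]⟩
    have e1 := classPart_eq_of_agree (cls := cls) (m := .near)
      (fun e he => (hS e).2 (by simp [he])) h
    have e2 := classPart_eq_of_agree (cls := cls) (m := .cross)
      (fun e he => (hS e).2 (by simp [he])) h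
    have e3 := classPart_eq_of_agree (cls := cls) (m := .bulk)
      (fun e he => (hS e).2 (by simp [he])) h
    simp only [classPart_assemble, packLabels] at e1 e2 e3
    exact Prod.ext e3 (Prod.ext e1 e2)
  have oab : ∀ (R' : Set (HalfEdge G)),
      (∀ e, (∃ h ∈ R', h.edge = e) ↔ cls e = .inner ∨ cls e = .near ∨ cls e = .far) →
      ∀ x y : ClassLabel D cls .inner × ClassLabel D cls .near × ClassLabel D cls .far,
      star (B.vec R' (assemble x.1 x.2.1 x.2.2 k₀ o₀ l₀)) ⬝ᵥ
        B.vec R' (assemble y.1 y.2.1 y.2.2 k₀ o₀ l₀) = if x = y then 1 else 0 :=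
      fun R' hR' x y => by
    rw [hB.star_vec_dotProduct]
    congr 1
    refine propext ⟨fun h => ?_, fun h => by simp [h]⟩
    have e1 := classPart_eq_of_agree (cls := cls) (m := .inner)
      (fun e he => (hR' e).2 (by simp [he])) h
    have e2 := classPart_eq_of_agree (cls := cls) (m := .near)
      (fun e he => (hR' e).2 (by simp [he])) h
    have e3 := classPart_eq_of_agree (cls := cls) (m := .far)
      (fun e he => (hR' e).2 (by simp [he])) h
    simp only [classPart_assemble, packLabels] at e1 e2 e3
    exact Prod.ext e1 (Prod.ext e2 e3)
  have cξ : ∀ n i j k o l, B.vec S (assemble n i j k o l) = ξ (l, i, k) := fun n i j k o l => by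
    refine B.vec_congr fun h hh => ?_
    rcases (hS h.edge).1 ⟨h, hh, rfl⟩ with h' | h' | h' <;>
      rw [assemble_apply _ _ _ _ _ _ h', assemble_apply _ _ _ _ _ _ h'] <;> rfl
  have cab : ∀ (R' : Set (HalfEdge G)),
      (∀ e, (∃ h ∈ R', h.edge = e) ↔ cls e = .inner ∨ cls e = .near ∨ cls e = .far) →
      ∀ n i j k o l, B.vec R' (assemble (cls := cls) n i j k o l) =
        B.vec R' (assemble n i j k₀ o₀ l₀) := fun R' hR' n i j k o l => by
    refine B.vec_congr fun h hh => ?_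
    rcases (hR' h.edge).1 ⟨h, hh, rfl⟩ with h' | h' | h' <;>
      rw [assemble_apply _ _ _ _ _ _ h', assemble_apply _ _ _ _ _ _ h'] <;> rfl
  set lam' : ClassLabel D cls .inner → ClassLabel D cls .near × ClassLabel D cls .far → ℝ :=
    fun n i => lam (assemble n i.1 i.2 k₀ o₀ l₀) with hlam'
  set q' : ClassLabel D cls .cross → ClassLabel D cls .outer → ℝ :=
    fun k o => q (assemble n₀ i₀ j₀ k o l₀) with hq'
  set χ' : ClassLabel D cls .bulk → ℝ := fun l => χ (assemble n₀ i₀ j₀ k₀ o₀ l) with hχ'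
  have hμ : ∀ n i j k o l, lam (assemble (cls := cls) n i j k o l) * q (assemble n i j k o l) *
      χ (assemble n i j k o l) = lam' n (i, j) * q' k o * χ' l := fun n i j k o l => by
    rw [dlam n i j k o l k₀ o₀ l₀, dq n i j k o l n₀ i₀ j₀ l₀, dχ n i j k o l n₀ i₀ j₀ k₀ o₀]
  obtain ⟨f, hf0, hf1, hloss, hf⟩ := exists_filter oξ (oab R hR) (oab T hT) (lam := lam')
    (q := q') (χ := χ') (fun n i => hlam _) (fun k o => hq _) (fun l => hχ _)
    (by
      rw [sum_assemble cls] at h1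
      simpa only [hμ] using h1) hε
  refine ⟨fun J => f (classPart cls J .near) (classPart cls J .far) (classPart cls J .cross),
    fun J => hf0 _ _ _, fun J => hf1 _ _ _, fun J J' h => ?_, ?_, fun g hg0 hgf hg => ?_⟩
  · have : ∀ m, m ≠ .inner → classPart cls J m = classPart cls J' m := fun m hm =>
      funext fun e => h e.1 (by rw [e.2]; exact hm)
    simp only [this .near (by simp), this .far (by simp), this .cross (by simp)]
  · rw [sum_assemble cls]
    simpa only [hμ, classPart_assemble, packLabels] using hloss
  -- The filter must ignore the inner labels, because these are summed coherently into the vectors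
  -- of A before the filter acts.
  have hg' : ∀ n i j k o l, g (assemble (cls := cls) n i j k o l) =
      g (assemble n₀ i j k o l) := fun n i j k o l => hg _ _ fun e he => by
    rcases he' : cls e with _ | _ | _ | _ | _ | _
    · exact (he he').elim
    all_goals
      rw [assemble_apply _ _ _ _ _ _ he', assemble_apply _ _ _ _ _ _ he']
      rfl
  have key := hf (fun i j k o l => g (assemble n₀ i j k o l)) (fun i j k o l => hg0 _)
    (fun i j k o l => by
      refine (hgf _).trans ?_
      simp only [classPart_assemble, packLabels, le_refl])
  refine le_of_eq_of_le (congrArg _ ?_) (key.trans_eq (congrArg _ ?_))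
  -- The complement of S ∪ T sees only the cross and outer labels: these index the mixture, all
  -- others the superposition.
  · let E : (ClassLabel D cls .inner × ClassLabel D cls .near × ClassLabel D cls .far ×
        ClassLabel D cls .bulk) × (ClassLabel D cls .cross × ClassLabel D cls .outer) ≃
        EdgeLabel D :=
      { toFun := fun x => assemble x.1.1 x.1.2.1 x.1.2.2.1 x.2.1 x.2.2 x.1.2.2.2
        invFun := fun J => ((classPart cls J .inner, classPart cls J .near, classPart cls J .far,
          classPart cls J .bulk), (classPart cls J .cross, classPart cls J .outer))
        left_inv := fun x => by simp only [classPart_assemble, packLabels]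
        right_inv := fun J => assemble_classPart cls J }
    rw [reducedState_pureState_sum_fullVec hB hST E
      (fun d => assemble n₀ i₀ j₀ d.1 d.2 l₀)]
    · refine Finset.sum_congr rfl fun d _ => congrArg _ (Finset.sum_congr rfl fun r _ => ?_)
      change ((√(lam (assemble _ _ _ _ _ _) * q (assemble _ _ _ _ _ _) *
        χ (assemble _ _ _ _ _ _)) : ℝ) : ℂ) • tensorVec (B.vec S (assemble _ _ _ _ _ _))
          (B.vec T (assemble _ _ _ _ _ _)) = _
      rw [hμ, cξ, cab T hT]
    · intro r d h hh
      rcases (hSTc h.edge).1 ⟨h, hh, rfl⟩ with h' | h' <;>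
        exact (assemble_apply _ _ _ _ _ _ h').trans
          (Eq.trans (by rfl) (assemble_apply n₀ i₀ j₀ d.1 d.2 l₀ h').symm)
    · intro d d' h
      have e1 := classPart_eq_of_agree (cls := cls) (m := .cross)
        (fun e he => (hSTc e).2 (by simp [he])) h
      have e2 := classPart_eq_of_agree (cls := cls) (m := .outer)
        (fun e he => (hSTc e).2 (by simp [he])) h
      simp only [classPart_assemble, packLabels] at e1 e2
      exact Prod.ext e1 e2
  -- The complement of S ∪ R also sees the far labels, which thereby move from the superposition to
  -- the mixture.
  · let E : (ClassLabel D cls .inner × ClassLabel D cls .near × ClassLabel D cls .bulk) ×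
        (ClassLabel D cls .far × ClassLabel D cls .cross × ClassLabel D cls .outer) ≃
        EdgeLabel D :=
      { toFun := fun x => assemble x.1.1 x.1.2.1 x.2.1 x.2.2.1 x.2.2.2 x.1.2.2
        invFun := fun J => ((classPart cls J .inner, classPart cls J .near, classPart cls J .bulk),
          (classPart cls J .far, classPart cls J .cross, classPart cls J .outer))
        left_inv := fun x => by simp only [classPart_assemble, packLabels]
        right_inv := fun J => assemble_classPart cls J }
    symm
    rw [reducedState_pureState_sum_fullVec hB hSR E
      (fun d => assemble n₀ i₀ d.1 d.2.1 d.2.2 l₀)]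
    · refine Finset.sum_congr rfl fun d _ => congrArg _ (Finset.sum_congr rfl fun r _ => ?_)
      change ((√(lam (assemble _ _ _ _ _ _) * q (assemble _ _ _ _ _ _) *
        χ (assemble _ _ _ _ _ _) * g (assemble _ _ _ _ _ _)) : ℝ) : ℂ) •
          tensorVec (B.vec S (assemble _ _ _ _ _ _)) (B.vec R (assemble _ _ _ _ _ _)) = _
      rw [hμ, cξ, cab R hR, hg']
    · intro r d h hh
      rcases (hSRc h.edge).1 ⟨h, hh, rfl⟩ with h' | h' | h' <;>
        exact (assemble_apply _ _ _ _ _ _ h').trans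
          (Eq.trans (by rfl) (assemble_apply n₀ i₀ d.1 d.2.1 d.2.2 l₀ h').symm)
    · intro d d' h
      have e1 := classPart_eq_of_agree (cls := cls) (m := .far)
        (fun e he => (hSRc e).2 (by simp [he])) h
      have e2 := classPart_eq_of_agree (cls := cls) (m := .cross)
        (fun e he => (hSRc e).2 (by simp [he])) h
      have e3 := classPart_eq_of_agree (cls := cls) (m := .outer)
        (fun e he => (hSRc e).2 (by simp [he])) h
      simp only [classPart_assemble, packLabels] at e1 e2 e3
      exact Prod.ext e1 (Prod.ext e2 e3)

end

/-! ## Singular value decomposition and the background vector -/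

/-- Singular value decomposition of a square matrix, with rows of `U` and `W` as singular vectors
and `ν` the squared singular values. -/
theorem exists_singularValueDecomposition {n : ℕ} (M : Matrix (Fin n) (Fin n) ℂ) :
    ∃ (ν : Fin n → ℝ) (U W : Fin n → Fin n → ℂ), (∀ l, 0 ≤ ν l) ∧
      (∀ l l', star (U l) ⬝ᵥ U l' = if l = l' then 1 else 0) ∧
      (∀ l l', star (W l) ⬝ᵥ W l' = if l = l' then 1 else 0) ∧
      ∀ i j, M i j = ∑ l, ((√(ν l) : ℝ) : ℂ) * (U l i * W l j) := by
  have hH : (Mᴴ * M).IsHermitian := isHermitian_conjTranspose_mul_self M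
  have hP : (Mᴴ * M).PosSemidef := posSemidef_conjTranspose_mul_self M
  set ν := hH.eigenvalues with hν
  have hν0 : ∀ l, 0 ≤ ν l := hP.eigenvalues_nonneg
  set b := hH.eigenvectorBasis with hb
  have inner_eq : ∀ x y : EuclideanSpace ℂ (Fin n), inner ℂ x y = star x.ofLp ⬝ᵥ y.ofLp :=
    fun x y => by rw [EuclideanSpace.inner_eq_star_dotProduct, dotProduct_comm]
  have ob : ∀ l l', star (b l).ofLp ⬝ᵥ (b l').ofLp = if l = l' then 1 else 0 := fun l l' => by
    rw [← inner_eq, orthonormal_iff_ite.1 b.orthonormal]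
  set x : Fin n → Fin n → ℂ := fun l => M *ᵥ (b l).ofLp with hx
  have ox : ∀ l l', star (x l) ⬝ᵥ x l' = if l = l' then (ν l : ℂ) else 0 := fun l l' => by
    rw [hx, ← dotProduct_factor, hH.mulVec_eigenvectorBasis l', dotProduct_smul, ob]
    by_cases h : l = l'
    · subst h; simp [hν]
    · simp [h]
  have on := star_normalizeVec_dotProduct ox
  -- The images M b_l of the eigenvectors of Mᴴ M are orthogonal with squared norms ν l. The nonzero
  -- ones are normalized and completed to a basis; the added vectors get coefficient 0.
  have hon : Orthonormal ℂ ({l | ν l ≠ 0}.domRestrict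
      fun l => WithLp.toLp 2 (normalizeVec x ν l) : _ → EuclideanSpace ℂ (Fin n)) := by
    rw [orthonormal_iff_ite]
    rintro ⟨l, hl⟩ ⟨l', hl'⟩
    rw [Set.domRestrict_apply, Set.domRestrict_apply, inner_eq, on]
    have : (ν l)⁻¹ * ν l = 1 := inv_mul_cancel₀ hl
    simp [this]
  obtain ⟨u, hu⟩ := hon.exists_orthonormalBasis_extension_of_card_eq (by simp)
  refine ⟨ν, fun l => (u l).ofLp, fun l => star (b l).ofLp, hν0, fun l l' => ?_, fun l l' => ?_,
    fun i j => ?_⟩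
  · rw [← inner_eq, orthonormal_iff_ite.1 u.orthonormal]
  · rw [star_dotProduct_star, dotProduct_comm, ob]
    by_cases h : l = l'
    · subst h; simp
    · simp [h]
  · have hux : ∀ l, ((√(ν l) : ℝ) : ℂ) • (u l).ofLp = x l := fun l => by
      by_cases h : ν l = 0
      · rw [eq_zero_of_normSq_eq_zero ox h, h]; simp
      · rw [hu l h]
        exact sqrt_smul_normalizeVec ox l
    have hsum : ∑ l, vecMulVec (b l).ofLp (star (b l).ofLp) = (1 : Matrix (Fin n) (Fin n) ℂ) := by
      have h := mem_unitaryGroup_iff.1 hH.eigenvectorUnitary.2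
      rw [← h]
      ext p q
      simp [Matrix.sum_apply, vecMulVec_apply, Matrix.mul_apply, hb, star_eq_conjTranspose]
    have hM : M = ∑ l, vecMulVec (x l) (star (b l).ofLp) := by
      conv_lhs => rw [← mul_one M, ← hsum, Finset.mul_sum]
      exact Finset.sum_congr rfl fun l _ => mul_vecMulVec _ _ _
    conv_lhs => rw [hM]
    rw [Matrix.sum_apply]
    refine Finset.sum_congr rfl fun l _ => ?_
    rw [vecMulVec_apply, ← hux, Pi.smul_apply, smul_eq_mul, mul_assoc]

section

variable {V : Type*} {G : SimpleGraph V} {D : G.edgeSet → ℕ}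

/-- A half-edge of the edge `e`. -/
noncomputable def firstEnd (e : G.edgeSet) : HalfEdge G :=
  ⟨e, (e : Sym2 V).out.1, Sym2.out_fst_mem _⟩

/-- The other half-edge of the edge `e`. -/
noncomputable def secondEnd (e : G.edgeSet) : HalfEdge G :=
  ⟨e, (e : Sym2 V).out.2, Sym2.out_snd_mem _⟩

theorem coe_edge_eq_mk_out (e : G.edgeSet) : (e : Sym2 V) =
    s((e : Sym2 V).out.1, (e : Sym2 V).out.2) :=
  (Quot.out_eq (e : Sym2 V)).symm

theorem out_fst_ne_out_snd (e : G.edgeSet) : (e : Sym2 V).out.1 ≠ (e : Sym2 V).out.2 := by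
  have h := e.2
  rw [coe_edge_eq_mk_out e, SimpleGraph.mem_edgeSet] at h
  exact h.ne

theorem vertex_eq_out (h : HalfEdge G) :
    h.vertex = (h.edge : Sym2 V).out.1 ∨ h.vertex = (h.edge : Sym2 V).out.2 := by
  have := h.mem
  rw [coe_edge_eq_mk_out h.edge, Sym2.mem_iff] at this
  exact this

theorem eq_firstEnd_or_eq_secondEnd (h : HalfEdge G) :
    h = firstEnd h.edge ∨ h = secondEnd h.edge :=
  (vertex_eq_out h).imp (HalfEdge.ext rfl) (HalfEdge.ext rfl)

theorem prod_halfEdge [Finite V] [Fintype G.edgeSet] (F : HalfEdge G → ℂ) :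
    ∏ h, F h = ∏ e, F (firstEnd e) * F (secondEnd e) := by
  classical
  rw [← Finset.prod_fiberwise (s := Finset.univ) (g := HalfEdge.edge)]
  refine Finset.prod_congr rfl fun e _ => ?_
  have hne : firstEnd e ≠ secondEnd e := fun h => out_fst_ne_out_snd e (congrArg HalfEdge.vertex h)
  rw [← Finset.prod_pair hne]
  refine Finset.prod_congr (Finset.ext fun h => ?_) fun _ _ => rfl
  simp only [Finset.mem_filter, Finset.mem_univ, true_and, Finset.mem_insert,
    Finset.mem_singleton]
  constructor
  · rintro rfl
    exact eq_firstEnd_or_eq_secondEnd h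
  · rintro (rfl | rfl) <;> rfl

/-- The label at the first end of an edge. -/
noncomputable def FullConfig.first (c : FullConfig D) (e : G.edgeSet) : Fin (D e) :=
  c (firstEnd e)

/-- The label at the second end of an edge. -/
noncomputable def FullConfig.second (c : FullConfig D) (e : G.edgeSet) : Fin (D e) :=
  c (secondEnd e)

theorem fullConfig_restrict_eq_diagConfig {γ : Set G.edgeSet} (c : FullConfig D)
    (I : (e : γ) → Fin (D e.1)) : c.restrict _ = diagConfig γ I ↔
      (∀ e ∈ γ, c.first e = c.second e) ∧ I = fun e : γ => c.first e.1 := by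
  constructor
  · intro h
    have h1 : ∀ e : γ, c.first e.1 = I e := fun e => congrFun h ⟨firstEnd e.1, e.2⟩
    have h2 : ∀ e : γ, c.second e.1 = I e := fun e => congrFun h ⟨secondEnd e.1, e.2⟩
    exact ⟨fun e he => (h1 ⟨e, he⟩).trans (h2 ⟨e, he⟩).symm, funext fun e => (h1 e).symm⟩
  · rintro ⟨h1, rfl⟩
    funext ⟨h, hh⟩
    change c h = c.first h.edge
    obtain ⟨e, v, m⟩ := h
    rcases vertex_eq_out (⟨e, v, m⟩ : HalfEdge G) with hv | hv
    · dsimp only at hv; subst hv; rfl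
    · dsimp only at hv; subst hv
      exact (h1 e hh).symm

open scoped Classical in
theorem HasStandardSchmidt.exists_apply_eq [Fintype V] {γ : Set G.edgeSet}
    {v : Config D (halfEdgesOf γ) → ℂ} (hv : HasStandardSchmidt γ v) :
    ∃ lam : ((e : γ) → Fin (D e.1)) → ℝ, (∀ I, 0 ≤ lam I) ∧ ∀ c : FullConfig D,
      v (c.restrict _) = if ∀ e ∈ γ, c.first e = c.second e then
        ((√(lam fun e : γ => c.first e.1) : ℝ) : ℂ) else 0 := by
  obtain ⟨lam, hlam, rfl⟩ := hv
  refine ⟨lam, hlam, fun c => ?_⟩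
  rw [Finset.sum_apply, Finset.sum_eq_single fun e : γ => c.first e.1]
  · simp only [Pi.smul_apply, Pi.single_apply, fullConfig_restrict_eq_diagConfig, and_true]
    split_ifs <;> simp
  · intro I _ hI
    simp [fullConfig_restrict_eq_diagConfig, hI]
  · simp

open scoped Classical in
/-- A vector of the Hilbert space of one edge has a Schmidt decomposition. -/
theorem exists_schmidt_edge (e : G.edgeSet) (w : Config D (halfEdgesOf {e}) → ℂ) :
    ∃ (ν : Fin (D e) → ℝ) (U W : Fin (D e) → Fin (D e) → ℂ), (∀ l, 0 ≤ ν l) ∧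
      (∀ l l', star (U l) ⬝ᵥ U l' = if l = l' then 1 else 0) ∧
      (∀ l l', star (W l) ⬝ᵥ W l' = if l = l' then 1 else 0) ∧
      ∀ c : FullConfig D, w (c.restrict _) =
        ∑ l, ((√(ν l) : ℝ) : ℂ) * (U l (c.first e) * W l (c.second e)) := by
  -- The vector is read as a matrix with rows for the first end of the edge and columns for the
  -- second; the casts transport indices along the equality of edges.
  obtain ⟨ν, U, W, h0, hU, hW, hM⟩ := exists_singularValueDecomposition
    (fun i j : Fin (D e) => w fun h =>
      if h.1.vertex = (e : Sym2 V).out.1 then Fin.cast (congrArg D h.2).symm i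
      else Fin.cast (congrArg D h.2).symm j)
  refine ⟨ν, U, W, h0, hU, hW, fun c => ?_⟩
  rw [← hM]
  congr 1
  funext ⟨⟨e', v, m⟩, (he : e' = e)⟩
  subst he
  change c ⟨e', v, m⟩ = if v = (e' : Sym2 V).out.1 then c.first e' else c.second e'
  rcases vertex_eq_out (⟨e', v, m⟩ : HalfEdge G) with hv | hv
  · dsimp only at hv; subst hv
    rw [if_pos rfl]; rfl
  · dsimp only at hv; subst hv
    rw [if_neg (out_fst_ne_out_snd e').symm]; rfl

/-- The background vector is a superposition of product vectors whose weights factorize. -/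
theorem exists_backgroundVector_eq_sum [Fintype V] [Fintype G.edgeSet] {γ₁ γ₂ : Set G.edgeSet}
    (hγ : Disjoint γ₁ γ₂)
    {v₁ : Config D (halfEdgesOf γ₁) → ℂ} {v₂ : Config D (halfEdgesOf γ₂) → ℂ}
    (w : (e : G.edgeSet) → Config D (halfEdgesOf {e}) → ℂ)
    (hv₁ : HasStandardSchmidt γ₁ v₁) (hv₂ : HasStandardSchmidt γ₂ v₂) :
    ∃ (B : LocalFamily D) (m₁ m₂ : EdgeLabel D → ℝ) (ν : (e : G.edgeSet) → Fin (D e) → ℝ),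
      B.IsOrthonormal ∧ (∀ J, 0 ≤ m₁ J) ∧ (∀ J, 0 ≤ m₂ J) ∧ (∀ e l, 0 ≤ ν e l) ∧
      (∀ J J', (∀ e ∈ γ₁, J e = J' e) → m₁ J = m₁ J') ∧
      (∀ J J', (∀ e ∈ γ₂, J e = J' e) → m₂ J = m₂ J') ∧
      (∀ e ∈ γ₁ ∪ γ₂, ∀ l, ν e l = 1) ∧
      backgroundVector γ₁ γ₂ v₁ v₂ w =
        ∑ J, ((√(m₁ J * m₂ J * ∏ e, ν e (J e)) : ℝ) : ℂ) • B.fullVec J := by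
  classical
  obtain ⟨lam₁, h₁, hc₁⟩ := hv₁.exists_apply_eq
  obtain ⟨lam₂, h₂, hc₂⟩ := hv₂.exists_apply_eq
  choose ν' U W hν' hU hW hw using fun e => exists_schmidt_edge e (w e)
  -- The weights on γ₁ and γ₂ need not factorize over edges and are carried by `lam₁` and `lam₂`;
  -- the factor 1 allows a product over all edges.
  set ν : (e : G.edgeSet) → Fin (D e) → ℝ := fun e l => if e ∈ γ₁ ∪ γ₂ then 1 else ν' e l with hν
  have hν0 : ∀ e l, 0 ≤ ν e l := fun e l => by
    simp only [hν]; split_ifs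
    exacts [zero_le_one, hν' e l]
  set B : LocalFamily D := fun h l i => if h.edge ∈ γ₁ ∪ γ₂ then (if l = i then 1 else 0) else
    if h.vertex = (h.edge : Sym2 V).out.1 then U h.edge l i else W h.edge l i with hB
  set m₁ : EdgeLabel D → ℝ := fun J => lam₁ fun e => J e.1 with hm₁
  set m₂ : EdgeLabel D → ℝ := fun J => lam₂ fun e => J e.1 with hm₂
  have hBγ : ∀ h, h.edge ∈ γ₁ ∪ γ₂ → ∀ l i, B h l i = if l = i then 1 else 0 :=
    fun h hh l i => by simp only [hB, if_pos hh]
  have hBU : ∀ h, h.edge ∉ γ₁ ∪ γ₂ → h.vertex = (h.edge : Sym2 V).out.1 → B h = U h.edge :=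
    fun h hh hv => by
      funext l i
      simp only [hB, if_neg hh, if_pos hv]
  have hBW : ∀ h, h.edge ∉ γ₁ ∪ γ₂ → h.vertex ≠ (h.edge : Sym2 V).out.1 → B h = W h.edge :=
    fun h hh hv => by
      funext l i
      simp only [hB, if_neg hh, if_neg hv]
  refine ⟨B, m₁, m₂, ν, fun h l l' => ?_, fun J => h₁ _, fun J => h₂ _, hν0,
    fun J J' h => congrArg lam₁ (funext fun e => h e.1 e.2),
    fun J J' h => congrArg lam₂ (funext fun e => h e.1 e.2), fun e he l => if_pos he, ?_⟩
  · by_cases hh : h.edge ∈ γ₁ ∪ γ₂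
    · simp [dotProduct, hBγ h hh]
    · by_cases hv : h.vertex = (h.edge : Sym2 V).out.1
      · rw [hBU h hh hv]
        exact hU _ _ _
      · rw [hBW h hh hv]
        exact hW _ _ _
  funext c
  set Jc : EdgeLabel D := fun e => c.first e with hJc
  set F : (e : G.edgeSet) → Fin (D e) → ℂ := fun e l => ((√(ν e l) : ℝ) : ℂ) *
    (B (firstEnd e) l (c.first e) * B (secondEnd e) l (c.second e)) with hF
  have hFγ : ∀ e ∈ γ₁ ∪ γ₂, ∀ l, F e l =
      if l = Jc e ∧ c.first e = c.second e then 1 else 0 := fun e he l => by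
    have e1 : ν e l = 1 := if_pos he
    have e2 : Jc e = c.first e := rfl
    have e3 := hBγ (firstEnd e) he l (c.first e)
    have e4 := hBγ (secondEnd e) he l (c.second e)
    by_cases h1 : l = c.first e
    · replace e3 := e3.trans (if_pos h1)
      by_cases h2 : l = c.second e
      · replace e4 := e4.trans (if_pos h2)
        rw [if_pos ⟨h1, h1.symm.trans h2⟩]
        simp [hF, e1, e3, e4]
      · replace e4 := e4.trans (if_neg h2)
        rw [if_neg fun h => h2 (h1.trans h.2)]
        simp [hF, e4]
    · replace e3 := e3.trans (if_neg h1)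
      rw [if_neg fun h => h1 h.1]
      simp [hF, e3]
  have hFb : ∀ e ∉ γ₁ ∪ γ₂, ∑ l, F e l = w e (c.restrict _) := fun e he => by
    rw [hw]
    refine Finset.sum_congr rfl fun l _ => ?_
    have e1 : ν e l = ν' e l := if_neg he
    have e2 : B (firstEnd e) = U e := hBU (firstEnd e) he rfl
    have e3 : B (secondEnd e) = W e := hBW (secondEnd e) he (out_fst_ne_out_snd e).symm
    simp only [hF, e1, e2, e3]
  -- On γ₁ ∪ γ₂ the basis is the standard one, so only labels J that agree there with c contribute.
  -- The joint weights may therefore be evaluated at c, and the remaining sum over J factorizes over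
  -- the edges.
  have hterm : ∀ J : EdgeLabel D, ((√(m₁ J * m₂ J * ∏ e, ν e (J e)) : ℝ) : ℂ) * B.fullVec J c =
      ((√(m₁ Jc) * √(m₂ Jc) : ℝ) : ℂ) * ∏ e, F e (J e) := fun J => by
    by_cases hJ : ∀ e ∈ γ₁ ∪ γ₂, J e = Jc e
    · have em₁ : m₁ J = m₁ Jc := congrArg lam₁ (funext fun e => hJ e.1 (Or.inl e.2))
      have em₂ : m₂ J = m₂ Jc := congrArg lam₂ (funext fun e => hJ e.1 (Or.inr e.2))
      rw [em₁, em₂, Real.sqrt_mul (mul_nonneg (h₁ _) (h₂ _)), Real.sqrt_mul (h₁ _),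
        Real.sqrt_prod _ (fun e _ => hν0 e (J e)), LocalFamily.fullVec, prod_halfEdge]
      simp only [hF, Finset.prod_mul_distrib]
      push_cast
      simp only [mul_assoc]
      rfl
    · push Not at hJ
      obtain ⟨e, he, hne⟩ := hJ
      have h0 : F e (J e) = 0 := by rw [hFγ e he, if_neg fun h => hne h.1]
      have h0' : B (firstEnd e) (J e) (c.first e) * B (secondEnd e) (J e) (c.second e)
          = 0 := by
        have : ν e (J e) = 1 := if_pos he
        simpa [hF, this] using h0
      have p1 : ∏ e, F e (J e) = 0 := Finset.prod_eq_zero (Finset.mem_univ e) h0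
      have p2 : B.fullVec J c = 0 := by
        rw [LocalFamily.fullVec, prod_halfEdge]
        exact Finset.prod_eq_zero (Finset.mem_univ e) h0'
      rw [p1, p2, mul_zero, mul_zero]
  rw [Finset.sum_apply]
  simp only [Pi.smul_apply, smul_eq_mul, hterm]
  rw [← Finset.mul_sum]
  have hprod : ∑ J : EdgeLabel D, ∏ e, F e (J e) = ∏ e, ∑ l, F e l := by
    have key : ∏ e, ∑ l, F e l = ∑ J : ((e : G.edgeSet) → Fin (D e)), ∏ e, F e (J e) := by
      rw [Finset.prod_univ_sum, Fintype.piFinset_univ]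
    refine Eq.trans ?_ key.symm
    exact Fintype.sum_equiv (ι := EdgeLabel D) (κ := (e : G.edgeSet) → Fin (D e)) (Equiv.refl _)
      _ _ fun _ => rfl
  have hsumγ : ∀ e ∈ γ₁ ∪ γ₂, ∑ l, F e l = if c.first e = c.second e then 1 else 0 :=
    fun e he => by
      simp only [hFγ e he, ite_and]
      simp
  have hsplit : ∏ e, ∑ l, F e l =
      (if ∀ e ∈ γ₁, c.first e = c.second e then 1 else 0) *
      (if ∀ e ∈ γ₂, c.first e = c.second e then 1 else 0) *
      ∏ e : ((γ₁ ∪ γ₂)ᶜ : Set G.edgeSet), w e.1 (c.restrict _) := by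
    have e1 : ∀ γ : Set G.edgeSet,
        (if ∀ e ∈ γ, c.first e = c.second e then (1 : ℂ) else 0) =
        ∏ e, if e ∈ γ then (if c.first e = c.second e then 1 else 0) else 1 := by
      intro γ
      have : ∀ e, (if e ∈ γ then (if c.first e = c.second e then (1 : ℂ) else 0) else 1) =
          if (e ∈ γ → c.first e = c.second e) then 1 else 0 := fun e => by
        by_cases he : e ∈ γ <;> simp [he]
      simp only [this, Finset.prod_ite_zero]
      simp
    rw [e1, e1, prod_set_eq_prod_dite ((γ₁ ∪ γ₂)ᶜ), ← Finset.prod_mul_distrib,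
      ← Finset.prod_mul_distrib]
    refine Finset.prod_congr rfl fun e _ => ?_
    by_cases he₁ : e ∈ γ₁
    · have he₂ : e ∉ γ₂ := Set.disjoint_left.1 hγ he₁
      rw [hsumγ e (Or.inl he₁)]
      simp [he₁, he₂]
    · by_cases he₂ : e ∈ γ₂
      · rw [hsumγ e (Or.inr he₂)]
        simp [he₁, he₂]
      · rw [hFb e (by simp [he₁, he₂])]
        simp [he₁, he₂]
  rw [hprod, hsplit, backgroundVector, hc₁, hc₂]
  simp only [hm₁, hm₂, hJc]
  push_cast
  split_ifs <;> simp
  exact Or.inl (Finset.prod_congr (Finset.ext fun _ => by simp) fun _ _ => rfl)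

end

/-! ## The filter of a cut -/

section

variable {V : Type*} {G : SimpleGraph V} {D : G.edgeSet → ℕ}

open scoped Classical in
/-- The class of an edge for the cut `Δ`. -/
noncomputable def cutClass (G : SimpleGraph V) (A Δ : Set V) (e : G.edgeSet) : EdgeClass :=
  if e ∈ incidentEdges G A then
    if e ∈ incidentEdges G (Δ \ A) then .near
    else if e ∈ incidentEdges G Δᶜ then .far else .inner
  else if e ∈ incidentEdges G Δᶜ then
    if e ∈ incidentEdges G (Δ \ A) then .cross else .outer
  else .bulk

/-- The three vertex sets are disjoint and an edge has only two ends. This leaves six classes: one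
or two of the three sets are met. -/
theorem not_mem_three_incidentEdges {A Δ : Set V} (hA : A ⊆ Δ) {e : G.edgeSet}
    (h1 : e ∈ incidentEdges G A) (h2 : e ∈ incidentEdges G (Δ \ A))
    (h3 : e ∈ incidentEdges G Δᶜ) : False := by
  obtain ⟨x, hx, hxe⟩ := h1
  obtain ⟨y, hy, hye⟩ := h2
  obtain ⟨z, hz, hze⟩ := h3
  have hxy : x ≠ y := fun h => hy.2 (h ▸ hx)
  have hxz : x ≠ z := fun h => hz (h ▸ hA hx)
  have hyz : y ≠ z := fun h => hz (h ▸ hy.1)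
  rw [(Sym2.mem_and_mem_iff hxy).1 ⟨hxe, hye⟩, Sym2.mem_iff] at hze
  exact hze.elim (fun h => hxz h.symm) fun h => hyz h.symm

theorem mem_incidentEdges_cases (A Δ : Set V) (e : G.edgeSet) :
    e ∈ incidentEdges G A ∨ e ∈ incidentEdges G (Δ \ A) ∨ e ∈ incidentEdges G Δᶜ := by
  have hx := Sym2.out_fst_mem (e : Sym2 V)
  by_cases h1 : (e : Sym2 V).out.1 ∈ A
  · exact Or.inl ⟨_, h1, hx⟩
  · by_cases h2 : (e : Sym2 V).out.1 ∈ Δ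
    · exact Or.inr (Or.inl ⟨_, ⟨h2, h1⟩, hx⟩)
    · exact Or.inr (Or.inr ⟨_, h2, hx⟩)

theorem cutClass_near_cross_bulk {A Δ : Set V} (hA : A ⊆ Δ) (e : G.edgeSet) :
    e ∈ incidentEdges G (Δ \ A) ↔
      cutClass G A Δ e = .near ∨ cutClass G A Δ e = .cross ∨ cutClass G A Δ e = .bulk := by
  have h1 := not_mem_three_incidentEdges hA (e := e)
  have h2 := mem_incidentEdges_cases A Δ e
  unfold cutClass
  split_ifs <;> simp_all

theorem cutClass_inner_near_far {A Δ : Set V} (e : G.edgeSet) :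
    e ∈ incidentEdges G A ↔
      cutClass G A Δ e = .inner ∨ cutClass G A Δ e = .near ∨ cutClass G A Δ e = .far := by
  unfold cutClass
  split_ifs <;> simp_all

theorem cutClass_far_cross_outer {A Δ : Set V} (hA : A ⊆ Δ) (e : G.edgeSet) :
    e ∈ incidentEdges G Δᶜ ↔
      cutClass G A Δ e = .far ∨ cutClass G A Δ e = .cross ∨ cutClass G A Δ e = .outer := by
  have h1 := not_mem_three_incidentEdges hA (e := e)
  unfold cutClass
  split_ifs <;> simp_all

theorem cutClass_cross_outer {A Δ : Set V} (e : G.edgeSet) :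
    (e ∈ incidentEdges G Δᶜ ∧ e ∉ incidentEdges G A) ↔
      cutClass G A Δ e = .cross ∨ cutClass G A Δ e = .outer := by
  unfold cutClass
  split_ifs <;> simp_all

theorem cutClass_ne_inner {A Δ : Set V} (hA : A ⊆ Δ) (e : G.edgeSet) :
    e ∈ incidentEdges G Aᶜ ↔ cutClass G A Δ e ≠ .inner := by
  have h1 := not_mem_three_incidentEdges hA (e := e)
  have h2 := mem_incidentEdges_cases A Δ e
  have h3 : e ∈ incidentEdges G Aᶜ ↔ e ∈ incidentEdges G (Δ \ A) ∨ e ∈ incidentEdges G Δᶜ := by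
    constructor
    · rintro ⟨x, hx, hxe⟩
      by_cases hΔ : x ∈ Δ
      · exact Or.inl ⟨x, ⟨hΔ, hx⟩, hxe⟩
      · exact Or.inr ⟨x, hΔ, hxe⟩
    · rintro (⟨x, hx, hxe⟩ | ⟨x, hx, hxe⟩)
      · exact ⟨x, hx.2, hxe⟩
      · exact ⟨x, fun h => hx (hA h), hxe⟩
  rw [h3]
  unfold cutClass
  split_ifs <;> simp_all

theorem exists_halfEdgesAt_iff (S : Set V) (e : G.edgeSet) :
    (∃ h ∈ halfEdgesAt G S, h.edge = e) ↔ e ∈ incidentEdges G S :=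
  ⟨fun ⟨h, hS, he⟩ => ⟨h.vertex, hS, he ▸ h.mem⟩, fun ⟨x, hx, hxe⟩ => ⟨⟨e, x, hxe⟩, hx, rfl⟩⟩

/-- The filter for one cut of a network whose weights factorize over `γ₁`, `γ₂` and the other
edges. -/
theorem exists_cutFilter [Finite V] [Fintype G.edgeSet] {bdry A Δ : Set V}
    (hdisj : Disjoint (incidentEdges G A) (incidentEdges G (bdry \ A)))
    (hΔ : Δ ∈ cuts bdry A) {B : LocalFamily D} (hB : B.IsOrthonormal)
    {m₁ m₂ : EdgeLabel D → ℝ} {ν : (e : G.edgeSet) → Fin (D e) → ℝ}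
    (h₁ : ∀ J, 0 ≤ m₁ J) (h₂ : ∀ J, 0 ≤ m₂ J) (hν : ∀ e l, 0 ≤ ν e l)
    (d₁ : ∀ J J', (∀ e ∈ incidentEdges G A, J e = J' e) → m₁ J = m₁ J')
    (d₂ : ∀ J J', (∀ e ∈ incidentEdges G (bdry \ A), J e = J' e) → m₂ J = m₂ J')
    (hν1 : ∀ e ∈ incidentEdges G A ∪ incidentEdges G (bdry \ A), ∀ l, ν e l = 1)
    (J₀ : EdgeLabel D) (hsum : ∑ J, m₁ J * m₂ J * ∏ e, ν e (J e) ≤ 1) {ε : ℝ} (hε : 0 ≤ ε) :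
    ∃ f : EdgeLabel D → ℝ, (∀ J, 0 ≤ f J) ∧ (∀ J, f J ≤ 1) ∧
      (∀ J J', (∀ e ∈ incidentEdges G Aᶜ, J e = J' e) → f J = f J') ∧
      (∑ J, (m₁ J * m₂ J * ∏ e, ν e (J e)) * (1 - f J) ≤ ε) ∧
      ∀ g : EdgeLabel D → ℝ, (∀ J, 0 ≤ g J) → (∀ J, g J ≤ f J) →
        (∀ J J', (∀ e ∈ incidentEdges G Aᶜ, J e = J' e) → g J = g J') →
        smoothCondMinEntropy ε (reducedState (halfEdgesAt G (Δ \ A))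
            (halfEdgesAt G A ∪ outerHalfEdges G A Δ)
            (pureState (∑ J, ((√(m₁ J * m₂ J * ∏ e, ν e (J e)) : ℝ) : ℂ) • B.fullVec J))) ≤
          condMinEntropy (reducedState (halfEdgesAt G (Δ \ A)) (halfEdgesAt G A)
            (pureState (∑ J, ((√(m₁ J * m₂ J * (∏ e, ν e (J e)) * g J) : ℝ) : ℂ) •
              B.fullVec J))) := by
  classical
  have hAΔ : A ⊆ Δ := fun x hx => (hΔ.symm ▸ hx : x ∈ Δ ∩ bdry).1
  have hΔb : ∀ x ∈ Δ, x ∈ bdry → x ∈ A := fun x h h' => (hΔ ▸ ⟨h, h'⟩ : x ∈ A)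
  set cls := cutClass G A Δ with hcls
  have hdisjoint : Disjoint (halfEdgesAt G (Δ \ A)) (halfEdgesAt G A) :=
    Set.disjoint_left.2 fun h hS hR => hS.2 hR
  have c1 := cutClass_near_cross_bulk (G := G) hAΔ
  have c2 := cutClass_inner_near_far (G := G) (A := A) (Δ := Δ)
  have c3 := cutClass_far_cross_outer (G := G) hAΔ
  have c4 := cutClass_cross_outer (G := G) (A := A) (Δ := Δ)
  -- A boundary vertex outside A is outside Δ, and disjointness of γ₁ and γ₂ keeps the edge away
  -- from A. Hence `m₂` depends on k and o only.
  have hγ₂ : ∀ e ∈ incidentEdges G (bdry \ A), cls e = .cross ∨ cls e = .outer := fun e he => by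
    refine (c4 e).1 ⟨?_, fun h => Set.disjoint_left.1 hdisj h he⟩
    obtain ⟨x, hx, hxe⟩ := he
    exact ⟨x, fun h => hx.2 (hΔb x h hx.1), hxe⟩
  obtain ⟨f, hf0, hf1, hfd, hloss, hf⟩ := exists_edgeFilter hB cls
    (S := halfEdgesAt G (Δ \ A)) (R := halfEdgesAt G A)
    (T := halfEdgesAt G A ∪ outerHalfEdges G A Δ) hdisjoint
    (Set.disjoint_union_right.2 ⟨hdisjoint, Set.disjoint_left.2 fun h hS hY => hY.1 hS.1⟩)
    (fun e => by rw [exists_halfEdgesAt_iff]; exact c1 e)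
    (fun e => by rw [exists_halfEdgesAt_iff]; exact c2 e)
    (fun e => by
      rw [← c2 e]
      constructor
      · rintro ⟨h, hA | ⟨_, y, hy, hye⟩, rfl⟩
        · exact ⟨_, hA, h.mem⟩
        · exact ⟨y, hy, hye ▸ Sym2.mem_mk_right _ _⟩
      · rintro ⟨x, hx, hxe⟩
        exact ⟨⟨e, x, hxe⟩, Or.inl hx, rfl⟩)
    (fun e => by
      rw [← c3 e]
      constructor
      · rintro ⟨h, hh, rfl⟩
        exact ⟨h.vertex, fun hv => hh (by
          by_cases hvA : h.vertex ∈ A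
          exacts [Or.inr hvA, Or.inl ⟨hv, hvA⟩]), h.mem⟩
      · rintro ⟨x, hx, hxe⟩
        exact ⟨⟨e, x, hxe⟩, fun hh => hh.elim (fun h => hx h.1) fun h => hx (hAΔ h), rfl⟩)
    (fun e => by
      rw [← c4 e]
      constructor
      · rintro ⟨h, hh, rfl⟩
        have hv : h.vertex ∉ Δ := fun hv => hh (by
          by_cases hvA : h.vertex ∈ A
          exacts [Or.inr (Or.inl hvA), Or.inl ⟨hv, hvA⟩])
        refine ⟨⟨h.vertex, hv, h.mem⟩, ?_⟩
        rintro ⟨y, hy, hye⟩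
        have hne : h.vertex ≠ y := fun heq => hv (by rw [heq]; exact hAΔ hy)
        exact hh (Or.inr (Or.inr ⟨hv, y, hy, (Sym2.mem_and_mem_iff hne).1 ⟨h.mem, hye⟩⟩))
      · rintro ⟨⟨x, hx, hxe⟩, hne⟩
        refine ⟨⟨e, x, hxe⟩, ?_, rfl⟩
        rintro (h | h | ⟨_, y, hy, hye⟩)
        · exact hx h.1
        · exact hx (hAΔ h)
        · exact hne ⟨y, hy, hye ▸ Sym2.mem_mk_right _ _⟩)
    -- The product in q also runs over the edges at A, where ν = 1, so it depends only on the cross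
    -- and outer labels.
    J₀ (lam := m₁) (q := fun J => m₂ J * ∏ e, if cls e = .bulk then 1 else ν e (J e))
    (χ := fun J => ∏ e, if cls e = .bulk then ν e (J e) else 1) h₁
    (fun J => mul_nonneg (h₂ J) (Finset.prod_nonneg fun e _ => by
      split_ifs
      exacts [zero_le_one, hν _ _]))
    (fun J => Finset.prod_nonneg fun e _ => by
      split_ifs
      exacts [hν _ _, zero_le_one])
    (fun n i j k o l k' o' l' => d₁ _ _ fun e he => by
      rcases (c2 e).1 he with h | h | h <;>
        rw [assemble_apply _ _ _ _ _ _ h, assemble_apply _ _ _ _ _ _ h] <;> rfl)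
    (fun n i j k o l n' i' j' l' => by
      congr 1
      · refine d₂ _ _ fun e he => ?_
        rcases hγ₂ e he with h | h <;>
          rw [assemble_apply _ _ _ _ _ _ h, assemble_apply _ _ _ _ _ _ h] <;> rfl
      · refine Finset.prod_congr rfl fun e _ => ?_
        by_cases hb : cls e = .bulk
        · rw [if_pos hb, if_pos hb]
        rw [if_neg hb, if_neg hb]
        by_cases hA' : e ∈ incidentEdges G A
        · rw [hν1 e (Or.inl hA'), hν1 e (Or.inl hA')]
        · have : cls e = .cross ∨ cls e = .outer := by
            have := (c2 e).not.1 hA'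
            rcases h : cls e with _ | _ | _ | _ | _ | _ <;> simp_all
          rcases this with h | h <;>
            rw [assemble_apply _ _ _ _ _ _ h, assemble_apply _ _ _ _ _ _ h] <;> rfl)
    (fun n i j k o l n' i' j' k' o' => by
      refine Finset.prod_congr rfl fun e _ => ?_
      by_cases hb : cls e = .bulk
      · rw [if_pos hb, if_pos hb, assemble_apply _ _ _ _ _ _ hb, assemble_apply _ _ _ _ _ _ hb]
        rfl
      · rw [if_neg hb, if_neg hb])
    (by
      refine le_of_eq_of_le (Finset.sum_congr rfl fun J _ => ?_) hsum
      rw [mul_assoc, mul_assoc, ← Finset.prod_mul_distrib, mul_assoc]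
      congr 2
      exact Finset.prod_congr rfl fun e _ => by split_ifs <;> simp) hε
  have hμ : ∀ J : EdgeLabel D, m₁ J * (m₂ J * ∏ e, if cls e = .bulk then 1 else ν e (J e)) *
      (∏ e, if cls e = .bulk then ν e (J e) else 1) = m₁ J * m₂ J * ∏ e, ν e (J e) := fun J => by
    rw [mul_assoc, mul_assoc, ← Finset.prod_mul_distrib, mul_assoc]
    congr 2
    exact Finset.prod_congr rfl fun e _ => by split_ifs <;> simp
  simp only [hμ] at hloss hf
  have hcongr : ∀ F : EdgeLabel D → ℝ, (∀ J J', (∀ e, cls e ≠ .inner → J e = J' e) → F J = F J') ↔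
      ∀ J J', (∀ e ∈ incidentEdges G Aᶜ, J e = J' e) → F J = F J' := fun F => by
    simp only [cutClass_ne_inner hAΔ, hcls]
  exact ⟨f, hf0, hf1, (hcongr f).1 hfd, hloss, fun g hg0 hgf hg => hf g hg0 hgf ((hcongr g).2 hg)⟩

end

/-! ## Joint smoothing -/

/-- The union bound: 1 - ab ≤ (1 - a) + (1 - b) on the unit interval, iterated. -/
theorem one_sub_prod_le_sum {ι : Type*} (s : Finset ι) {f : ι → ℝ} (h0 : ∀ i, 0 ≤ f i)
    (h1 : ∀ i, f i ≤ 1) : 1 - ∏ i ∈ s, f i ≤ ∑ i ∈ s, (1 - f i) := by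
  classical
  induction s using Finset.induction_on with
  | empty => simp
  | insert a s ha ih =>
    rw [Finset.prod_insert ha, Finset.sum_insert ha]
    have hp0 : 0 ≤ ∏ i ∈ s, f i := Finset.prod_nonneg fun i _ => h0 i
    have hp1 : ∏ i ∈ s, f i ≤ 1 := Finset.prod_le_one (fun i _ => h0 i) fun i _ => h1 i
    nlinarith [h0 a, h1 a]

theorem prod_le_apply {ι : Type*} {s : Finset ι} {f : ι → ℝ} (h0 : ∀ i, 0 ≤ f i)
    (h1 : ∀ i, f i ≤ 1) {i : ι} (hi : i ∈ s) : ∏ j ∈ s, f j ≤ f i := by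
  classical
  rw [← Finset.mul_prod_erase s f hi]
  exact mul_le_of_le_one_right (h0 i) (Finset.prod_le_one (fun i _ => h0 i) fun i _ => h1 i)

/-- A cut is determined by its bulk part, since its boundary part is A. -/
theorem ncard_cuts_le {V : Type*} [Finite V] (bdry A : Set V) :
    (cuts bdry A).ncard ≤ 2 ^ (bdryᶜ).ncard := by
  rw [← Set.ncard_powerset]
  refine Set.ncard_le_ncard_of_injOn (fun Δ => Δ ∩ bdryᶜ) (fun Δ _ => Set.inter_subset_right)
    (fun Δ hΔ Δ' hΔ' h => ?_)
  rw [← Set.inter_union_compl Δ bdry, ← Set.inter_union_compl Δ' bdry, show Δ ∩ bdry = A from hΔ,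
    show Δ' ∩ bdry = A from hΔ', show Δ ∩ bdryᶜ = Δ' ∩ bdryᶜ from h]

/-- With δ the lost weight, the overlap is at least ∑ μ f and the defect term at least 1 - ∑ μ. So
the generalized fidelity is at least 1 - δ, and 1 - (1 - δ)² ≤ 2δ. -/
theorem purifiedDistance_pureState_le {ι m : Type*} [Fintype m] [DecidableEq m] [Fintype ι]
    [DecidableEq ι] {v : ι → m → ℂ} (hv : ∀ i j, star (v i) ⬝ᵥ v j = if i = j then 1 else 0)
    {μ f : ι → ℝ} (hμ : ∀ i, 0 ≤ μ i) (hμ1 : ∑ i, μ i ≤ 1) (hf0 : ∀ i, 0 ≤ f i)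
    (hf1 : ∀ i, f i ≤ 1) :
    purifiedDistance (pureState (∑ i, ((√(μ i) : ℝ) : ℂ) • v i))
        (pureState (∑ i, ((√(μ i * f i) : ℝ) : ℂ) • v i)) ≤
      √(2 * ∑ i, μ i * (1 - f i)) := by
  have hdot : ∀ a b : ι → ℝ, star (∑ i, ((a i : ℝ) : ℂ) • v i) ⬝ᵥ (∑ i, ((b i : ℝ) : ℂ) • v i) =
      ((∑ i, a i * b i : ℝ) : ℂ) := fun a b => by
    simp [star_sum, sum_dotProduct, dotProduct_sum, smul_dotProduct, dotProduct_smul, hv, mul_comm]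
  have htr : ∀ a : ι → ℝ, (∀ i, 0 ≤ a i) →
      (pureState (∑ i, ((√(a i) : ℝ) : ℂ) • v i)).trace.re = ∑ i, a i := fun a ha => by
    have := hdot (fun i => √(a i)) fun i => √(a i)
    rw [star_dotProduct_self_eq] at this
    rw [trace_pureState, Complex.ofReal_inj.1 this]
    exact Finset.sum_congr rfl fun i _ => Real.mul_self_sqrt (ha i)
  have hμf : ∀ i, 0 ≤ μ i * f i := fun i => mul_nonneg (hμ i) (hf0 i)
  have hδ : ∑ i, μ i * (1 - f i) = ∑ i, μ i - ∑ i, μ i * f i := by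
    simp only [mul_sub, mul_one, Finset.sum_sub_distrib]
  have hle : ∑ i, μ i * f i ≤ ∑ i, μ i :=
    Finset.sum_le_sum fun i _ => mul_le_of_le_one_right (hμ i) (hf1 i)
  have h0 : 0 ≤ ∑ i, μ i * f i := Finset.sum_nonneg fun i _ => hμf i
  have hF : ∑ i, μ i * f i ≤ fidelity (pureState (∑ i, ((√(μ i) : ℝ) : ℂ) • v i))
      (pureState (∑ i, ((√(μ i * f i) : ℝ) : ℂ) • v i)) := by
    rw [fidelity_pureState, hdot, Complex.norm_real, Real.norm_eq_abs]
    refine le_trans (Finset.sum_le_sum fun i _ => ?_) (le_abs_self _)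
    rw [← Real.sqrt_mul (hμ i)]
    refine Real.le_sqrt_of_sq_le ?_
    have : μ i * f i * (μ i * f i) ≤ μ i * (μ i * f i) :=
      mul_le_mul_of_nonneg_right (mul_le_of_le_one_right (hμ i) (hf1 i)) (hμf i)
    nlinarith
  have hS : 1 - ∑ i, μ i ≤ √((1 - ∑ i, μ i) * (1 - ∑ i, μ i * f i)) := by
    refine Real.le_sqrt_of_sq_le ?_
    nlinarith
  rw [purifiedDistance]
  refine Real.sqrt_le_sqrt ?_
  rw [generalizedFidelity, htr μ hμ, htr _ hμf, hδ]
  set F := fidelity (pureState (∑ i, ((√(μ i) : ℝ) : ℂ) • v i))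
    (pureState (∑ i, ((√(μ i * f i) : ℝ) : ℂ) • v i)) +
      √((1 - ∑ i, μ i) * (1 - ∑ i, μ i * f i))
  have hF1 : 1 - (∑ i, μ i - ∑ i, μ i * f i) ≤ F := by linarith [add_le_add hF hS]
  nlinarith [sq_nonneg (∑ i, μ i - ∑ i, μ i * f i)]

theorem mainTheorem9 {V : Type*} [Fintype V] (G : SimpleGraph V) (D : G.edgeSet → ℕ)
    (bdry A : Set V) (hA : A ⊆ bdry)
    (hdisj : Disjoint (incidentEdges G A) (incidentEdges G (bdry \ A)))
    (v₁ : Config D (halfEdgesOf (incidentEdges G A)) → ℂ)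
    (v₂ : Config D (halfEdgesOf (incidentEdges G (bdry \ A))) → ℂ)
    (w : (e : G.edgeSet) → Config D (halfEdgesOf {e}) → ℂ)
    (hv₁ : HasStandardSchmidt (incidentEdges G A) v₁)
    (hv₂ : HasStandardSchmidt (incidentEdges G (bdry \ A)) v₂)
    (φ : Matrix (FullConfig D) (FullConfig D) ℂ)
    (hφ : φ = pureState
      (backgroundVector (incidentEdges G A) (incidentEdges G (bdry \ A)) v₁ v₂ w))
    (hφ_sub : IsSubState φ) (ε : ℝ) (hε : 0 ≤ ε) :
    ∃ φε : Matrix (FullConfig D) (FullConfig D) ℂ, IsSubState φε ∧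
      purifiedDistance φ φε ≤ 2 * √(2 ^ (bdryᶜ).ncard * ε) ∧
      ∀ Δ ∈ cuts bdry A,
        smoothCondMinEntropy ε
            (reducedState (halfEdgesAt G (Δ \ A))
              (halfEdgesAt G A ∪ outerHalfEdges G A Δ) φ) ≤
          condMinEntropy
            (reducedState (halfEdgesAt G (Δ \ A)) (halfEdgesAt G A) φε) := by
  classical
  have : Fintype G.edgeSet := Fintype.ofFinite _
  obtain ⟨B, m₁, m₂, ν, hB, h₁, h₂, hν, d₁, d₂, hν1, hvec⟩ :=
    exists_backgroundVector_eq_sum hdisj w hv₁ hv₂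
  rw [hvec] at hφ
  set μ : EdgeLabel D → ℝ := fun J => m₁ J * m₂ J * ∏ e, ν e (J e) with hμ
  have hμ0 : ∀ J, 0 ≤ μ J := fun J =>
    mul_nonneg (mul_nonneg (h₁ J) (h₂ J)) (Finset.prod_nonneg fun e _ => hν _ _)
  have htr : ∀ a : EdgeLabel D → ℝ, (∀ J, 0 ≤ a J) →
      (pureState (∑ J, ((√(a J) : ℝ) : ℂ) • B.fullVec J)).trace.re = ∑ J, a J := fun a ha => by
    have h : star (∑ J, ((√(a J) : ℝ) : ℂ) • B.fullVec J) ⬝ᵥ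
        (∑ J, ((√(a J) : ℝ) : ℂ) • B.fullVec J) = ((∑ J, √(a J) * √(a J) : ℝ) : ℂ) := by
      simp [star_sum, sum_dotProduct, dotProduct_sum, smul_dotProduct, dotProduct_smul,
        hB.star_fullVec_dotProduct]
    rw [star_dotProduct_self_eq] at h
    rw [trace_pureState, Complex.ofReal_inj.1 h]
    exact Finset.sum_congr rfl fun J _ => Real.mul_self_sqrt (ha J)
  have hμ1 : ∑ J, μ J ≤ 1 := by
    rw [← htr μ hμ0, ← hφ]
    exact hφ_sub.2
  have hfilter : ∀ Δ : Set V, ∃ f : EdgeLabel D → ℝ, (∀ J, 0 ≤ f J) ∧ (∀ J, f J ≤ 1) ∧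
      (∀ J J', (∀ e ∈ incidentEdges G Aᶜ, J e = J' e) → f J = f J') ∧
      (∑ J, μ J * (1 - f J) ≤ ε) ∧ (Δ ∈ cuts bdry A →
      ∀ g : EdgeLabel D → ℝ, (∀ J, 0 ≤ g J) → (∀ J, g J ≤ f J) →
        (∀ J J', (∀ e ∈ incidentEdges G Aᶜ, J e = J' e) → g J = g J') →
        smoothCondMinEntropy ε (reducedState (halfEdgesAt G (Δ \ A))
            (halfEdgesAt G A ∪ outerHalfEdges G A Δ)
            (pureState (∑ J, ((√(μ J) : ℝ) : ℂ) • B.fullVec J))) ≤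
          condMinEntropy (reducedState (halfEdgesAt G (Δ \ A)) (halfEdgesAt G A)
            (pureState (∑ J, ((√(μ J * g J) : ℝ) : ℂ) • B.fullVec J)))) := by
    intro Δ
    by_cases hne : Δ ∈ cuts bdry A ∧ Nonempty (EdgeLabel D)
    · obtain ⟨hΔ, ⟨J₀⟩⟩ := hne
      obtain ⟨f, hf0, hf1, hfd, hloss, hf⟩ := exists_cutFilter hdisj hΔ hB h₁ h₂ hν d₁ d₂ hν1 J₀
        hμ1 hε
      exact ⟨f, hf0, hf1, hfd, hloss, fun _ => hf⟩
    -- Nothing is required if Δ is not a cut. Otherwise there are no edge labels at all (some bond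
    -- dimension is zero), the state is 0 and its min-entropy is ⊤.
    · refine ⟨fun _ => 1, fun _ => zero_le_one, fun _ => le_rfl, fun _ _ _ => rfl,
        by simpa using hε, fun hΔ g _ _ _ => ?_⟩
      have : IsEmpty (EdgeLabel D) := not_nonempty_iff.1 fun h => hne ⟨hΔ, h⟩
      have h0 : reducedState (halfEdgesAt G (Δ \ A)) (halfEdgesAt G A)
          (pureState (∑ J, ((√(μ J * g J) : ℝ) : ℂ) • B.fullVec J)) = 0 := by
        ext p q
        simp [reducedState, pureState, vecMulVec_apply]
      rw [h0, condMinEntropy_zero]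
      exact le_top
  choose f hf0 hf1 hfd hloss hf using hfilter
  set s : Finset (Set V) := (Set.toFinite (cuts bdry A)).toFinset with hs
  -- The product lies below each factor and ignores the labels inside A, so it is admissible for
  -- every cut.
  set g : EdgeLabel D → ℝ := fun J => ∏ Δ ∈ s, f Δ J with hg
  have hg0 : ∀ J, 0 ≤ g J := fun J => Finset.prod_nonneg fun Δ _ => hf0 Δ J
  have hg1 : ∀ J, g J ≤ 1 := fun J => Finset.prod_le_one (fun Δ _ => hf0 Δ J) fun Δ _ => hf1 Δ J
  have hgd : ∀ J J', (∀ e ∈ incidentEdges G Aᶜ, J e = J' e) → g J = g J' := fun J J' h =>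
    Finset.prod_congr rfl fun Δ _ => hfd Δ J J' h
  have hgloss : ∑ J, μ J * (1 - g J) ≤ 2 ^ (bdryᶜ).ncard * ε := by
    calc ∑ J, μ J * (1 - g J) ≤ ∑ J, μ J * ∑ Δ ∈ s, (1 - f Δ J) :=
          Finset.sum_le_sum fun J _ => mul_le_mul_of_nonneg_left
            (one_sub_prod_le_sum s (fun Δ => hf0 Δ J) fun Δ => hf1 Δ J) (hμ0 J)
      _ = ∑ Δ ∈ s, ∑ J, μ J * (1 - f Δ J) := by
          simp only [Finset.mul_sum]
          exact Finset.sum_comm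
      _ ≤ ∑ Δ ∈ s, ε := Finset.sum_le_sum fun Δ _ => hloss Δ
      _ = (cuts bdry A).ncard * ε := by
          rw [Finset.sum_const, nsmul_eq_mul, Set.ncard_eq_toFinset_card _ (Set.toFinite _)]
      _ ≤ 2 ^ (bdryᶜ).ncard * ε := by
          refine mul_le_mul_of_nonneg_right ?_ hε
          exact_mod_cast ncard_cuts_le bdry A
  refine ⟨pureState (∑ J, ((√(μ J * g J) : ℝ) : ℂ) • B.fullVec J),
    ⟨pureState_posSemidef _, ?_⟩, ?_, fun Δ hΔ => ?_⟩
  · rw [htr (fun J => μ J * g J) fun J => mul_nonneg (hμ0 J) (hg0 J)]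
    exact (Finset.sum_le_sum fun J _ => mul_le_of_le_one_right (hμ0 J) (hg1 J)).trans hμ1
  · rw [hφ]
    refine (purifiedDistance_pureState_le (fun J J' => by
      rw [hB.star_fullVec_dotProduct]) hμ0 hμ1 hg0 hg1).trans ?_
    -- The lost weight δ is at most this quantity x, and √(2δ) ≤ √(2x) ≤ 2√x.
    have h0 : 0 ≤ (2 : ℝ) ^ (bdryᶜ).ncard * ε := by positivity
    refine Real.sqrt_le_iff.2 ⟨by positivity, ?_⟩
    rw [mul_pow, Real.sq_sqrt h0]
    linarith
  · rw [hφ]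
    exact hf Δ hΔ g hg0 (fun J => prod_le_apply (fun Δ => hf0 Δ J) (fun Δ => hf1 Δ J)
      ((Set.toFinite (cuts bdry A)).mem_toFinset.2 hΔ)) hgd
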